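/- **Setting.** Let $M\cong\mathbb Z^l$ be a lattice, $N=M^\vee$, and let $\Delta\subset M$ be the set of lattice points of a full-dimensional integral convex polytope. Let $w=\{w_m\}_{m\in\Delta}$ be a real-valued convex function on $\Delta$ (it has a supporting affine function at each $m\in\Delta$) whose induced polyhedral decomposition $Z$ of $\Delta$ is simplicial: $S\in Z$ iff $\emptyset\neq S\subset\Delta$ and for some affine function $\alpha$ one has $w=\alpha$ on $S$ and $w>\alpha$ on $\Delta\setminus S$, and each such $S$ is affinely independent. Let $Z_{\rm top}$ be the set of simplices of $Z$ with $l+1$ vertices. Let $s_m$ be the monomial on $N_{\mathbb C^*}\cong(\mathbb C^*)^l$ given by $m$. For $0<|t|<1$ with a chosen branch of $\log t$, put $t^r=e^{r\log t}$ and $\tau=-\log|t|$; let $X_t=\{\sum_{m\in\Delta}t^{w_m}s_m=0\}\subset N_{\mathbb C^*}$. For a constant $\kappa>0$ put $$\eta_m=\frac{|t^{w_m}s_m|^2}{\sum_{m'\in\Delta}|t^{w_{m'}}s_{m'}|^2},\qquad a_m=\kappa-\log\eta_m,\qquad h_t=\kappa^2\sum_{S\in Z_{\rm top}}\Big(\prod_{m\in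 S}a_m\Big)^{-2},$$ and let $g_t$ be the Kähler metric on $X_t$ with Kähler form the restriction of $\frac{i}{2\pi}\partial\bar\partial\big(\log\sum_{m\in\Delta}|t^{w_m}s_m|^2+\log h_t\big)$. Let $S_1=\{m_0,m_1\}\in Z$ be a $1$-simplex (it corresponds to a maximal degeneracy point $O$), and let $S_*=\{m_0,m_1,\dots,m_l\}\in Z_{\rm top}$ contain $S_1$. Adjust $w$ by a real affine function so that $w_{m_0}=w_{m_1}=0$ and $w_m>0$ for $m\in\Delta\setminus S_1$. Let $\hat T=\{p\in N_{\mathbb C^*}: s_{m_1}(p)=-s_{m_0}(p)\}$, $\hat N=(m_1-m_0)^\perp\subset N$, and let $F:\hat T\to\hat N_{\mathbb R}$ be given by $F(p)_i=-\log|p_i|$. Let $\Delta_{S_1}=\bigcup_{S_1\subset S\in Z}(S\setminus S_1)$ and $$\Delta_\tau=\{x\in\hat N_{\mathbb R}:\langle m-m_0,x\rangle+\tau w_m\ge 0\ \text{for all } m\in\Delta_{S_1}\},$$ and more generally, for real $\sigma$, let $\Delta_{\sigma}$ be given by the same formula with $\sigma$ in place of $\tau$. Let $g_t^{\rm tor}$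 be the metric with Kähler form $\frac{i}{2\pi}\partial\bar\partial\log\hat h_t$ on the interior of $F^{-1}(\Delta_\tau)$, where $$\hat h_t=\sum_{S_1\subset S\in Z_{\rm top}}\ \prod_{m\in S\setminus S_1}\hat a_m^{-2},\qquad \hat a_m=-\log\big|t^{w_m}s_m/s_{m_0}\big|^2 .$$ Points of $\hat T$ and of $X_t$ near $O$ are identified through the coordinates $z_k=s_{m_k}/s_{m_0}$, $2\le k\le l$: $p\in\hat T$ corresponds to $x=\exp(u)\cdot p\in X_t$, where $u\in N_{\mathbb C}$, $\langle m_k-m_0,u\rangle=0$ for $2\le k\le l$, and $|\langle m_1-m_0,u\rangle|<1$. Let $g,g'$ be Riemannian metrics near a set $K$. The metric $g$ is called $C^\infty$-quasi-isometric to $g'$ on $K$ if on $K$ there is $C>0$ with $C^{-1}g\le g'\le Cg$, the curvature of $g$ and all its covariant derivatives are bounded, and $g'$ and all its covariant derivatives with respect to $g$ are bounded in the norm of $g$. It is so uniformly for a family if all these bounds (one for each order of differentiation) can be chosen the same for the whole family. **Lemma.** For all sufficiently large $\kappa$ (depending only on $\Delta$ and the original $w$), and for all $S_1$, $S_*$ and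 normalizations of $w$ as above, there are constants $\mu>0$ and $\tau_0$ such that for all $t$ and all branches of $\log t$ with $\tau\ge\tau_0$: 1. near $F^{-1}(\Delta_{\tau-\mu})$ each point of $\hat T$ corresponds to exactly one point of $X_t$, and the resulting identification map is holomorphic; 2. on $F^{-1}(\Delta_{\tau-\mu})$ the metric $g_t^{\rm tor}$ is $C^\infty$-quasi-isometric to $g_t$ (transported by the identification), uniformly for all $t$ and all branches of $\log t$ with $\tau\ge\tau_0$. -/

import Mathlib

open scoped ContDiff Topology

noncomputable section

namespace ToricDegeneration

/-! ### Riemannian geometry in a coordinate chart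

A chart is a real normed space `E`; tensor fields are functions on `E`. -/

section Riemannian

variable {E : Type*} [NormedAddCommGroup E] [NormedSpace ℝ E]

/-- A field of bilinear forms on `E`. -/
abbrev MetricField (E : Type*) [NormedAddCommGroup E] [NormedSpace ℝ E] : Type _ :=
  E → E →L[ℝ] E →L[ℝ] ℝ

/-- A covariant tensor field of rank `k` on `E`: the value at `x` on the vectors `a 0, …, a (k-1)`. -/
abbrev TensorField (E : Type*) (k : ℕ) : Type _ := E → (Fin k → E) → ℝ

/-- `g` is a smooth Riemannian metric on a neighbourhood of `x`. -/
def IsRiemannianNear (g : MetricField E) (x : E) : Prop :=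
  ∀ᶠ y in 𝓝 x, ContDiffAt ℝ ∞ g y ∧ (∀ u v, g y u v = g y v u) ∧ ∀ v, v ≠ 0 → 0 < g y v v

/-- The Koszul form
`w ↦ (1/2) ((D_u g)(v, w) + (D_v g)(u, w) - (D_w g)(u, v))` for constant fields `u`, `v`. -/
def koszulForm (g : MetricField E) (x u v : E) : E →L[ℝ] ℝ :=
  (1 / 2 : ℝ) •
    (fderiv ℝ g x u v + fderiv ℝ g x v u - ((fderiv ℝ g x).flip u).flip v)

/-- The Christoffel symbols `Γ(u, v)` of the Levi-Civita connection, that is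
`g (Γ(u, v), w) = koszulForm g x u v w` for all `w`. -/
def christoffel (g : MetricField E) (x u v : E) : E :=
  (g x).inverse (koszulForm g x u v)

/-- The covariant derivative of a covariant tensor field; the new slot is the first one:
`(∇T)(a₀, a₁, …, a_k) = (D_{a₀} T)(a₁, …, a_k) - ∑ᵢ T(a₁, …, Γ(a₀, aᵢ), …, a_k)`. -/
def covDeriv (g : MetricField E) {k : ℕ} (T : TensorField E k) : TensorField E (k + 1) :=
  fun x a =>
    fderiv ℝ (fun y => T y (Fin.tail a)) x (a 0) -
      ∑ i : Fin k, T x (Function.update (Fin.tail a) i (christoffel g x (a 0) (Fin.tail a i)))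

/-- The `j`-th covariant derivative `∇ʲT`. -/
def iterCovDeriv (g : MetricField E) {k : ℕ} (T : TensorField E k) :
    (j : ℕ) → TensorField E (k + j)
  | 0 => T
  | j + 1 => covDeriv g (iterCovDeriv g T j)

/-- The Riemann curvature operator `R(u, v) w`. -/
def curvatureOperator (g : MetricField E) (x u v w : E) : E :=
  fderiv ℝ (fun y => christoffel g y v w) x u - fderiv ℝ (fun y => christoffel g y u w) x v
    + christoffel g x u (christoffel g x v w) - christoffel g x v (christoffel g x u w)

/-- The Riemann curvature tensor, as a covariant tensor of rank four. -/
def curvatureTensor (g : MetricField E) : TensorField E 4 :=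
  fun x a => g x (curvatureOperator g x (a 0) (a 1) (a 2)) (a 3)

/-- A metric, as a covariant tensor of rank two. -/
def metricTensor (g : MetricField E) : TensorField E 2 :=
  fun x a => g x (a 0) (a 1)

/-- The norm of the tensor `T` at `x` with respect to `g` is at most `C`. -/
def TensorBound (g : MetricField E) (C : ℝ) {k : ℕ} (T : TensorField E k) (x : E) : Prop :=
  ∀ a : Fin k → E, |T x a| ≤ C * ∏ i, Real.sqrt (g x (a i) (a i))

/-- `g i` is `C^∞`-quasi-isometric to `g' i` on `K i`, with constants that are the same for all
members `i ∈ I` of the family: both are Riemannian metrics, they are quasi-isometric, the curvature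
of `g i` and all its covariant derivatives are bounded, and `g' i` and all its covariant
derivatives with respect to `g i` are bounded in the norm of `g i`. -/
structure UniformlyCInftyQuasiIsometric {ι : Type*} (I : Set ι) (K : ι → Set E)
    (g g' : ι → MetricField E) : Prop where
  riemannian : ∀ i ∈ I, ∀ x ∈ K i, IsRiemannianNear (g i) x ∧ IsRiemannianNear (g' i) x
  quasiIsometric : ∃ C : ℝ, 0 < C ∧ ∀ i ∈ I, ∀ x ∈ K i, ∀ v,
    g' i x v v ≤ C * g i x v v ∧ g i x v v ≤ C * g' i x v v
  curvatureBounded : ∀ j : ℕ, ∃ C : ℝ, ∀ i ∈ I, ∀ x ∈ K i,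
    TensorBound (g i) C (iterCovDeriv (g i) (curvatureTensor (g i)) j) x
  metricBounded : ∀ j : ℕ, ∃ C : ℝ, ∀ i ∈ I, ∀ x ∈ K i,
    TensorBound (g i) C (iterCovDeriv (g i) (metricTensor (g' i)) j) x

end Riemannian

/-- The symmetric form `g(u, v) = ω(u, J v)` of `ω = (i / 2π) ∂∂̄ φ` on a complex normed space:
`g(u, v) = (1 / 4π) (D²φ(u, v) + D²φ(iu, iv))`. It is the Kähler metric with potential `φ`
wherever it is positive. -/
def kahlerMetric {E : Type*} [NormedAddCommGroup E] [NormedSpace ℂ E] (φ : E → ℝ) :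
    MetricField E :=
  fun x =>
    let J : E →L[ℝ] E := (Complex.I • ContinuousLinearMap.id ℂ E).restrictScalars ℝ
    let H : E →L[ℝ] E →L[ℝ] ℝ := fderiv ℝ (fderiv ℝ φ) x
    (1 / (4 * Real.pi) : ℝ) • (H + H.bilinearComp J J)

/-! ### Lattice polytopes and regular simplicial decompositions -/

/-- The point of `M_ℝ = ℝˡ` given by a point of the lattice `M = ℤˡ`. -/
def toReal {l : ℕ} (m : Fin l → ℤ) : Fin l → ℝ := fun i => (m i : ℝ)

/-- The pairing of `m ∈ M` with `N ⊗ R`. -/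
def pairing {l : ℕ} {R : Type*} [Ring R] (m : Fin l → ℤ) (v : Fin l → R) : R :=
  ∑ i, (m i : R) * v i

/-- `Δ` is the set of all lattice points of a full-dimensional integral convex polytope. -/
def IsIntegralPolytope {l : ℕ} (Δ : Finset (Fin l → ℤ)) : Prop :=
  affineSpan ℝ (toReal '' (Δ : Set (Fin l → ℤ))) = ⊤ ∧
    ∀ m, toReal m ∈ convexHull ℝ (toReal '' (Δ : Set (Fin l → ℤ))) → m ∈ Δ

/-- `w` is a convex function on `Δ`: it has a supporting affine function at each point. -/
def IsConvexOn {l : ℕ} (Δ : Finset (Fin l → ℤ)) (w : (Fin l → ℤ) → ℝ) : Prop :=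
  ∀ m ∈ Δ, ∃ (c : ℝ) (b : Fin l → ℝ),
    w m = c + pairing m b ∧ ∀ m' ∈ Δ, c + pairing m' b ≤ w m'

/-- `S` is a cell of the polyhedral decomposition of `Δ` determined by `w`. -/
def IsCell {l : ℕ} (Δ : Finset (Fin l → ℤ)) (w : (Fin l → ℤ) → ℝ) (S : Finset (Fin l → ℤ)) :
    Prop :=
  S.Nonempty ∧ S ⊆ Δ ∧ ∃ (c : ℝ) (b : Fin l → ℝ),
    (∀ m ∈ S, w m = c + pairing m b) ∧ ∀ m ∈ Δ, m ∉ S → c + pairing m b < w m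

/-- The decomposition determined by `w` is simplicial. -/
def IsSimplicial {l : ℕ} (Δ : Finset (Fin l → ℤ)) (w : (Fin l → ℤ) → ℝ) : Prop :=
  ∀ S, IsCell Δ w S → AffineIndependent ℝ (fun m : S => toReal (m : Fin l → ℤ))

open Classical in
/-- The top dimensional simplices of the decomposition. -/
def topCells {l : ℕ} (Δ : Finset (Fin l → ℤ)) (w : (Fin l → ℤ) → ℝ) :
    Finset (Finset (Fin l → ℤ)) :=
  Δ.powerset.filter (fun S => IsCell Δ w S ∧ S.card = l + 1)

/-! ### The hypersurfaces `X_t` and the metrics `g_t`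

The parameter `t` is given by a logarithm `L`, `t = exp L`, so that `t ^ r = exp (r L)` makes sense
for real exponents; thus `τ = -log |t| = -re L`. -/

/-- The power `t ^ r` for `t = exp L`. -/
def tpow (L : ℂ) (r : ℝ) : ℂ := Complex.exp ((r : ℂ) * L)

/-- The monomial `s_m`. -/
def monomial {l : ℕ} (m : Fin l → ℤ) (z : Fin l → ℂ) : ℂ := ∏ i, z i ^ m i

/-- The hypersurface `X_t = {∑ t ^ (w m) s_m = 0}` in the complex torus. -/
def hypersurface {l : ℕ} (Δ : Finset (Fin l → ℤ)) (w : (Fin l → ℤ) → ℝ) (L : ℂ) :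
    Set (Fin l → ℂ) :=
  {z | (∀ i, z i ≠ 0) ∧ ∑ m ∈ Δ, tpow L (w m) * monomial m z = 0}

/-- The sum `∑ |t ^ (w m) s_m|²`; its logarithm is the pullback of the Fubini-Study potential
under the embedding with homogeneous coordinates `t ^ (w m) s_m`. -/
def sumSq {l : ℕ} (Δ : Finset (Fin l → ℤ)) (w : (Fin l → ℤ) → ℝ) (L : ℂ) (z : Fin l → ℂ) : ℝ :=
  ∑ m ∈ Δ, ‖tpow L (w m) * monomial m z‖ ^ 2

/-- `η_m = |t ^ (w m) s_m|² / ∑ |t ^ (w m') s_m'|²`. -/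
def eta {l : ℕ} (Δ : Finset (Fin l → ℤ)) (w : (Fin l → ℤ) → ℝ) (L : ℂ) (m : Fin l → ℤ)
    (z : Fin l → ℂ) : ℝ :=
  ‖tpow L (w m) * monomial m z‖ ^ 2 / sumSq Δ w L z

/-- `a_m = κ - log η_m`. -/
def aFun {l : ℕ} (Δ : Finset (Fin l → ℤ)) (w : (Fin l → ℤ) → ℝ) (κ : ℝ) (L : ℂ)
    (m : Fin l → ℤ) (z : Fin l → ℂ) : ℝ :=
  κ - Real.log (eta Δ w L m z)

/-- `h_t = κ² ∑_S (∏_{m ∈ S} a_m)⁻²`, the sum over the top dimensional simplices. -/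
def hFun {l : ℕ} (Δ : Finset (Fin l → ℤ)) (w : (Fin l → ℤ) → ℝ) (κ : ℝ) (L : ℂ)
    (z : Fin l → ℂ) : ℝ :=
  κ ^ 2 * ∑ S ∈ topCells Δ w, ((∏ m ∈ S, aFun Δ w κ L m z)⁻¹) ^ 2

/-- The potential of the approximate metric `g_t`, whose Kähler form is the restriction to `X_t`
of `ω_FS + (i / 2π) ∂∂̄ log h_t`. -/
def approxPotential {l : ℕ} (Δ : Finset (Fin l → ℤ)) (w : (Fin l → ℤ) → ℝ) (κ : ℝ) (L : ℂ)
    (z : Fin l → ℂ) : ℝ :=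
  Real.log (sumSq Δ w L z) + Real.log (hFun Δ w κ L z)

/-! ### The toric model near a maximal degeneracy point

The point is given by a one dimensional simplex `{m₀, m₁}`, and `w` is normalized by
`w m₀ = w m₁ = 0`. Characters of the torus `T̂` are written `m - m₀`. -/

/-- The torus `T̂ = {s_{m₁} = - s_{m₀}}`. -/
def toricTorus {l : ℕ} (m₀ m₁ : Fin l → ℤ) : Set (Fin l → ℂ) :=
  {p | (∀ i, p i ≠ 0) ∧ monomial m₁ p = -monomial m₀ p}

/-- The Lie algebra `N̂_ℂ = (m₁ - m₀)^⊥` of the group that acts simply transitively on `T̂`. -/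
def toricLie {l : ℕ} (m₀ m₁ : Fin l → ℤ) : Submodule ℂ (Fin l → ℂ) where
  carrier := {v | pairing (m₁ - m₀) v = 0}
  zero_mem' := by simp [pairing]
  add_mem' := by
    intro u v hu hv
    simp only [pairing, Set.mem_ofPred_eq, Pi.add_apply, mul_add, Finset.sum_add_distrib] at *
    rw [hu, hv, add_zero]
  smul_mem' := by
    intro c v hv
    simp only [pairing, Set.mem_ofPred_eq, Pi.smul_apply, smul_eq_mul] at *
    rw [← mul_zero c, ← hv, Finset.mul_sum]
    exact Finset.sum_congr rfl fun i _ => by ring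

/-- The action of `exp v` on the torus; `v ↦ torusExp v p` is a holomorphic chart of `T̂` near
`p ∈ T̂` (and a covering of the component of `p`), where `v` ranges over `toricLie m₀ m₁`. -/
def torusExp {l : ℕ} (v p : Fin l → ℂ) : Fin l → ℂ := fun i => Complex.exp (v i) * p i

/-- The vertices `m ∉ {m₀, m₁}` of the simplices that contain `{m₀, m₁}`. -/
def linkVertices {l : ℕ} (Δ : Finset (Fin l → ℤ)) (w : (Fin l → ℤ) → ℝ) (m₀ m₁ : Fin l → ℤ) :
    Set (Fin l → ℤ) :=
  {m | ∃ S, IsCell Δ w S ∧ m₀ ∈ S ∧ m₁ ∈ S ∧ m ∈ S ∧ m ≠ m₀ ∧ m ≠ m₁}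

/-- The moment map `F`, normalized by `|s_m(p)| = exp (-⟨m, F p⟩)`. -/
def momentMap {l : ℕ} (p : Fin l → ℂ) : Fin l → ℝ := fun i => -Real.log ‖p i‖

/-- The polyhedron `Δ_τ` in `N̂_ℝ = (m₁ - m₀)^⊥`. -/
def polyhedron {l : ℕ} (Δ : Finset (Fin l → ℤ)) (w : (Fin l → ℤ) → ℝ) (m₀ m₁ : Fin l → ℤ)
    (τ : ℝ) : Set (Fin l → ℝ) :=
  {x | pairing (m₁ - m₀) x = 0 ∧
    ∀ m ∈ linkVertices Δ w m₀ m₁, 0 ≤ pairing (m - m₀) x + τ * w m}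

/-- `F⁻¹(Δ_τ)` in `T̂`. -/
def toricRegion {l : ℕ} (Δ : Finset (Fin l → ℤ)) (w : (Fin l → ℤ) → ℝ) (m₀ m₁ : Fin l → ℤ)
    (τ : ℝ) : Set (Fin l → ℂ) :=
  {p | p ∈ toricTorus m₀ m₁ ∧ momentMap p ∈ polyhedron Δ w m₀ m₁ τ}

/-- `â_m = -log |t ^ (w m) ŝ_m|²` with `ŝ_m = s_m / s_{m₀}`. -/
def hatA {l : ℕ} (w : (Fin l → ℤ) → ℝ) (L : ℂ) (m₀ m : Fin l → ℤ) (p : Fin l → ℂ) : ℝ :=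
  -Real.log (‖tpow L (w m) * (monomial m p / monomial m₀ p)‖ ^ 2)

open Classical in
/-- `ĥ_t = ∑_Ŝ (∏_{m ∈ Ŝ} â_m)⁻²`, the sum over `Ŝ = S \ {m₀, m₁}` for the top dimensional
simplices `S` that contain `{m₀, m₁}`. -/
def hatH {l : ℕ} (Δ : Finset (Fin l → ℤ)) (w : (Fin l → ℤ) → ℝ) (L : ℂ) (m₀ m₁ : Fin l → ℤ)
    (p : Fin l → ℂ) : ℝ :=
  ∑ S ∈ (topCells Δ w).filter (fun S => m₀ ∈ S ∧ m₁ ∈ S),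
    ((∏ m ∈ S \ {m₀, m₁}, hatA w L m₀ m p)⁻¹) ^ 2

/-- The potential `log ĥ_t` of the toric metric. -/
def toricPotential {l : ℕ} (Δ : Finset (Fin l → ℤ)) (w : (Fin l → ℤ) → ℝ) (L : ℂ)
    (m₀ m₁ : Fin l → ℤ) (p : Fin l → ℂ) : ℝ :=
  Real.log (hatH Δ w L m₀ m₁ p)

/-- The point `x` of `X_t` near the maximal degeneracy point is identified with the point `p` of
`T̂` through the simplex `S = {m₀, m₁, …, m_l}`: the coordinates `z_k = s_{m_k} / s_{m₀}`, `k ≥ 2`,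
of the two points agree, and `z₁ = s_{m₁} / s_{m₀}`, which is `-1` at `p`, is near `-1` at `x`. This
is written additively, as `x = exp u • p`, which also fixes the branch when the `z_k` are only
coordinates on a finite quotient of the torus. -/
def IsIdentified {l : ℕ} (Δ : Finset (Fin l → ℤ)) (w : (Fin l → ℤ) → ℝ) (L : ℂ)
    (m₀ m₁ : Fin l → ℤ) (S : Finset (Fin l → ℤ)) (p x : Fin l → ℂ) : Prop :=
  x ∈ hypersurface Δ w L ∧ ∃ u : Fin l → ℂ, x = torusExp u p ∧
    (∀ m ∈ S, m ≠ m₁ → pairing (m - m₀) u = 0) ∧ ‖pairing (m₁ - m₀) u‖ < 1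

/-- The identification map from `T̂` to `X_t` (wherever there is a unique identified point). -/
def identification {l : ℕ} (Δ : Finset (Fin l → ℤ)) (w : (Fin l → ℤ) → ℝ) (L : ℂ)
    (m₀ m₁ : Fin l → ℤ) (S : Finset (Fin l → ℤ)) (p : Fin l → ℂ) : Fin l → ℂ :=
  Classical.epsilon (IsIdentified Δ w L m₀ m₁ S p)

/-- The toric metric `g_t^tor` on `T̂`, in the chart at `p`. -/
def toricMetric {l : ℕ} (Δ : Finset (Fin l → ℤ)) (w : (Fin l → ℤ) → ℝ) (L : ℂ)
    (m₀ m₁ : Fin l → ℤ) (p : Fin l → ℂ) : MetricField (toricLie m₀ m₁) :=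
  kahlerMetric fun v => toricPotential Δ w L m₀ m₁ (torusExp (v : Fin l → ℂ) p)

/-- The metric `g_t` of `X_t`, transported to `T̂` by the (holomorphic) identification, in the
chart at `p`. -/
def approxMetric {l : ℕ} (Δ : Finset (Fin l → ℤ)) (w : (Fin l → ℤ) → ℝ) (κ : ℝ) (L : ℂ)
    (m₀ m₁ : Fin l → ℤ) (S : Finset (Fin l → ℤ)) (p : Fin l → ℂ) :
    MetricField (toricLie m₀ m₁) :=
  kahlerMetric fun v =>
    approxPotential Δ w κ L (identification Δ w L m₀ m₁ S (torusExp (v : Fin l → ℂ) p))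

end ToricDegeneration

end

/-! Near each point of the region both metrics are written in linear coordinates adapted to that
point. In these coordinates they belong to two families of metrics that depend smoothly on a
parameter in a compact set, and every bound required by the definition then follows from continuity
(`uniformlyCInftyQuasiIsometric_of_compact`).

At a point `p` put `R m = hatA m p`. These numbers are at least a constant that grows with `μ`, but
they have no common upper bound and may be of very different sizes. A ray argument on the polyhedron
(`exists_minimal_topCell`) yields a top cell `S` containing `m₀`, `m₁` with an exchange property: `R
m' ≤ C * R m` whenever `m' ∈ S` can be replaced by `m`, with `C` independent of `t` and `p`. Hence
the product of the `R m` over `S` is, up to a constant, the smallest such product over all top cells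
(`prod_le_prod_of_exchange`).

Rescale the Lie algebra by the `R m` in the basis dual to `S`. The functions `hatA m` become `R m *
(1 - 2 Re (c m ζ))`, where the functionals `c m` are bounded because of the exchange property and
form a coordinate system for `m ∈ S`. After division by the product belonging to `S`, the summands
of `hatH` have bounded weights, and that of `S` has weight one. This is `exists_scaledParam_mem`.

On the other side, a point of `X_t` near the degeneracy point is obtained from `p` by a shift `Λ z`
along a fixed direction. Here `z` is the vector of the remaining normalized monomials at `p`, and
`Λ` solves the equation of `X_t` by the inverse function theorem (`exists_localSolution`). Then
`a_m` and `hatA m` differ by a smooth function of `z`. In the rescaled coordinates each entry of `z`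
is a phase times `exp (-(1/2 - c m ζ) / r)` with `r = 1 / R m`, and this extends smoothly by zero
across `r = 0` (`contDiffAt_decay`).

So both potentials are, up to real affine functions, which do not change the metric, instances of
one model potential with parameter `(c, phases, weights, r)`. At `r = 0` the model is a constant
plus `log ∑ q_S ∏ (1 - 2 Re (c m ζ))⁻²` with nonnegative weights. Its Levi form at the origin is
positive definite by Cauchy-Schwarz (`modelPotential_posDef`). Compactness of the parameters at `r =
0` and the tube lemma give regularity for all `0 ≤ r ≤ ρ` (`exists_isRegularAt_modelPotential`).
Choosing `μ` large forces `1 / R m ≤ ρ`. -/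

noncomputable section

namespace ToricDegeneration

/-! ### Naturality of the Riemannian constructions under affine coordinate changes. -/

section Naturality

variable {E F : Type*} [NormedAddCommGroup E] [NormedSpace ℝ E] [NormedAddCommGroup F]
  [NormedSpace ℝ F]

/-- The pullback of a metric field under the affine isomorphism `ζ ↦ x + T ζ`. -/
def pullbackMetric (T : F ≃L[ℝ] E) (x : E) (g : MetricField E) : MetricField F :=
  fun ζ => (g (x + T ζ)).bilinearComp (T : F →L[ℝ] E) (T : F →L[ℝ] E)

/-- The pullback of a covariant tensor field under the affine isomorphism `ζ ↦ x + T ζ`. -/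
def pullbackTensor (T : F ≃L[ℝ] E) (x : E) {k : ℕ} (X : TensorField E k) : TensorField F k :=
  fun ζ a => X (x + T ζ) (fun i => T (a i))

/-- Precomposition with `T` in both slots of a bilinear form. -/
def bilinPull (T : F ≃L[ℝ] E) : (E →L[ℝ] E →L[ℝ] ℝ) ≃L[ℝ] (F →L[ℝ] F →L[ℝ] ℝ) :=
  T.symm.arrowCongr (T.symm.arrowCongr (ContinuousLinearEquiv.refl ℝ ℝ))

lemma bilinPull_apply (T : F ≃L[ℝ] E) (B : E →L[ℝ] E →L[ℝ] ℝ) (a b : F) :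
    bilinPull T B a b = B (T a) (T b) := by
  simp [bilinPull]

lemma fderiv_comp_affine {G : Type*} [NormedAddCommGroup G] [NormedSpace ℝ G]
    (T : F ≃L[ℝ] E) (x : E) (f : E → G) (ζ u : F) :
    fderiv ℝ (fun ζ => f (x + T ζ)) ζ u = fderiv ℝ f (x + T ζ) (T u) := by
  have h := T.comp_right_fderiv (f := fun y => f (x + y)) (x := ζ)
  rw [fderiv_comp_add_left] at h
  exact congrArg (fun A => A u) h

lemma pullbackMetric_eq (T : F ≃L[ℝ] E) (x : E) (g : MetricField E) :
    pullbackMetric T x g = fun ζ => bilinPull T (g (x + T ζ)) := by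
  funext ζ
  ext a b
  simp [pullbackMetric, bilinPull_apply]

lemma fderiv_pullbackMetric (T : F ≃L[ℝ] E) (x : E) (g : MetricField E) (ζ u a b : F) :
    fderiv ℝ (pullbackMetric T x g) ζ u a b = fderiv ℝ g (x + T ζ) (T u) (T a) (T b) := by
  rw [pullbackMetric_eq]
  have h := ContinuousLinearEquiv.comp_fderiv (𝕜 := ℝ) (E := E →L[ℝ] E →L[ℝ] ℝ)
    (F := F →L[ℝ] F →L[ℝ] ℝ) (bilinPull T) (f := fun ζ => g (x + T ζ)) (x := ζ)
  have h' : fderiv ℝ (fun ζ => bilinPull T (g (x + T ζ))) ζ u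
      = bilinPull T (fderiv ℝ (fun ζ => g (x + T ζ)) ζ u) := congrArg (fun A => A u) h
  rw [h', bilinPull_apply]
  exact congrArg (fun B => B (T a) (T b)) (fderiv_comp_affine T x g ζ u)

lemma koszulForm_apply (g : MetricField E) (x u v w : E) :
    koszulForm g x u v w =
      (1 / 2) * (fderiv ℝ g x u v w + fderiv ℝ g x v u w - fderiv ℝ g x w u v) := by
  simp [koszulForm]

lemma koszulForm_pullback (T : F ≃L[ℝ] E) (x : E) (g : MetricField E) (ζ u v w : F) :
    koszulForm (pullbackMetric T x g) ζ u v w = koszulForm g (x + T ζ) (T u) (T v) (T w) := by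
  simp only [koszulForm_apply, fderiv_pullbackMetric]

/-- `ContinuousLinearMap.inverse` commutes with composition by isomorphisms on both sides, even
where the form is degenerate and the inverse takes its default value. Thus no hypothesis on `g` is
needed here or in the statements about `covDeriv` and the curvature. -/
lemma christoffel_pullback (T : F ≃L[ℝ] E) (x : E) (g : MetricField E) (ζ u v : F) :
    christoffel (pullbackMetric T x g) ζ u v
      = T.symm (christoffel g (x + T ζ) (T u) (T v)) := by
  let D : (E →L[ℝ] ℝ) ≃L[ℝ] (F →L[ℝ] ℝ) := T.symm.arrowCongr (ContinuousLinearEquiv.refl ℝ ℝ)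
  have hD : ∀ f : E →L[ℝ] ℝ, ∀ a, D f a = f (T a) := fun f a => by simp [D]
  have h1 : pullbackMetric T x g ζ =
      (D : (E →L[ℝ] ℝ) →L[ℝ] (F →L[ℝ] ℝ)).comp ((g (x + T ζ)).comp (T : F →L[ℝ] E)) := by
    ext a b
    simp [pullbackMetric, hD]
  have h2 : D.symm (koszulForm (pullbackMetric T x g) ζ u v)
      = koszulForm g (x + T ζ) (T u) (T v) := by
    rw [ContinuousLinearEquiv.symm_apply_eq]
    ext w
    rw [hD, koszulForm_pullback]
  rw [christoffel, h1, ContinuousLinearMap.inverse_equiv_comp,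
    ContinuousLinearMap.inverse_comp_equiv]
  simp only [ContinuousLinearMap.comp_apply, ContinuousLinearEquiv.coe_coe]
  rw [h2, christoffel]

lemma covDeriv_pullback (T : F ≃L[ℝ] E) (x : E) (g : MetricField E) {k : ℕ}
    (X : TensorField E k) :
    covDeriv (pullbackMetric T x g) (pullbackTensor T x X) = pullbackTensor T x (covDeriv g X) := by
  funext ζ a
  simp only [covDeriv, pullbackTensor]
  congr 1
  · exact fderiv_comp_affine T x (fun y => X y (fun i => T (Fin.tail a i))) ζ (a 0)
  · refine Finset.sum_congr rfl fun i _ => ?_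
    congr 1
    funext j
    by_cases h : j = i
    · subst h
      simp [christoffel_pullback, Fin.tail]
    · simp [Function.update_of_ne h, Fin.tail]

lemma iterCovDeriv_pullback (T : F ≃L[ℝ] E) (x : E) (g : MetricField E) {k : ℕ}
    (X : TensorField E k) (j : ℕ) :
    iterCovDeriv (pullbackMetric T x g) (pullbackTensor T x X) j
      = pullbackTensor T x (iterCovDeriv g X j) := by
  induction j with
  | zero => rfl
  | succ j ih =>
    simp only [iterCovDeriv]
    rw [ih, covDeriv_pullback]

lemma metricTensor_pullback (T : F ≃L[ℝ] E) (x : E) (g : MetricField E) :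
    metricTensor (pullbackMetric T x g) = pullbackTensor T x (metricTensor g) := by
  funext ζ a
  simp [metricTensor, pullbackMetric, pullbackTensor]

lemma curvatureOperator_pullback (T : F ≃L[ℝ] E) (x : E) (g : MetricField E) (ζ u v w : F) :
    T (curvatureOperator (pullbackMetric T x g) ζ u v w)
      = curvatureOperator g (x + T ζ) (T u) (T v) (T w) := by
  have h : ∀ a b c : F, T (fderiv ℝ (fun y => christoffel (pullbackMetric T x g) y a b) ζ c)
      = fderiv ℝ (fun y => christoffel g y (T a) (T b)) (x + T ζ) (T c) := by
    intro a b c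
    simp only [christoffel_pullback]
    have h := T.symm.comp_fderiv (f := fun ζ => christoffel g (x + T ζ) (T a) (T b)) (x := ζ)
    have h' : fderiv ℝ (fun ζ => T.symm (christoffel g (x + T ζ) (T a) (T b))) ζ c
      = T.symm (fderiv ℝ (fun ζ => christoffel g (x + T ζ) (T a) (T b)) ζ c) :=
        congrArg (fun A => A c) h
    rw [h', T.apply_symm_apply]
    exact fderiv_comp_affine T x (fun y => christoffel g y (T a) (T b)) ζ c
  simp only [curvatureOperator, map_sub, map_add, h]
  simp only [christoffel_pullback, T.apply_symm_apply]

lemma curvatureTensor_pullback (T : F ≃L[ℝ] E) (x : E) (g : MetricField E) :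
    curvatureTensor (pullbackMetric T x g) = pullbackTensor T x (curvatureTensor g) := by
  funext ζ a
  simp only [curvatureTensor, pullbackTensor]
  rw [← curvatureOperator_pullback]
  simp [pullbackMetric]

end Naturality

/-! ### Dependence of the tensors on germs of the metric only. -/

section Locality

variable {E : Type*} [NormedAddCommGroup E] [NormedSpace ℝ E]

lemma christoffel_congr {g g' : MetricField E} {x : E} (h : g =ᶠ[𝓝 x] g') (u v : E) :
    christoffel g x u v = christoffel g' x u v := by
  simp only [christoffel, koszulForm, h.fderiv_eq, h.eq_of_nhds]

lemma covDeriv_congr {g g' : MetricField E} {x : E} {k : ℕ} {X X' : TensorField E k}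
    (h : g =ᶠ[𝓝 x] g') (hX : X =ᶠ[𝓝 x] X') : covDeriv g X =ᶠ[𝓝 x] covDeriv g' X' := by
  filter_upwards [h.eventuallyEq_nhds, hX.eventuallyEq_nhds] with y hy hXy
  funext a
  have h1 : (fun z => X z (Fin.tail a)) =ᶠ[𝓝 y] fun z => X' z (Fin.tail a) :=
    hXy.mono fun z hz => congrFun hz _
  simp only [covDeriv, h1.fderiv_eq, christoffel_congr hy, hXy.eq_of_nhds]

lemma iterCovDeriv_congr {g g' : MetricField E} {x : E} {k : ℕ} {X X' : TensorField E k}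
    (h : g =ᶠ[𝓝 x] g') (hX : X =ᶠ[𝓝 x] X') (j : ℕ) :
    iterCovDeriv g X j =ᶠ[𝓝 x] iterCovDeriv g' X' j := by
  induction j with
  | zero => exact hX
  | succ j ih => exact covDeriv_congr h ih

lemma metricTensor_congr {g g' : MetricField E} {x : E} (h : g =ᶠ[𝓝 x] g') :
    metricTensor g =ᶠ[𝓝 x] metricTensor g' := by
  filter_upwards [h] with y hy
  funext a
  simp only [metricTensor, hy]

lemma curvatureTensor_congr {g g' : MetricField E} {x : E} (h : g =ᶠ[𝓝 x] g') :
    curvatureTensor g =ᶠ[𝓝 x] curvatureTensor g' := by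
  filter_upwards [h.eventuallyEq_nhds] with y hy
  funext a
  have h1 : ∀ u v, (fun z => christoffel g z u v) =ᶠ[𝓝 y] fun z => christoffel g' z u v :=
    fun u v => hy.eventuallyEq_nhds.mono fun z hz => christoffel_congr hz u v
  simp only [curvatureTensor, curvatureOperator, (h1 _ _).fderiv_eq, christoffel_congr hy,
    hy.eq_of_nhds]

end Locality

/-! ### Homogeneity of tensor fields in each slot. -/

section Homogeneity

variable {E : Type*} [NormedAddCommGroup E] [NormedSpace ℝ E]

/-- A tensor field that is homogeneous in each slot. -/
def IsHomogeneous {k : ℕ} (X : TensorField E k) : Prop :=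
  ∀ (x : E) (a : Fin k → E) (i : Fin k) (c : ℝ), X x (Function.update a i (c • a i)) = c * X x a

lemma christoffel_smul_left (g : MetricField E) (x u v : E) (c : ℝ) :
    christoffel g x (c • u) v = c • christoffel g x u v := by
  have : koszulForm g x (c • u) v = c • koszulForm g x u v := by
    ext w; simp only [koszulForm_apply, map_smul, smul_apply, smul_eq_mul]; ring
  rw [christoffel, this, map_smul, christoffel]

lemma christoffel_smul_right (g : MetricField E) (x u v : E) (c : ℝ) :
    christoffel g x u (c • v) = c • christoffel g x u v := by
  have : koszulForm g x u (c • v) = c • koszulForm g x u v := by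
    ext w; simp only [koszulForm_apply, map_smul, smul_apply, smul_eq_mul]; ring
  rw [christoffel, this, map_smul, christoffel]

lemma fderiv_fun_const_smul {G : Type*} [NormedAddCommGroup G] [NormedSpace ℝ G] (c : ℝ)
    (f : E → G) (x : E) : fderiv ℝ (fun y => c • f y) x = c • fderiv ℝ f x := by
  have h := congrFun (fderiv_const_smul_field (𝕜 := ℝ) (f := f) c) x
  exact h

/-- Unlike additivity, homogeneity passes through `fderiv` without any differentiability assumption,
and it is enough to turn a bound on unit vectors into a bound by the product of norms. -/
lemma IsHomogeneous.covDeriv {k : ℕ} {X : TensorField E k} (hX : IsHomogeneous X)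
    (g : MetricField E) : IsHomogeneous (covDeriv g X) := by
  intro x a i c
  simp only [ToricDegeneration.covDeriv]
  refine Fin.cases ?_ (fun i => ?_) i
  · rw [Fin.tail_update_zero, Function.update_self, map_smul, smul_eq_mul, mul_sub, Finset.mul_sum]
    congr 1
    refine Finset.sum_congr rfl fun j _ => ?_
    rw [christoffel_smul_left]
    have := hX x (Function.update (Fin.tail a) j (christoffel g x (a 0) (Fin.tail a j))) j c
    simpa using this
  · have h0 : Function.update a i.succ (c • a i.succ) 0 = a 0 :=
      Function.update_of_ne (Fin.succ_ne_zero i).symm _ _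
    have h1 : ∀ b : E, Fin.tail (Function.update a i.succ b) = Function.update (Fin.tail a) i b :=
      fun b => Fin.tail_update_succ a i b
    rw [h0, h1, mul_sub, Finset.mul_sum]
    have h2 : ∀ y, X y (Function.update (Fin.tail a) i (c • a i.succ)) = c * X y (Fin.tail a) :=
      fun y => hX y (Fin.tail a) i c
    congr 1
    · simp only [h2]
      exact congrArg (fun A => A (a 0)) (fderiv_fun_const_smul c (fun y => X y (Fin.tail a)) x)
    · refine Finset.sum_congr rfl fun j _ => ?_
      by_cases hj : j = i
      · subst hj
        rw [Function.update_self, christoffel_smul_right, Function.update_idem]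
        have := hX x (Function.update (Fin.tail a) j (christoffel g x (a 0) (Fin.tail a j))) j c
        rw [Function.update_self, Function.update_idem] at this
        exact this
      · rw [Function.update_of_ne hj, Function.update_comm (Ne.symm hj)]
        have := hX x (Function.update (Fin.tail a) j (christoffel g x (a 0) (Fin.tail a j))) i c
        rw [Function.update_of_ne (Ne.symm hj)] at this
        exact this

lemma IsHomogeneous.iterCovDeriv {k : ℕ} {X : TensorField E k} (hX : IsHomogeneous X)
    (g : MetricField E) (j : ℕ) : IsHomogeneous (iterCovDeriv g X j) := by
  induction j with
  | zero => exact hX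
  | succ j ih => exact ih.covDeriv g

lemma isHomogeneous_metricTensor (g : MetricField E) : IsHomogeneous (metricTensor g) := by
  intro x a i c
  fin_cases i <;> simp [metricTensor]

lemma isHomogeneous_curvatureTensor (g : MetricField E) : IsHomogeneous (curvatureTensor g) := by
  intro x a i c
  have h1 : ∀ u v w, curvatureOperator g x (c • u) v w = c • curvatureOperator g x u v w := by
    intro u v w
    simp only [curvatureOperator, christoffel_smul_left, christoffel_smul_right,
      fderiv_fun_const_smul, map_smul, smul_sub, smul_add, smul_apply]
  have h2 : ∀ u v w, curvatureOperator g x u (c • v) w = c • curvatureOperator g x u v w := by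
    intro u v w
    simp only [curvatureOperator, christoffel_smul_left, christoffel_smul_right,
      fderiv_fun_const_smul, map_smul, smul_sub, smul_add, smul_apply]
  have h3 : ∀ u v w, curvatureOperator g x u v (c • w) = c • curvatureOperator g x u v w := by
    intro u v w
    simp only [curvatureOperator, christoffel_smul_right, fderiv_fun_const_smul, smul_sub,
      smul_add, smul_apply]
  fin_cases i <;> simp [curvatureTensor, h1, h2, h3]

/-- A homogeneous form that is bounded on the unit balls is bounded by the product of the norms. -/
lemma IsHomogeneous.le_prod {k : ℕ} {X : TensorField E k} (hX : IsHomogeneous X) {x : E} {M : ℝ}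
    (hM : ∀ a : Fin k → E, (∀ i, ‖a i‖ ≤ 1) → |X x a| ≤ M) (a : Fin k → E) :
    |X x a| ≤ M * ∏ i, ‖a i‖ := by
  suffices H : ∀ s : Finset (Fin k), ∀ a : Fin k → E, (∀ i ∉ s, ‖a i‖ ≤ 1) →
      |X x a| ≤ M * ∏ i ∈ s, ‖a i‖ from H Finset.univ a (by simp)
  intro s
  induction s using Finset.induction_on with
  | empty => intro a ha; simpa using hM a (by simpa using ha)
  | insert i s hi ih =>
    intro a ha
    rw [Finset.prod_insert hi]
    by_cases h0 : a i = 0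
    · have h := hX x a i 0
      rw [zero_smul, ← h0, Function.update_eq_self] at h
      rw [h, h0]; simp
    · have hn : ‖a i‖ ≠ 0 := norm_ne_zero_iff.2 h0
      set b := Function.update a i (‖a i‖⁻¹ • a i) with hb
      have h := hX x a i ‖a i‖⁻¹
      have h1 : |X x b| ≤ M * ∏ j ∈ s, ‖b j‖ := by
        refine ih b fun j hj => ?_
        by_cases hji : j = i
        · subst hji; simp [hb, norm_smul, hn]
        · rw [hb, Function.update_of_ne hji]
          exact ha j (by simp [hji, hj])
      have h2 : ∏ j ∈ s, ‖b j‖ = ∏ j ∈ s, ‖a j‖ := Finset.prod_congr rfl fun j hj => by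
        rw [hb, Function.update_of_ne (ne_of_mem_of_not_mem hj hi)]
      rw [h2, hb, h, abs_mul, abs_of_nonneg (by positivity)] at h1
      have h3 := mul_le_mul_of_nonneg_left h1 (norm_nonneg (a i))
      rw [← mul_assoc, mul_inv_cancel₀ hn, one_mul] at h3
      linarith

end Homogeneity

/-! ### Joint smoothness of covariant derivatives and curvature in point and parameter. -/

section JointSmoothness

variable {P F H : Type*} [NormedAddCommGroup P] [NormedSpace ℝ P] [NormedAddCommGroup F]
  [NormedSpace ℝ F] [NormedAddCommGroup H] [NormedSpace ℝ H]

/-- The family `G` of metric fields is, near `p`, jointly smooth, symmetric and positive definite. -/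
def IsRegularAt (G : P → MetricField F) (p : P × F) : Prop :=
  ∀ᶠ q in 𝓝 p, ContDiffAt ℝ ∞ (Function.uncurry G) q ∧ (∀ u v, G q.1 q.2 u v = G q.1 q.2 v u) ∧
    ∀ v, v ≠ 0 → 0 < G q.1 q.2 v v

/-- Positivity gives injectivity, and the dual space has the same dimension. The isomorphism is what
makes the inversion in the Christoffel symbols a smooth operation at `B`. -/
lemma exists_equiv_of_posDef [FiniteDimensional ℝ F] (B : F →L[ℝ] F →L[ℝ] ℝ)
    (hB : ∀ v, v ≠ 0 → 0 < B v v) : ∃ e : F ≃L[ℝ] (F →L[ℝ] ℝ), (e : F →L[ℝ] F →L[ℝ] ℝ) = B := by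
  have hinj : LinearMap.ker (B : F →ₗ[ℝ] F →L[ℝ] ℝ) = ⊥ := by
    rw [LinearMap.ker_eq_bot']
    intro v hv
    by_contra h
    have := hB v h
    have h2 : B v = 0 := hv
    simp [h2] at this
  have hfin : Module.finrank ℝ F = Module.finrank ℝ (F →L[ℝ] ℝ) := by
    rw [← (LinearMap.toContinuousLinearMap (𝕜 := ℝ) (E := F) (F' := ℝ)).finrank_eq]
    exact (Subspace.dual_finrank_eq (K := ℝ) (V := F)).symm
  let e := LinearEquiv.ofInjectiveOfFinrankEq (B : F →ₗ[ℝ] F →L[ℝ] ℝ)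
    (LinearMap.ker_eq_bot.1 hinj) hfin
  refine ⟨e.toContinuousLinearEquiv, ?_⟩
  ext a b
  rfl

lemma ContDiffAt.fderiv_family {G : Type*} [NormedAddCommGroup G] [NormedSpace ℝ G]
    {Φ : P → F → G} {a : H → P} {b : H → F} {h : H}
    (hΦ : ContDiffAt ℝ ∞ (Function.uncurry Φ) (a h, b h))
    (ha : ContDiffAt ℝ ∞ a h) (hb : ContDiffAt ℝ ∞ b h) :
    ContDiffAt ℝ ∞ (fun h => fderiv ℝ (Φ (a h)) (b h)) h := by
  refine ContDiffAt.fderiv (n := ∞) (f := fun h y => Φ (a h) y) ?_ hb (by simp)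
  have h1 : ContDiffAt ℝ ∞ (fun q : H × F => (a q.1, q.2)) (h, b h) :=
    ContDiffAt.prodMk (ContDiffAt.comp (h, b h) ha contDiffAt_fst) contDiffAt_snd
  exact ContDiffAt.comp (h, b h) (g := Function.uncurry Φ) hΦ h1

lemma contDiffAt_flip {A B C : Type*} [NormedAddCommGroup A] [NormedSpace ℝ A]
    [NormedAddCommGroup B] [NormedSpace ℝ B] [NormedAddCommGroup C] [NormedSpace ℝ C]
    {f : H → A →L[ℝ] B →L[ℝ] C} {h : H} (hf : ContDiffAt ℝ ∞ f h) :
    ContDiffAt ℝ ∞ (fun h => (f h).flip) h :=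
  ContDiffAt.comp h (g := ContinuousLinearMap.flip)
    (LinearIsometryEquiv.contDiff (𝕜 := ℝ) (E := A →L[ℝ] B →L[ℝ] C) (F := B →L[ℝ] A →L[ℝ] C)
      (ContinuousLinearMap.flipₗᵢ ℝ A B C)).contDiffAt hf

lemma contDiffAt_christoffel [FiniteDimensional ℝ F] {G : P → MetricField F} {a : H → P}
    {b u v : H → F} {h : H}
    (hG : ContDiffAt ℝ ∞ (Function.uncurry G) (a h, b h))
    (hpos : ∀ w, w ≠ 0 → 0 < G (a h) (b h) w w)
    (ha : ContDiffAt ℝ ∞ a h) (hb : ContDiffAt ℝ ∞ b h) (hu : ContDiffAt ℝ ∞ u h)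
    (hv : ContDiffAt ℝ ∞ v h) :
    ContDiffAt ℝ ∞ (fun h => christoffel (G (a h)) (b h) (u h) (v h)) h := by
  have : CompleteSpace F := FiniteDimensional.complete ℝ F
  have hD := ContDiffAt.fderiv_family hG ha hb
  have hg : ContDiffAt ℝ ∞ (fun h => G (a h) (b h)) h :=
    ContDiffAt.comp h (g := Function.uncurry G) hG (ha.prodMk hb)
  obtain ⟨e, he⟩ := exists_equiv_of_posDef _ hpos
  have hinv : ContDiffAt ℝ ∞ (fun h => (G (a h) (b h)).inverse) h := by
    refine ContDiffAt.comp h (g := ContinuousLinearMap.inverse) ?_ hg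
    rw [← he]
    exact contDiffAt_map_inverse e
  have hk : ContDiffAt ℝ ∞ (fun h => koszulForm (G (a h)) (b h) (u h) (v h)) h := by
    unfold koszulForm
    refine ContDiffAt.const_smul _ (ContDiffAt.sub (ContDiffAt.add ?_ ?_) ?_)
    · exact (hD.clm_apply hu).clm_apply hv
    · exact (hD.clm_apply hv).clm_apply hu
    · exact (contDiffAt_flip ((contDiffAt_flip hD).clm_apply hu)).clm_apply hv
  exact hinv.clm_apply hk

/-- The family `X` of tensor fields is jointly smooth at the point `p`. -/
def SmoothTensorAt {k : ℕ} (X : P → TensorField F k) (p : P × F) : Prop :=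
  ∀ a : Fin k → F, ContDiffAt ℝ ∞ (fun q : (P × F) × (Fin k → F) => X q.1.1 q.1.2 q.2) (p, a)

lemma SmoothTensorAt.comp {k : ℕ} {X : P → TensorField F k} {a : H → P} {b : H → F}
    {c : H → Fin k → F} {h : H} (hX : SmoothTensorAt X (a h, b h)) (ha : ContDiffAt ℝ ∞ a h)
    (hb : ContDiffAt ℝ ∞ b h) (hc : ∀ i, ContDiffAt ℝ ∞ (fun h => c h i) h) :
    ContDiffAt ℝ ∞ (fun h => X (a h) (b h) (c h)) h :=
  ContDiffAt.comp h (g := fun q : (P × F) × (Fin k → F) => X q.1.1 q.1.2 q.2) (hX (c h)) ((ha.prodMk hb).prodMk (contDiffAt_pi.2 hc))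

lemma SmoothTensorAt.covDeriv [FiniteDimensional ℝ F] {k : ℕ} {X : P → TensorField F k}
    {G : P → MetricField F} {p : P × F} (hX : SmoothTensorAt X p) (hG : IsRegularAt G p) :
    SmoothTensorAt (fun θ => covDeriv (G θ) (X θ)) p := by
  intro a
  obtain ⟨hG1, -, hG3⟩ := hG.self_of_nhds
  have e1 : ContDiffAt ℝ ∞ (fun q : (P × F) × (Fin (k + 1) → F) => q.1.1) (p, a) := by fun_prop
  have e2 : ContDiffAt ℝ ∞ (fun q : (P × F) × (Fin (k + 1) → F) => q.1.2) (p, a) := by fun_prop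
  have e3 : ∀ i, ContDiffAt ℝ ∞ (fun q : (P × F) × (Fin (k + 1) → F) => q.2 i) (p, a) := by
    intro i; fun_prop
  unfold ToricDegeneration.covDeriv
  refine ContDiffAt.sub ?_ (ContDiffAt.sum fun i _ => ?_)
  · refine ContDiffAt.clm_apply ?_ (e3 0)
    -- The tangent vectors are treated as further parameters, so that the derivative in the base
    -- point alone is the derivative of a jointly smooth family.
    refine ContDiffAt.fderiv_family (H := (P × F) × (Fin (k + 1) → F))
      (P := (P × F) × (Fin (k + 1) → F)) (Φ := fun q y => X q.1.1 y (Fin.tail q.2))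
      (a := fun q => q) (b := fun q => q.1.2) ?_ contDiffAt_id e2
    have f1 : ContDiffAt ℝ ∞ (fun q : ((P × F) × (Fin (k + 1) → F)) × F => q.1.1.1)
      ((p, a), p.2) := by fun_prop
    have f2 : ContDiffAt ℝ ∞ (fun q : ((P × F) × (Fin (k + 1) → F)) × F => q.2)
      ((p, a), p.2) := by fun_prop
    refine SmoothTensorAt.comp (H := ((P × F) × (Fin (k + 1) → F)) × F) (h := ((p, a), p.2))
      (c := fun q => Fin.tail q.1.2) hX f1 f2 fun i => ?_
    simp only [Fin.tail]
    fun_prop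
  · refine SmoothTensorAt.comp (H := (P × F) × (Fin (k + 1) → F)) (h := (p, a)) hX e1 e2
      fun j => ?_
    by_cases hj : j = i
    · subst hj
      simp only [Function.update_self]
      exact contDiffAt_christoffel hG1 hG3 e1 e2 (e3 0) (e3 _)
    · simp only [Function.update_of_ne hj]
      exact e3 _

lemma SmoothTensorAt.iterCovDeriv [FiniteDimensional ℝ F] {k : ℕ} {X : P → TensorField F k}
    {G : P → MetricField F} {p : P × F} (hX : SmoothTensorAt X p) (hG : IsRegularAt G p) (j : ℕ) :
    SmoothTensorAt (fun θ => iterCovDeriv (G θ) (X θ) j) p := by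
  induction j with
  | zero => exact hX
  | succ j ih => exact ih.covDeriv hG

lemma IsRegularAt.smooth_metricTensor {G : P → MetricField F} {p : P × F} (hG : IsRegularAt G p) :
    SmoothTensorAt (fun θ => metricTensor (G θ)) p := by
  intro a
  obtain ⟨hG1, -, -⟩ := hG.self_of_nhds
  unfold metricTensor
  have h : ContDiffAt ℝ ∞ (fun q : (P × F) × (Fin 2 → F) => Function.uncurry G q.1) (p, a) :=
    ContDiffAt.comp (p, a) hG1 contDiffAt_fst
  refine (ContDiffAt.clm_apply (f := fun q : (P × F) × (Fin 2 → F) => Function.uncurry G q.1 (q.2 0))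
    (h.clm_apply ?_) ?_) <;> fun_prop

lemma IsRegularAt.smooth_curvatureTensor [FiniteDimensional ℝ F] {G : P → MetricField F}
    {p : P × F} (hG : IsRegularAt G p) : SmoothTensorAt (fun θ => curvatureTensor (G θ)) p := by
  intro a
  obtain ⟨hG1, -, hG3⟩ := hG.self_of_nhds
  have e1 : ContDiffAt ℝ ∞ (fun q : (P × F) × (Fin 4 → F) => q.1.1) (p, a) := by fun_prop
  have e2 : ContDiffAt ℝ ∞ (fun q : (P × F) × (Fin 4 → F) => q.1.2) (p, a) := by fun_prop
  have e3 : ∀ i, ContDiffAt ℝ ∞ (fun q : (P × F) × (Fin 4 → F) => q.2 i) (p, a) := by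
    intro i; fun_prop
  have hd : ∀ i j k, ContDiffAt ℝ ∞ (fun q : (P × F) × (Fin 4 → F) =>
      fderiv ℝ (fun y => christoffel (G q.1.1) y (q.2 i) (q.2 j)) q.1.2 (q.2 k)) (p, a) := by
    intro i j k
    refine ContDiffAt.clm_apply ?_ (e3 k)
    refine ContDiffAt.fderiv_family (H := (P × F) × (Fin 4 → F))
      (P := (P × F) × (Fin 4 → F)) (Φ := fun q y => christoffel (G q.1.1) y (q.2 i) (q.2 j))
      (a := fun q => q) (b := fun q => q.1.2) ?_ contDiffAt_id e2
    exact contDiffAt_christoffel (H := ((P × F) × (Fin 4 → F)) × F) (h := ((p, a), p.2))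
      (a := fun q => q.1.1.1) (b := fun q => q.2) (u := fun q => q.1.2 i) (v := fun q => q.1.2 j)
      hG1 hG3 (by fun_prop) (by fun_prop) (by fun_prop) (by fun_prop)
  have h : ContDiffAt ℝ ∞ (fun q : (P × F) × (Fin 4 → F) => Function.uncurry G q.1) (p, a) :=
    ContDiffAt.comp (p, a) hG1 contDiffAt_fst
  unfold curvatureTensor
  refine (ContDiffAt.clm_apply (f := fun q : (P × F) × (Fin 4 → F) =>
    Function.uncurry G q.1 (curvatureOperator (G q.1.1) q.1.2 (q.2 0) (q.2 1) (q.2 2)))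
    (h.clm_apply ?_) (e3 3))
  unfold curvatureOperator
  refine ((hd 1 2 0).sub (hd 0 2 1)).add ?_ |>.sub ?_
  · exact contDiffAt_christoffel hG1 hG3 e1 e2 (e3 0)
      (contDiffAt_christoffel hG1 hG3 e1 e2 (e3 1) (e3 2))
  · exact contDiffAt_christoffel hG1 hG3 e1 e2 (e3 1)
      (contDiffAt_christoffel hG1 hG3 e1 e2 (e3 0) (e3 2))

end JointSmoothness

/-! ### Uniform bounds from a compact parameter set. -/

section Compactness

variable {P E F ι : Type*} [NormedAddCommGroup P] [NormedSpace ℝ P] [NormedAddCommGroup F]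
  [NormedSpace ℝ F] [FiniteDimensional ℝ F] [NormedAddCommGroup E] [NormedSpace ℝ E]

lemma exists_bound_of_smoothTensorAt {k : ℕ} {X : P → TensorField F k} {K : Set P}
    (hK : IsCompact K) (hX : ∀ θ ∈ K, SmoothTensorAt X (θ, 0))
    (hom : ∀ θ, IsHomogeneous (X θ)) :
    ∃ M : ℝ, 0 ≤ M ∧ ∀ θ ∈ K, ∀ a, |X θ 0 a| ≤ M * ∏ i, ‖a i‖ := by
  have hc : IsCompact (K ×ˢ Metric.closedBall (0 : Fin k → F) 1) :=
    hK.prod (ProperSpace.isCompact_closedBall _ _)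
  have hcont : ContinuousOn (fun q : P × (Fin k → F) => X q.1 0 q.2)
      (K ×ˢ Metric.closedBall (0 : Fin k → F) 1) := by
    rintro ⟨θ, a⟩ ⟨hθ, -⟩
    refine ContinuousAt.continuousWithinAt ?_
    have h1 := (hX θ hθ a).continuousAt
    have h2 : ContinuousAt (fun q : P × (Fin k → F) => (((q.1, (0 : F)), q.2) :
      (P × F) × (Fin k → F))) (θ, a) := by fun_prop
    exact ContinuousAt.comp (f := fun q : P × (Fin k → F) => (((q.1, (0 : F)), q.2) :
      (P × F) × (Fin k → F))) (x := (θ, a)) h1 h2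
  obtain ⟨M, hM⟩ := hc.exists_bound_of_continuousOn hcont
  refine ⟨max M 0, le_max_right _ _, fun θ hθ => (hom θ).le_prod fun a ha => ?_⟩
  refine (hM (θ, a) ⟨hθ, ?_⟩).trans (le_max_left _ _)
  rw [mem_closedBall_zero_iff]
  exact (pi_norm_le_iff_of_nonneg zero_le_one).2 ha

/-- The minimum over the product of `K` with the unit sphere is positive; scaling extends the bound
to all vectors. -/
lemma exists_lower_bound_of_isRegularAt {G : P → MetricField F} {K : Set P} (hK : IsCompact K)
    (hG : ∀ θ ∈ K, IsRegularAt G (θ, 0)) :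
    ∃ c : ℝ, 0 < c ∧ ∀ θ ∈ K, ∀ v, c * ‖v‖ ^ 2 ≤ G θ 0 v v := by
  have hc : IsCompact (K ×ˢ Metric.sphere (0 : F) 1) := hK.prod (isCompact_sphere _ _)
  have hcont : ContinuousOn (fun q : P × F => G q.1 0 q.2 q.2) (K ×ˢ Metric.sphere (0 : F) 1) := by
    rintro ⟨θ, a⟩ ⟨hθ, -⟩
    refine ContinuousAt.continuousWithinAt ?_
    have h1 := (hG θ hθ).self_of_nhds.1.continuousAt
    have h2 : ContinuousAt (fun q : P × F => Function.uncurry G (q.1, 0)) (θ, a) :=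
      ContinuousAt.comp (f := fun q : P × F => (q.1, (0 : F))) (x := (θ, a)) h1 (by fun_prop)
    exact (h2.clm_apply continuousAt_snd).clm_apply continuousAt_snd
  obtain ⟨c, hc0, hcb⟩ := hc.exists_forall_le' hcont (a := 0) (by
    rintro ⟨θ, a⟩ ⟨hθ, ha⟩
    refine (hG θ hθ).self_of_nhds.2.2 a ?_
    rintro rfl
    simp at ha)
  refine ⟨c, hc0, fun θ hθ v => ?_⟩
  by_cases hv : v = 0
  · simp [hv]
  · have hn : ‖v‖ ≠ 0 := norm_ne_zero_iff.2 hv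
    have := hcb (θ, ‖v‖⁻¹ • v) ⟨hθ, by simp [norm_smul, hn]⟩
    simp only [map_smul, smul_apply, smul_eq_mul] at this
    have h3 := mul_le_mul_of_nonneg_left this (sq_nonneg ‖v‖)
    have h4 : ‖v‖ ^ 2 * (‖v‖⁻¹ * (‖v‖⁻¹ * G θ 0 v v)) = G θ 0 v v := by field_simp
    linarith

/-- If, in suitable affine coordinates at each point, the metrics of two families belong to two
families of metrics that depend smoothly on a parameter in a compact set, then they are uniformly
quasi-isometric with all derivatives. -/
theorem uniformlyCInftyQuasiIsometric_of_compact {I : Set ι} {K : ι → Set E}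
    {g g' : ι → MetricField E} {G G' : P → MetricField F} {Θ : Set P} (hΘ : IsCompact Θ)
    (hG : ∀ θ ∈ Θ, IsRegularAt G (θ, 0)) (hG' : ∀ θ ∈ Θ, IsRegularAt G' (θ, 0))
    (H : ∀ i ∈ I, ∀ x ∈ K i, ∃ θ ∈ Θ, ∃ T : F ≃L[ℝ] E,
      pullbackMetric T x (g i) =ᶠ[𝓝 0] G θ ∧ pullbackMetric T x (g' i) =ᶠ[𝓝 0] G' θ) :
    UniformlyCInftyQuasiIsometric I K g g' := by
  obtain ⟨c, hc, hcb⟩ := exists_lower_bound_of_isRegularAt hΘ hG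
  obtain ⟨c', hc', hcb'⟩ := exists_lower_bound_of_isRegularAt hΘ hG'
  obtain ⟨M, hM, hMb⟩ := exists_bound_of_smoothTensorAt hΘ
    (fun θ hθ => (hG θ hθ).smooth_metricTensor) (fun θ => isHomogeneous_metricTensor (G θ))
  obtain ⟨M', hM', hMb'⟩ := exists_bound_of_smoothTensorAt hΘ
    (fun θ hθ => (hG' θ hθ).smooth_metricTensor) (fun θ => isHomogeneous_metricTensor (G' θ))
  -- Everything is evaluated at the centre of the chart: the point `x` corresponds to `0`, and
  -- vectors are transported by `T.symm`.
  have val : ∀ {g : MetricField E} {G : P → MetricField F} {x : E} {θ : P} {T : F ≃L[ℝ] E},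
      pullbackMetric T x g =ᶠ[𝓝 0] G θ → ∀ u v, g x u v = G θ 0 (T.symm u) (T.symm v) := by
    intro g G x θ T h u v
    rw [← h.eq_of_nhds]
    simp [pullbackMetric]
  have riem : ∀ {g : MetricField E} {G : P → MetricField F} {x : E} {θ : P} {T : F ≃L[ℝ] E},
      IsRegularAt G (θ, 0) → pullbackMetric T x g =ᶠ[𝓝 0] G θ → IsRiemannianNear g x := by
    intro g G x θ T hG h
    have hA : ContinuousAt (fun y => T.symm (y - x)) x := by fun_prop
    have hA0 : T.symm (x - x) = 0 := by simp
    have hB : ContinuousAt (fun y => ((θ, T.symm (y - x)) : P × F)) x := by fun_prop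
    have hG2 : ∀ᶠ q in 𝓝 ((θ, T.symm (x - x)) : P × F), ContDiffAt ℝ ∞ (Function.uncurry G) q ∧
        (∀ u v, G q.1 q.2 u v = G q.1 q.2 v u) ∧ ∀ v, v ≠ 0 → 0 < G q.1 q.2 v v := by
      rw [hA0]; exact hG
    have h2 : ∀ᶠ ζ in 𝓝 (T.symm (x - x)), pullbackMetric T x g =ᶠ[𝓝 ζ] G θ := by
      rw [hA0]; exact h.eventuallyEq_nhds
    filter_upwards [hA.eventually h2, hB.eventually hG2] with y hy1 hy2
    have gy : g =ᶠ[𝓝 y] fun y => bilinPull T.symm (G θ (T.symm (y - x))) := by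
      have hA : ContinuousAt (fun y => T.symm (y - x)) y := by fun_prop
      filter_upwards [hA.eventually hy1] with z hz
      ext a b
      rw [bilinPull_apply, ← hz]
      simp [pullbackMetric]
    refine ⟨ContDiffAt.congr_of_eventuallyEq ?_ gy, ?_, ?_⟩
    · refine ContDiffAt.comp y (g := bilinPull T.symm)
        (ContinuousLinearEquiv.contDiff (𝕜 := ℝ) (E := F →L[ℝ] F →L[ℝ] ℝ)
          (F := E →L[ℝ] E →L[ℝ] ℝ) (bilinPull T.symm)).contDiffAt ?_
      have hT : ContDiffAt ℝ ∞ (fun y => ((θ, T.symm (y - x)) : P × F)) y := by fun_prop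
      exact ContDiffAt.comp y (g := Function.uncurry G) hy2.1 hT
    · intro u v
      rw [gy.eq_of_nhds, bilinPull_apply, bilinPull_apply]
      exact hy2.2.1 _ _
    · intro v hv
      rw [gy.eq_of_nhds, bilinPull_apply]
      exact hy2.2.2 _ (by simpa using hv)
  have bd : ∀ {k : ℕ} (X : P → TensorField F k), (∀ θ ∈ Θ, SmoothTensorAt X (θ, 0)) →
      (∀ θ, IsHomogeneous (X θ)) → ∃ C : ℝ, ∀ i ∈ I, ∀ x ∈ K i, ∀ Y : TensorField E k,
      (∀ θ ∈ Θ, ∀ T : F ≃L[ℝ] E, pullbackMetric T x (g i) =ᶠ[𝓝 0] G θ →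
        pullbackMetric T x (g' i) =ᶠ[𝓝 0] G' θ → pullbackTensor T x Y 0 = X θ 0) →
      TensorBound (g i) C Y x := by
    intro k X hX hom
    obtain ⟨A, hA, hAb⟩ := exists_bound_of_smoothTensorAt hΘ hX hom
    -- Each slot costs one factor `c ^ (-1/2)`, since `‖T.symm v‖ ≤ c ^ (-1/2) * sqrt (g v v)` by
    -- the lower bound `hcb`.
    refine ⟨A * (Real.sqrt c)⁻¹ ^ k, fun i hi x hx Y hY a => ?_⟩
    obtain ⟨θ, hθ, T, h1, h2⟩ := H i hi x hx
    have h3 := congrFun (hY θ hθ T h1 h2) (fun j => T.symm (a j))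
    simp only [pullbackTensor, map_zero, add_zero, ContinuousLinearEquiv.apply_symm_apply] at h3
    rw [h3]
    refine (hAb θ hθ _).trans ?_
    rw [mul_assoc]
    refine mul_le_mul_of_nonneg_left ?_ hA
    have : (Real.sqrt c)⁻¹ ^ k * ∏ j, Real.sqrt (g i x (a j) (a j))
        = ∏ j : Fin k, (Real.sqrt c)⁻¹ * Real.sqrt (g i x (a j) (a j)) := by
      rw [Finset.prod_mul_distrib]; simp
    rw [this]
    refine Finset.prod_le_prod (fun _ _ => norm_nonneg _) fun j _ => ?_
    rw [val h1]
    have h4 := Real.sqrt_le_sqrt (hcb θ hθ (T.symm (a j)))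
    rw [Real.sqrt_mul hc.le, Real.sqrt_sq (norm_nonneg _)] at h4
    rw [le_inv_mul_iff₀ (Real.sqrt_pos.2 hc)]
    exact h4
  refine ⟨?_, ?_, ?_, ?_⟩
  · intro i hi x hx
    obtain ⟨θ, hθ, T, h1, h2⟩ := H i hi x hx
    exact ⟨riem (hG θ hθ) h1, riem (hG' θ hθ) h2⟩
  · refine ⟨M' / c + M / c' + 1, by positivity, fun i hi x hx v => ?_⟩
    obtain ⟨θ, hθ, T, h1, h2⟩ := H i hi x hx
    rw [val h1, val h2]
    set u := T.symm v
    have b1 := hcb θ hθ u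
    have b2 := hcb' θ hθ u
    have b3 := (le_abs_self _).trans (hMb θ hθ ![u, u])
    have b4 := (le_abs_self _).trans (hMb' θ hθ ![u, u])
    simp only [metricTensor, Matrix.cons_val_zero, Matrix.cons_val_one, Fin.prod_univ_two] at b3 b4
    have p1 : 0 ≤ G θ 0 u u := le_trans (by positivity) b1
    have p2 : 0 ≤ G' θ 0 u u := le_trans (by positivity) b2
    constructor
    · have : M' * (‖u‖ * ‖u‖) ≤ M' / c * G θ 0 u u := by
        rw [div_mul_eq_mul_div, le_div_iff₀ hc]; nlinarith
      have : 0 ≤ (M / c' + 1) * G θ 0 u u := by positivity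
      nlinarith
    · have : M * (‖u‖ * ‖u‖) ≤ M / c' * G' θ 0 u u := by
        rw [div_mul_eq_mul_div, le_div_iff₀ hc']; nlinarith
      have : 0 ≤ (M' / c + 1) * G' θ 0 u u := by positivity
      nlinarith
  · intro j
    obtain ⟨C, hC⟩ := bd (fun θ => iterCovDeriv (G θ) (curvatureTensor (G θ)) j)
      (fun θ hθ => (hG θ hθ).smooth_curvatureTensor.iterCovDeriv (hG θ hθ) j)
      (fun θ => (isHomogeneous_curvatureTensor _).iterCovDeriv _ j)
    refine ⟨C, fun i hi x hx => hC i hi x hx _ fun θ hθ T h1 h2 => ?_⟩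
    rw [← iterCovDeriv_pullback, ← curvatureTensor_pullback]
    exact (iterCovDeriv_congr h1 (curvatureTensor_congr h1) j).eq_of_nhds
  · intro j
    obtain ⟨C, hC⟩ := bd (fun θ => iterCovDeriv (G θ) (metricTensor (G' θ)) j)
      (fun θ hθ => (hG' θ hθ).smooth_metricTensor.iterCovDeriv (hG θ hθ) j)
      (fun θ => (isHomogeneous_metricTensor _).iterCovDeriv _ j)
    refine ⟨C, fun i hi x hx => hC i hi x hx _ fun θ hθ T h1 h2 => ?_⟩
    rw [← iterCovDeriv_pullback, ← metricTensor_pullback]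
    exact (iterCovDeriv_congr h1 (metricTensor_congr h2) j).eq_of_nhds

end Compactness

/-! ### Kähler metrics defined by potentials. -/

section Kahler

variable {P V : Type*} [NormedAddCommGroup P] [NormedSpace ℝ P] [NormedAddCommGroup V]
  [NormedSpace ℂ V]

lemma kahlerMetric_apply (φ : V → ℝ) (x u v : V) :
    kahlerMetric φ x u v = (1 / (4 * Real.pi)) * (fderiv ℝ (fderiv ℝ φ) x u v +
      fderiv ℝ (fderiv ℝ φ) x (Complex.I • u) (Complex.I • v)) := by
  simp [kahlerMetric]
  ring

lemma fderiv_fderiv_comp_affine {E F : Type*} [NormedAddCommGroup E] [NormedSpace ℝ E]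
    [NormedAddCommGroup F] [NormedSpace ℝ F] (T : F ≃L[ℝ] E) (x : E) (φ : E → ℝ) (ζ u v : F) :
    fderiv ℝ (fderiv ℝ fun ζ => φ (x + T ζ)) ζ u v
      = fderiv ℝ (fderiv ℝ φ) (x + T ζ) (T u) (T v) := by
  let D : (E →L[ℝ] ℝ) ≃L[ℝ] (F →L[ℝ] ℝ) := T.symm.arrowCongr (ContinuousLinearEquiv.refl ℝ ℝ)
  have hD : ∀ f : E →L[ℝ] ℝ, ∀ a, D f a = f (T a) := fun f a => by simp [D]
  have h1 : (fderiv ℝ fun ζ => φ (x + T ζ)) = fun ζ => D (fderiv ℝ φ (x + T ζ)) := by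
    funext ζ
    ext a
    rw [hD, fderiv_comp_affine]
  have h := ContinuousLinearEquiv.comp_fderiv (𝕜 := ℝ) (E := E →L[ℝ] ℝ)
    (F := F →L[ℝ] ℝ) D (f := fun ζ => fderiv ℝ φ (x + T ζ)) (x := ζ)
  have h' : fderiv ℝ (fun ζ => D (fderiv ℝ φ (x + T ζ))) ζ u
      = D (fderiv ℝ (fun ζ => fderiv ℝ φ (x + T ζ)) ζ u) := congrArg (fun A => A u) h
  rw [h1, h', hD]
  exact congrArg (fun A => A (T v)) (fderiv_comp_affine T x (fderiv ℝ φ) ζ u)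

/-- A complex linear `T` commutes with multiplication by `i`, so it carries the `J`-invariant part
of the Hessian to that of the pulled back potential. This is why all rescalings below are complex
linear. -/
lemma pullbackMetric_kahlerMetric (T : V ≃L[ℂ] V) (x : V) (φ : V → ℝ) :
    pullbackMetric (T.restrictScalars ℝ) x (kahlerMetric φ)
      = kahlerMetric fun ζ => φ (x + T ζ) := by
  funext ζ
  ext u v
  have h := fderiv_fderiv_comp_affine (T.restrictScalars ℝ) x φ ζ
  simp only [ContinuousLinearEquiv.restrictScalars_apply] at h
  simp [pullbackMetric, kahlerMetric_apply, h]

lemma kahlerMetric_congr {φ ψ : V → ℝ} {x : V} (h : φ =ᶠ[𝓝 x] ψ) :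
    kahlerMetric φ =ᶠ[𝓝 x] kahlerMetric ψ := by
  filter_upwards [h.eventuallyEq_nhds] with y hy
  ext u v
  simp only [kahlerMetric_apply, (hy.fderiv (𝕜 := ℝ)).fderiv_eq]

/-- Real affine functions have zero Hessian. The unbounded terms in the potentials, such as the
logarithm of the product of the scales and that of `|s_{m₀}|²`, are removed in this way. -/
lemma kahlerMetric_add_affine {φ ψ : V → ℝ} {x : V} {c : ℝ} {A : V →L[ℝ] ℝ}
    (hψ : ∀ᶠ y in 𝓝 x, ContDiffAt ℝ ∞ ψ y) (h : ∀ᶠ y in 𝓝 x, φ y = ψ y + (c + A y)) :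
    kahlerMetric φ =ᶠ[𝓝 x] kahlerMetric ψ := by
  refine (kahlerMetric_congr h).trans ?_
  filter_upwards [hψ.eventually_nhds] with y hy
  have h1 : (fderiv ℝ fun y => ψ y + (c + A y)) =ᶠ[𝓝 y] fun z => fderiv ℝ ψ z + A := by
    filter_upwards [hy] with z hz
    have hd : DifferentiableAt ℝ ψ z := hz.differentiableAt (by simp)
    rw [fderiv_fun_add hd (by fun_prop), fderiv_const_add, A.fderiv]
  ext u v
  simp only [kahlerMetric_apply, h1.fderiv_eq, fderiv_add_const]

/-- A positive definite form is bounded below by `c > 0` on the compact unit sphere, and a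
perturbation of norm less than `c` cannot destroy positivity. -/
lemma eventually_posDef {F : Type*} [NormedAddCommGroup F] [NormedSpace ℝ F]
    [FiniteDimensional ℝ F] {B : F →L[ℝ] F →L[ℝ] ℝ} (hB : ∀ v, v ≠ 0 → 0 < B v v) :
    ∀ᶠ B' in 𝓝 B, ∀ v, v ≠ 0 → 0 < B' v v := by
  have hcont : ContinuousOn (fun v => B v v) (Metric.sphere (0 : F) 1) := by fun_prop
  obtain ⟨c, hc, hcb⟩ := (isCompact_sphere (0 : F) 1).exists_forall_le' hcont (a := 0) (by
    intro v hv
    refine hB v ?_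
    rintro rfl
    simp at hv)
  filter_upwards [Metric.ball_mem_nhds B hc] with B' hB' v hv
  have hn : 0 < ‖v‖ := norm_pos_iff.2 hv
  have h1 := hcb (‖v‖⁻¹ • v) (by simp [norm_smul, hn.ne'])
  simp only [map_smul, smul_apply, smul_eq_mul] at h1
  have h2 : c * ‖v‖ ^ 2 ≤ B v v := by
    have h3 := mul_le_mul_of_nonneg_left h1 (sq_nonneg ‖v‖)
    have h4 : ‖v‖ ^ 2 * (‖v‖⁻¹ * (‖v‖⁻¹ * B v v)) = B v v := by field_simp
    linarith
  have h3 : |(B' - B) v v| ≤ ‖B' - B‖ * ‖v‖ * ‖v‖ := (B' - B).le_opNorm₂ v v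
  have h4 : ‖B' - B‖ < c := (mem_ball_iff_norm (E := F →L[ℝ] F →L[ℝ] ℝ)).1 hB'
  have h5 := (abs_le.1 h3).1
  simp only [sub_apply] at h5
  have h6 : ‖B' - B‖ * ‖v‖ * ‖v‖ < c * ‖v‖ * ‖v‖ := by gcongr
  nlinarith

lemma contDiffAt_kahlerMetric {Φ : P → V → ℝ} {p : P × V}
    (h : ContDiffAt ℝ ∞ (Function.uncurry Φ) p) :
    ContDiffAt ℝ ∞ (Function.uncurry fun θ => kahlerMetric (Φ θ)) p := by
  have h1 : ContDiffAt ℝ ∞ (Function.uncurry fun θ => fderiv ℝ (Φ θ)) p :=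
    ContDiffAt.fderiv_family (a := Prod.fst) (b := Prod.snd) h contDiffAt_fst contDiffAt_snd
  have h2 : ContDiffAt ℝ ∞ (fun q : P × V => fderiv ℝ (fderiv ℝ (Φ q.1)) q.2) p :=
    ContDiffAt.fderiv_family (Φ := fun θ => fderiv ℝ (Φ θ)) (a := Prod.fst) (b := Prod.snd) h1
      contDiffAt_fst contDiffAt_snd
  refine ContDiffAt.const_smul _ (h2.add ?_)
  exact contDiffAt_flip ((contDiffAt_flip (h2.clm_comp contDiffAt_const)).clm_comp contDiffAt_const)

lemma isRegularAt_kahlerMetric [FiniteDimensional ℝ V] {Φ : P → V → ℝ} {p : P × V}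
    (h : ∀ᶠ q in 𝓝 p, ContDiffAt ℝ ∞ (Function.uncurry Φ) q)
    (hpos : ∀ v, v ≠ 0 → 0 < kahlerMetric (Φ p.1) p.2 v v) :
    IsRegularAt (fun θ => kahlerMetric (Φ θ)) p := by
  have hc := (contDiffAt_kahlerMetric h.self_of_nhds).continuousAt
  filter_upwards [h, hc.eventually (eventually_posDef hpos)] with q hq hq'
  refine ⟨contDiffAt_kahlerMetric hq, fun u v => ?_, hq'⟩
  have h1 : ContDiffAt ℝ ∞ (Φ q.1) q.2 :=
    ContDiffAt.comp q.2 (g := Function.uncurry Φ) (f := fun y => (q.1, y)) hq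
      (contDiffAt_const.prodMk contDiffAt_id)
  have h2 : IsSymmSndFDerivAt ℝ (Φ q.1) q.2 := h1.isSymmSndFDerivAt (by
    simp only [minSmoothness_of_isRCLikeNormedField]; exact ENat.LEInfty.out)
  rw [kahlerMetric_apply, kahlerMetric_apply, h2.eq u v, h2.eq (Complex.I • u)]

/-- Restriction to the line through `v` reduces positivity of the Hessian to a one variable
computation. -/
lemma fderiv_fderiv_apply_self {E : Type*} [NormedAddCommGroup E] [NormedSpace ℝ E] {φ : E → ℝ}
    (h : ∀ᶠ y in 𝓝 0, ContDiffAt ℝ ∞ φ y) (v : E) :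
    fderiv ℝ (fderiv ℝ φ) 0 v v = deriv (deriv fun s : ℝ => φ (s • v)) 0 := by
  have hl : ∀ s : ℝ, HasDerivAt (fun s : ℝ => s • v) v s := fun s => by
    simpa using (hasDerivAt_id s).smul_const v
  have hc : ContinuousAt (fun s : ℝ => s • v) 0 := (hl 0).continuousAt
  have h0 : ∀ᶠ y in 𝓝 ((0 : ℝ) • v), ContDiffAt ℝ ∞ φ y := by simpa using h
  have h1 : (deriv fun s : ℝ => φ (s • v)) =ᶠ[𝓝 0] fun s => fderiv ℝ φ (s • v) v := by
    filter_upwards [hc.eventually h0] with s hs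
    exact ((hs.differentiableAt (by simp)).hasFDerivAt.comp_hasDerivAt s (hl s)).deriv
  rw [h1.deriv_eq]
  have h2 : DifferentiableAt ℝ (fderiv ℝ φ) ((0 : ℝ) • v) :=
    (h0.self_of_nhds.fderiv_right (m := ∞) (by simp)).differentiableAt (by simp)
  have h3 : HasFDerivAt (fun y => fderiv ℝ φ y v)
      ((ContinuousLinearMap.apply ℝ ℝ v).comp (fderiv ℝ (fderiv ℝ φ) ((0 : ℝ) • v)))
      ((0 : ℝ) • v) :=
    (ContinuousLinearMap.apply ℝ ℝ v).hasFDerivAt.comp _ h2.hasFDerivAt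
  have h4 : HasDerivAt (fun s : ℝ => fderiv ℝ φ (s • v) v)
      (((ContinuousLinearMap.apply ℝ ℝ v).comp (fderiv ℝ (fderiv ℝ φ) ((0 : ℝ) • v))) v) 0 :=
    HasFDerivAt.comp_hasDerivAt (0 : ℝ) (l := fun y => fderiv ℝ φ y v) h3 (hl 0)
  rw [h4.deriv, zero_smul]
  rfl

end Kahler

/-! ### Convexity of the logarithm of a sum of products of inverse squares. -/

section LogSum

variable {α β : Type*}

lemma hasDerivAt_prod_inv_sq (s : Finset α) (x : α → ℝ) (t : ℝ) (h : ∀ a ∈ s, 1 - 2 * t * x a ≠ 0) :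
    HasDerivAt (fun t => ∏ a ∈ s, ((1 - 2 * t * x a)⁻¹) ^ 2)
      ((∏ a ∈ s, ((1 - 2 * t * x a)⁻¹) ^ 2) * ∑ a ∈ s, 4 * x a * (1 - 2 * t * x a)⁻¹) t := by
  classical
  induction s using Finset.induction_on with
  | empty => simpa using hasDerivAt_const t (1 : ℝ)
  | insert a s ha ih =>
    have h0 := h a (Finset.mem_insert_self a s)
    have h1 := ih fun b hb => h b (Finset.mem_insert_of_mem hb)
    have h2 : HasDerivAt (fun t => 1 - 2 * t * x a) (-(2 * x a)) t := by
      have := (((hasDerivAt_id t).const_mul 2).mul_const (x a)).const_sub 1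
      simpa using this
    have h3 := (h2.inv h0).pow 2 |>.mul h1
    simp only [Finset.prod_insert ha, Finset.sum_insert ha]
    refine HasDerivAt.congr_deriv (f := fun t => ((1 - 2 * t * x a)⁻¹) ^ 2 *
      ∏ a ∈ s, ((1 - 2 * t * x a)⁻¹) ^ 2) h3 ?_
    simp only [Pi.inv_apply, Pi.pow_apply]
    generalize 1 - 2 * t * x a = u
    norm_num
    ring

lemma hasDerivAt_sum_inv (s : Finset α) (x : α → ℝ) :
    HasDerivAt (fun t : ℝ => ∑ a ∈ s, 4 * x a * (1 - 2 * t * x a)⁻¹) (∑ a ∈ s, 8 * x a ^ 2) 0 := by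
  refine HasDerivAt.fun_sum fun a _ => ?_
  have h2 : HasDerivAt (fun t => 1 - 2 * t * x a) (-(2 * x a)) 0 := by
    have := (((hasDerivAt_id (0 : ℝ)).const_mul 2).mul_const (x a)).const_sub 1
    simpa using this
  refine ((h2.inv (by simp)).const_mul (4 * x a)).congr_deriv ?_
  simp; ring

/-- The second derivative at `0` of the logarithm of a sum of products of the `(1 - 2 t x)⁻²`. -/
lemma deriv_deriv_log_sum_ge (σ : Finset β) (sub : β → Finset α) (k : β → ℝ)
    (hk : ∀ S ∈ σ, 0 ≤ k S) (x : α → ℝ) (hsum : 0 < ∑ S ∈ σ, k S) :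
    (∑ S ∈ σ, k S * ∑ a ∈ sub S, 8 * x a ^ 2) / ∑ S ∈ σ, k S ≤
      deriv (deriv fun t : ℝ =>
        Real.log (∑ S ∈ σ, k S * ∏ a ∈ sub S, ((1 - 2 * t * x a)⁻¹) ^ 2)) 0 := by
  set p : β → ℝ → ℝ := fun S t => ∏ a ∈ sub S, ((1 - 2 * t * x a)⁻¹) ^ 2 with hp
  set d : β → ℝ → ℝ := fun S t => ∑ a ∈ sub S, 4 * x a * (1 - 2 * t * x a)⁻¹ with hd
  set h : ℝ → ℝ := fun t => ∑ S ∈ σ, k S * p S t with hh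
  set h' : ℝ → ℝ := fun t => ∑ S ∈ σ, k S * (p S t * d S t) with hh'
  have p0 : ∀ S, p S 0 = 1 := fun S => by simp [hp]
  have hne : ∀ᶠ t in 𝓝 (0 : ℝ), ∀ S ∈ σ, ∀ a ∈ sub S, 1 - 2 * t * x a ≠ 0 := by
    refine (Finset.eventually_all _).2 fun S _ => (Finset.eventually_all _).2 fun a _ => ?_
    refine ContinuousAt.eventually_ne (by fun_prop) (by simp)
  have der : ∀ᶠ t in 𝓝 (0 : ℝ), HasDerivAt h (h' t) t := by
    filter_upwards [hne] with t ht
    exact HasDerivAt.fun_sum fun S hS =>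
      (hasDerivAt_prod_inv_sq (sub S) x t (ht S hS)).const_mul (k S)
  have h00 : h 0 = ∑ S ∈ σ, k S := by simp [hh, p0]
  have hpos : ∀ᶠ t in 𝓝 (0 : ℝ), 0 < h t :=
    der.self_of_nhds.continuousAt.eventually_const_lt (by rw [h00]; exact hsum)
  have der1 : deriv (fun t => Real.log (h t)) =ᶠ[𝓝 0] fun t => h' t / h t := by
    filter_upwards [der, hpos] with t ht ht'
    exact (ht.log ht'.ne').deriv
  have der2 : HasDerivAt h' (∑ S ∈ σ, k S * ((d S 0) ^ 2 + ∑ a ∈ sub S, 8 * x a ^ 2)) 0 := by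
    refine HasDerivAt.fun_sum fun S hS => HasDerivAt.const_mul (k S) ?_
    have h1 := hasDerivAt_prod_inv_sq (sub S) x 0 (by simp)
    have h2 := hasDerivAt_sum_inv (sub S) x
    refine (h1.mul h2).congr_deriv ?_
    simp [hd]; ring
  have h0 : 0 < h 0 := by rw [h00]; exact hsum
  have h'0 : h' 0 = ∑ S ∈ σ, k S * d S 0 := by simp [hh', p0]
  have der3 : deriv (fun t => h' t / h t) 0 = _ := (der2.div der.self_of_nhds h0.ne').deriv
  rw [der1.deriv_eq, der3]
  -- The quotient rule produces the weighted variance of the logarithmic derivatives `d S`,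
  -- nonnegative by Cauchy-Schwarz, plus the weighted mean of their derivatives `∑ 8 x²`.
  have cs : (∑ S ∈ σ, k S * d S 0) ^ 2 ≤ (∑ S ∈ σ, k S) * ∑ S ∈ σ, k S * (d S 0) ^ 2 :=
    Finset.sum_sq_le_sum_mul_sum_of_sq_le_mul σ (fun S hS => hk S hS)
      (fun S hS => mul_nonneg (hk S hS) (sq_nonneg _)) (fun S hS => le_of_eq (by ring))
  rw [h'0, h00, div_le_div_iff₀ hsum (by positivity)]
  simp only [mul_add, Finset.sum_add_distrib]
  nlinarith

end LogSum

/-! ### Smooth extension by zero of exponentially small functions. -/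

section Decay

/-- The function `r⁻ᵏ exp (-y / r)` of `(r, y)`, extended by zero to `r ≤ 0`. -/
def decay (k : ℕ) (p : ℝ × ℂ) : ℂ :=
  if 0 < p.1 then ((p.1 : ℂ)⁻¹) ^ k * Complex.exp (-p.2 / p.1) else 0

/-- The term of order `k + 2` in the exponential series absorbs `r⁻ᵏ` and leaves `r²`, which is what
makes the derivative vanish at `r = 0`. -/
lemma norm_decay_le (k : ℕ) {a : ℝ} (ha : 0 < a) (p : ℝ × ℂ) (hp : a ≤ p.2.re) :
    ‖decay k p‖ ≤ ((k + 2).factorial / a ^ (k + 2)) * p.1 ^ 2 := by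
  unfold decay
  split_ifs with h
  · have h1 : (-p.2 / (p.1 : ℂ)).re = -(p.2.re / p.1) := by
      rw [Complex.div_ofReal_re, Complex.neg_re, neg_div]
    rw [norm_mul, norm_pow, norm_inv, Complex.norm_real, Real.norm_of_nonneg h.le, Complex.norm_exp,
      h1]
    have h2 : Real.exp (-(p.2.re / p.1)) ≤ Real.exp (-(a / p.1)) :=
      Real.exp_le_exp.2 (neg_le_neg (by gcongr))
    have h3 := Real.pow_div_factorial_le_exp (a / p.1) (by positivity) (k + 2)
    have h4 : Real.exp (-(a / p.1)) ≤ ((a / p.1) ^ (k + 2) / (k + 2).factorial)⁻¹ := by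
      rw [Real.exp_neg]
      exact inv_anti₀ (by positivity) h3
    calc (p.1⁻¹) ^ k * Real.exp (-(p.2.re / p.1))
        ≤ (p.1⁻¹) ^ k * ((a / p.1) ^ (k + 2) / (k + 2).factorial)⁻¹ := by
          have := h2.trans h4
          gcongr
      _ = ((k + 2).factorial / a ^ (k + 2)) * p.1 ^ 2 := by
          have := h.ne'
          rw [inv_pow, div_pow]
          field_simp
          ring
  · simp only [norm_zero]
    positivity

/-- The derivative of `decay k`. -/
def decayDeriv (k : ℕ) (p : ℝ × ℂ) : ℝ × ℂ →L[ℝ] ℂ :=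
  (p.2 * decay (k + 2) p - k * decay (k + 1) p) •
      (Complex.ofRealCLM.comp (ContinuousLinearMap.fst ℝ ℝ ℂ)) -
    decay (k + 1) p • ContinuousLinearMap.snd ℝ ℝ ℂ

lemma hasFDerivAt_decay (k : ℕ) (p : ℝ × ℂ) (hp : 0 < p.2.re) :
    HasFDerivAt (decay k) (decayDeriv k p) p := by
  rcases lt_trichotomy p.1 0 with h | h | h
  · have h0 : ∀ᶠ q in 𝓝 p, q.1 < 0 := continuousAt_fst.eventually_lt_const h
    have h1 : decay k =ᶠ[𝓝 p] fun _ => 0 := h0.mono fun q hq => by simp [decay, hq.not_gt]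
    have h2 : decayDeriv k p = 0 := by
      ext <;> simp [decayDeriv, decay, h.not_gt]
    rw [h2]
    exact (hasFDerivAt_const 0 p).congr_of_eventuallyEq h1
  · have h2 : decayDeriv k p = 0 := by ext <;> simp [decayDeriv, decay, h]
    have h3 : decay k p = 0 := by simp [decay, h]
    rw [h2]
    set a := p.2.re / 2
    have ha : 0 < a := by positivity
    have h0 : ∀ᶠ q : ℝ × ℂ in 𝓝 p, a < q.2.re := by
      have hc : ContinuousAt (fun q : ℝ × ℂ => q.2.re) p := by fun_prop
      exact hc.eventually_const_lt (by simp only [a]; linarith)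
    rw [hasFDerivAt_iff_isLittleO]
    simp only [h3, sub_zero, zero_apply]
    have hO : (decay k) =O[𝓝 p] fun q => (q.1) ^ 2 := by
      refine Asymptotics.IsBigO.of_bound ((k + 2).factorial / a ^ (k + 2)) ?_
      filter_upwards [h0] with q hq
      refine (norm_decay_le k ha q hq.le).trans (le_of_eq ?_)
      rw [Real.norm_of_nonneg (sq_nonneg _)]
    refine hO.trans_isLittleO ?_
    have hO2 : (fun q : ℝ × ℂ => q.1) =O[𝓝 p] fun q => q - p := by
      refine Asymptotics.IsBigO.of_bound 1 (Filter.Eventually.of_forall fun q => ?_)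
      have := norm_fst_le (q - p)
      simpa [h] using this
    have hl : (fun q : ℝ × ℂ => q.1) =o[𝓝 p] fun _ => (1 : ℝ) := by
      rw [Asymptotics.isLittleO_one_iff]
      simpa [h] using (continuousAt_fst (p := p)).tendsto
    have h5 : (fun q : ℝ × ℂ => q.1 ^ 2) =o[𝓝 p] fun q => ‖q - p‖ := by
      have h6 := hO2.norm_right.mul_isLittleO hl
      simpa [pow_two] using h6
    exact h5.of_norm_right
  · have h0 : ∀ᶠ q : ℝ × ℂ in 𝓝 p, 0 < q.1 := continuousAt_fst.eventually_const_lt h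
    have h1 : decay k =ᶠ[𝓝 p] fun q => ((q.1 : ℂ)⁻¹) ^ k * Complex.exp (-q.2 * (q.1 : ℂ)⁻¹) :=
      h0.mono fun q hq => by simp [decay, hq, div_eq_mul_inv]
    have hne : (p.1 : ℂ) ≠ 0 := by exact_mod_cast h.ne'
    have e1 : HasFDerivAt (fun q : ℝ × ℂ => (q.1 : ℂ))
        (Complex.ofRealCLM.comp (ContinuousLinearMap.fst ℝ ℝ ℂ)) p :=
      (Complex.ofRealCLM.comp (ContinuousLinearMap.fst ℝ ℝ ℂ)).hasFDerivAt
    have e2 : HasFDerivAt (fun q : ℝ × ℂ => (q.1 : ℂ)⁻¹)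
        ((-((p.1 : ℂ) ^ 2)⁻¹) • (Complex.ofRealCLM.comp (ContinuousLinearMap.fst ℝ ℝ ℂ))) p :=
      (hasDerivAt_inv hne).comp_hasFDerivAt p e1
    have e3 := (hasFDerivAt_snd (𝕜 := ℝ) (p := p)).neg.mul e2
    have e4 := (e2.pow k).mul e3.cexp
    refine (e4.congr_of_eventuallyEq h1).congr_fderiv ?_
    ext q
    · simp [decayDeriv, decay, h, div_eq_mul_inv]
      cases k with
      | zero => simp; ring
      | succ k => simp; ring
    · simp [decayDeriv, decay, h, div_eq_mul_inv]
      ring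

/-- Differentiation of `decay k` yields only `decay (k + 1)` and `decay (k + 2)` with polynomial
coefficients, so the induction on the order has to run for all `k` at once. -/
lemma contDiffOn_decay (n : ℕ) (k : ℕ) : ContDiffOn ℝ n (decay k) {p | 0 < p.2.re} := by
  have hopen : IsOpen {p : ℝ × ℂ | 0 < p.2.re} :=
    isOpen_lt continuous_const (Complex.continuous_re.comp continuous_snd)
  induction n generalizing k with
  | zero =>
    rw [Nat.cast_zero, contDiffOn_zero]
    exact fun p hp => (hasFDerivAt_decay k p hp).continuousAt.continuousWithinAt
  | succ n ih =>
    rw [Nat.cast_succ, contDiffOn_succ_iff_fderiv_of_isOpen hopen]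
    refine ⟨fun p hp => (hasFDerivAt_decay k p hp).differentiableAt.differentiableWithinAt,
      by simp, ?_⟩
    refine ContDiffOn.congr (f := decayDeriv k) ?_ fun p hp => (hasFDerivAt_decay k p hp).fderiv
    unfold decayDeriv
    have h1 := ih (k + 1)
    have h2 := ih (k + 2)
    refine ContDiffOn.sub (ContDiffOn.smul (ContDiffOn.sub (contDiffOn_snd.mul h2)
      (contDiffOn_const.mul h1)) contDiffOn_const) (h1.smul contDiffOn_const)

lemma contDiffAt_decay (k : ℕ) (p : ℝ × ℂ) (hp : 0 < p.2.re) : ContDiffAt ℝ ∞ (decay k) p := by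
  have hopen : IsOpen {p : ℝ × ℂ | 0 < p.2.re} :=
    isOpen_lt continuous_const (Complex.continuous_re.comp continuous_snd)
  exact (contDiffOn_infty.2 fun n => contDiffOn_decay n k).contDiffAt (hopen.mem_nhds hp)

end Decay

/-! ### Model potentials and their regularity for small inverse scales. -/

section Model

variable {ι σ V : Type*} [NormedAddCommGroup V] [NormedSpace ℂ V]

/-- The parameters of a model potential, apart from the inverse scales: the scaled characters
`c`, the phases `u` and the weights `q` of the simplices. -/
abbrev ModelParam (ι σ V : Type*) [NormedAddCommGroup V] [NormedSpace ℂ V] : Type _ :=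
  (ι → V →L[ℂ] ℂ) × (ι → ℂ) × (σ → ℝ)

/-- The characters `u exp (-(1/2 - c ζ) / r)` with inverse scales `r`. -/
def modelChar (θ : ModelParam ι σ V × (ι → ℝ)) (ζ : V) : ι → ℂ :=
  fun m => θ.1.2.1 m * decay 0 (θ.2 m, 1 / 2 - θ.1.1 m ζ)

lemma modelChar_of_zero (κ : ModelParam ι σ V) (ζ : V) : modelChar (κ, (0 : ι → ℝ)) ζ = 0 := by
  funext m
  simp [modelChar, decay]

variable [Fintype σ]

/-- The argument of the logarithm in the model potential. -/
def modelSum (sub : σ → Finset ι) (N : σ → (ι → ℂ) → ℝ) (B : ι → (ι → ℂ) → ℝ)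
    (θ : ModelParam ι σ V × (ι → ℝ)) (ζ : V) : ℝ :=
  ∑ S, θ.1.2.2 S * N S (modelChar θ ζ) *
    ∏ m ∈ sub S, ((1 - 2 * (θ.1.1 m ζ).re + θ.2 m * B m (modelChar θ ζ))⁻¹) ^ 2

/-- The model potential. -/
def modelPotential (sub : σ → Finset ι) (H : (ι → ℂ) → ℝ) (N : σ → (ι → ℂ) → ℝ)
    (B : ι → (ι → ℂ) → ℝ) (θ : ModelParam ι σ V × (ι → ℝ)) (ζ : V) : ℝ :=
  H (modelChar θ ζ) + Real.log (modelSum sub N B θ ζ)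

lemma modelSum_of_zero (sub : σ → Finset ι) (N : σ → (ι → ℂ) → ℝ) (B : ι → (ι → ℂ) → ℝ)
    (κ : ModelParam ι σ V) (ζ : V) :
    modelSum sub N B (κ, (0 : ι → ℝ)) ζ =
      ∑ S, κ.2.2 S * N S 0 * ∏ m ∈ sub S, ((1 - 2 * (κ.1 m ζ).re)⁻¹) ^ 2 := by
  simp [modelSum, modelChar_of_zero]

variable [Fintype ι]

lemma contDiff_modelPairing (m : ι) :
    ContDiff ℝ ∞ (fun q : (ModelParam ι σ V × (ι → ℝ)) × V => q.1.1.1 m q.2) := by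
  have h : ContDiff ℂ ∞ (fun p : (V →L[ℂ] ℂ) × V => p.1 p.2) := isBoundedBilinearMap_apply.contDiff
  have h1 : ContDiff ℝ ∞ (fun p : (V →L[ℂ] ℂ) × V => p.1 p.2) := h.restrict_scalars ℝ
  have h2 : ContDiff ℝ ∞ (fun q : (ModelParam ι σ V × (ι → ℝ)) × V => (q.1.1.1 m, q.2)) := by
    fun_prop
  exact h1.comp h2

lemma contDiffAt_modelChar {q : (ModelParam ι σ V × (ι → ℝ)) × V}
    (hq : ∀ m, 0 < (1 / 2 - q.1.1.1 m q.2).re) :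
    ContDiffAt ℝ ∞ (fun q : (ModelParam ι σ V × (ι → ℝ)) × V => modelChar q.1 q.2) q := by
  refine contDiffAt_pi.2 fun m => ?_
  unfold modelChar
  refine ContDiffAt.mul (by fun_prop) ?_
  have h := (contDiff_modelPairing (σ := σ) (V := V) m).contDiffAt (x := q)
  refine ContDiffAt.comp q (g := decay 0)
    (f := fun q : (ModelParam ι σ V × (ι → ℝ)) × V => (q.1.2 m, 1 / 2 - q.1.1.1 m q.2))
    (contDiffAt_decay 0 _ (hq m)) ?_
  exact ContDiffAt.prodMk (by fun_prop) (contDiffAt_const.sub h)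

variable {sub : σ → Finset ι} {H : (ι → ℂ) → ℝ} {N : σ → (ι → ℂ) → ℝ} {B : ι → (ι → ℂ) → ℝ} {δ : ℝ}

lemma contDiffAt_modelDenominator (hB : ∀ m, ∀ z ∈ Metric.ball (0 : ι → ℂ) δ,
      ContDiffAt ℝ ∞ (B m) z) {q : (ModelParam ι σ V × (ι → ℝ)) × V}
    (hq : ∀ m, 0 < (1 / 2 - q.1.1.1 m q.2).re) (hz : modelChar q.1 q.2 ∈ Metric.ball 0 δ) (m : ι) :
    ContDiffAt ℝ ∞ (fun q : (ModelParam ι σ V × (ι → ℝ)) × V =>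
      1 - 2 * (q.1.1.1 m q.2).re + q.1.2 m * B m (modelChar q.1 q.2)) q := by
  have hZ := contDiffAt_modelChar hq
  have h1 : ContDiffAt ℝ ∞
      (fun q : (ModelParam ι σ V × (ι → ℝ)) × V => (q.1.1.1 m q.2).re) q :=
    Complex.reCLM.contDiff.contDiffAt.comp q (contDiff_modelPairing (σ := σ) m).contDiffAt
  have h2 : ContDiffAt ℝ ∞ (fun q : (ModelParam ι σ V × (ι → ℝ)) × V =>
      B m (modelChar q.1 q.2)) q := ContDiffAt.comp q (g := B m) (hB m _ hz) hZ
  exact (contDiffAt_const.sub (contDiffAt_const.mul h1)).add (ContDiffAt.mul (by fun_prop) h2)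

lemma contDiffAt_modelSum
    (hN : ∀ S, ∀ z ∈ Metric.ball (0 : ι → ℂ) δ, ContDiffAt ℝ ∞ (N S) z)
    (hB : ∀ m, ∀ z ∈ Metric.ball (0 : ι → ℂ) δ, ContDiffAt ℝ ∞ (B m) z)
    {q : (ModelParam ι σ V × (ι → ℝ)) × V}
    (hq : ∀ m, 0 < (1 / 2 - q.1.1.1 m q.2).re) (hz : modelChar q.1 q.2 ∈ Metric.ball 0 δ)
    (hne : ∀ m, 1 - 2 * (q.1.1.1 m q.2).re + q.1.2 m * B m (modelChar q.1 q.2) ≠ 0) :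
    ContDiffAt ℝ ∞ (fun q : (ModelParam ι σ V × (ι → ℝ)) × V => modelSum sub N B q.1 q.2) q := by
  have hZ := contDiffAt_modelChar hq
  unfold modelSum
  refine ContDiffAt.sum fun S _ => ContDiffAt.mul (ContDiffAt.mul (by fun_prop) ?_) ?_
  · exact ContDiffAt.comp q (g := N S) (hN S _ hz) hZ
  · exact contDiffAt_prod fun m _ =>
      ((contDiffAt_modelDenominator hB hq hz m).inv (hne m)).pow 2

/-- At the base point `r = 0`, `ζ = 0` all characters vanish, all denominators are `1` and the sum
is positive. These are open conditions, and the neighbourhood also contains negative `r`, where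
`decay` is zero. -/
lemma eventually_contDiffAt_modelPotential (hδ : 0 < δ)
    (hH : ∀ z ∈ Metric.ball (0 : ι → ℂ) δ, ContDiffAt ℝ ∞ H z)
    (hN : ∀ S, ∀ z ∈ Metric.ball (0 : ι → ℂ) δ, ContDiffAt ℝ ∞ (N S) z)
    (hB : ∀ m, ∀ z ∈ Metric.ball (0 : ι → ℂ) δ, ContDiffAt ℝ ∞ (B m) z)
    {κ : ModelParam ι σ V} (hpos : 0 < ∑ S, κ.2.2 S * N S 0) :
    ∀ᶠ q in 𝓝 ((κ, (0 : ι → ℝ)), (0 : V)),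
      ContDiffAt ℝ ∞ (Function.uncurry (modelPotential sub H N B)) q ∧
        0 < modelSum sub N B q.1 q.2 := by
  set q₀ : (ModelParam ι σ V × (ι → ℝ)) × V := ((κ, (0 : ι → ℝ)), (0 : V)) with hq₀
  have hq : ∀ m, 0 < (1 / 2 - q₀.1.1.1 m q₀.2).re := by intro m; simp [hq₀]
  have hz : modelChar q₀.1 q₀.2 ∈ Metric.ball 0 δ := by
    simp only [hq₀, modelChar_of_zero]; simpa using hδ
  have hne : ∀ m, 1 - 2 * (q₀.1.1.1 m q₀.2).re + q₀.1.2 m * B m (modelChar q₀.1 q₀.2) ≠ 0 := by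
    intro m; simp [hq₀]
  have hs : 0 < modelSum sub N B q₀.1 q₀.2 := by
    simp only [hq₀, modelSum_of_zero]; simpa using hpos
  have E1 : ∀ᶠ q : (ModelParam ι σ V × (ι → ℝ)) × V in 𝓝 q₀,
      ∀ m, 0 < (1 / 2 - q.1.1.1 m q.2).re := by
    refine Filter.eventually_all.2 fun m => ?_
    have hc : ContinuousAt (fun q : (ModelParam ι σ V × (ι → ℝ)) × V =>
        (1 / 2 - q.1.1.1 m q.2).re) q₀ :=
      Complex.continuous_re.continuousAt.comp
        (continuousAt_const.sub (contDiff_modelPairing (σ := σ) m).continuous.continuousAt)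
    exact hc.eventually_const_lt (hq m)
  have E2 := (contDiffAt_modelChar hq).continuousAt.eventually (Metric.isOpen_ball.mem_nhds hz)
  have E3 : ∀ᶠ q : (ModelParam ι σ V × (ι → ℝ)) × V in 𝓝 q₀,
      ∀ m, 1 - 2 * (q.1.1.1 m q.2).re + q.1.2 m * B m (modelChar q.1 q.2) ≠ 0 :=
    Filter.eventually_all.2 fun m =>
      (contDiffAt_modelDenominator hB hq hz m).continuousAt.eventually_ne (hne m)
  have E4 := (contDiffAt_modelSum (sub := sub) hN hB hq hz hne).continuousAt.eventually_const_lt hs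
  filter_upwards [E1, E2, E3, E4] with q h1 h2 h3 h4
  refine ⟨ContDiffAt.add (ContDiffAt.comp q (g := H) (hH _ h2) (contDiffAt_modelChar h1)) ?_, h4⟩
  exact (contDiffAt_modelSum (sub := sub) hN hB h1 h2 h3).log h4.ne'

/-- For `r = 0` the characters vanish identically, so `H`, `N` and `B` contribute constants or drop
out and `deriv_deriv_log_sum_ge` applies on each line. The summand of `S₀` detects the real parts of
the functionals in `sub S₀`. The Kähler form adds the Hessian on `i v`, which detects the imaginary
parts. -/
lemma modelPotential_posDef (hδ : 0 < δ)
    (hH : ∀ z ∈ Metric.ball (0 : ι → ℂ) δ, ContDiffAt ℝ ∞ H z)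
    (hN : ∀ S, ∀ z ∈ Metric.ball (0 : ι → ℂ) δ, ContDiffAt ℝ ∞ (N S) z)
    (hB : ∀ m, ∀ z ∈ Metric.ball (0 : ι → ℂ) δ, ContDiffAt ℝ ∞ (B m) z)
    {κ : ModelParam ι σ V} (hnn : ∀ S, 0 ≤ κ.2.2 S * N S 0) {S₀ : σ}
    (hS₀ : 0 < κ.2.2 S₀ * N S₀ 0) (hinj : ∀ v, (∀ m ∈ sub S₀, κ.1 m v = 0) → v = 0)
    (v : V) (hv : v ≠ 0) :
    0 < kahlerMetric (modelPotential sub H N B (κ, (0 : ι → ℝ))) 0 v v := by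
  have hpos : 0 < ∑ S, κ.2.2 S * N S 0 :=
    Finset.sum_pos' (fun S _ => hnn S) ⟨S₀, Finset.mem_univ _, hS₀⟩
  set φ : V → ℝ := modelPotential sub H N B (κ, (0 : ι → ℝ)) with hφ
  have hsm : ∀ᶠ y in 𝓝 (0 : V), ContDiffAt ℝ ∞ φ y := by
    have h1 := eventually_contDiffAt_modelPotential (sub := sub) hδ hH hN hB hpos
    have h2 : ContinuousAt (fun y : V => ((κ, (0 : ι → ℝ)), y)) 0 := by fun_prop
    filter_upwards [h2.eventually h1] with y hy
    exact ContDiffAt.comp y (g := Function.uncurry (modelPotential sub H N B))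
      (f := fun y => ((κ, (0 : ι → ℝ)), y)) hy.1 (contDiffAt_const.prodMk contDiffAt_id)
  have key : ∀ u : V, (∑ S, κ.2.2 S * N S 0 * ∑ m ∈ sub S, 8 * (κ.1 m u).re ^ 2) /
      ∑ S, κ.2.2 S * N S 0 ≤ fderiv ℝ (fderiv ℝ φ) 0 u u := by
    intro u
    rw [fderiv_fderiv_apply_self hsm]
    have h1 : (fun s : ℝ => φ (s • u)) = fun s => H 0 + Real.log (∑ S, κ.2.2 S * N S 0 *
        ∏ m ∈ sub S, ((1 - 2 * s * (κ.1 m u).re)⁻¹) ^ 2) := by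
      funext s
      have h2 : ∀ m, (κ.1 m (s • u)).re = s * (κ.1 m u).re := by
        intro m
        have : s • u = (s : ℂ) • u := (Complex.coe_smul s u).symm
        rw [this, map_smul, smul_eq_mul, Complex.re_ofReal_mul]
      simp only [hφ, modelPotential, modelChar_of_zero, modelSum_of_zero, h2, mul_assoc]
    have h3 : deriv (fun s : ℝ => φ (s • u)) = deriv fun s => Real.log (∑ S, κ.2.2 S * N S 0 *
        ∏ m ∈ sub S, ((1 - 2 * s * (κ.1 m u).re)⁻¹) ^ 2) := by
      rw [h1]
      funext s
      rw [deriv_const_add]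
    rw [h3]
    exact deriv_deriv_log_sum_ge Finset.univ sub (fun S => κ.2.2 S * N S 0) (fun S _ => hnn S)
      (fun m => (κ.1 m u).re) hpos
  have nn : ∀ u : V, ∀ S, 0 ≤ κ.2.2 S * N S 0 * ∑ m ∈ sub S, 8 * (κ.1 m u).re ^ 2 := fun u S =>
    mul_nonneg (hnn S) (Finset.sum_nonneg fun m _ => by positivity)
  have nn' : ∀ u : V, 0 ≤ fderiv ℝ (fderiv ℝ φ) 0 u u := fun u =>
    le_trans (div_nonneg (Finset.sum_nonneg fun S _ => nn u S) hpos.le) (key u)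
  have strict : ∀ u : V, ∀ m ∈ sub S₀, (κ.1 m u).re ≠ 0 → 0 < fderiv ℝ (fderiv ℝ φ) 0 u u := by
    intro u m hm hne
    refine lt_of_lt_of_le (div_pos (Finset.sum_pos' (fun S _ => nn u S)
      ⟨S₀, Finset.mem_univ _, mul_pos hS₀ ?_⟩) hpos) (key u)
    exact Finset.sum_pos' (fun m _ => by positivity) ⟨m, hm, by positivity⟩
  rw [kahlerMetric_apply]
  refine mul_pos (by positivity) ?_
  obtain ⟨m, hm, hmv⟩ : ∃ m ∈ sub S₀, κ.1 m v ≠ 0 := by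
    by_contra hcon
    push Not at hcon
    exact hv (hinj v hcon)
  by_cases hre : (κ.1 m v).re = 0
  · refine add_pos_of_nonneg_of_pos (nn' v) (strict _ m hm ?_)
    intro h
    refine hmv (Complex.ext hre ?_)
    simpa [map_smul] using h
  · exact add_pos_of_pos_of_nonneg (strict v m hm hre) (nn' _)

/-- Regularity is an open condition that holds on `K × {0}`. Compactness of `K` then gives one bound
`ρ` on the inverse scales that is valid for all parameters. -/
lemma exists_isRegularAt_modelPotential [FiniteDimensional ℝ V] (hδ : 0 < δ)
    (hH : ∀ z ∈ Metric.ball (0 : ι → ℂ) δ, ContDiffAt ℝ ∞ H z)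
    (hN : ∀ S, ∀ z ∈ Metric.ball (0 : ι → ℂ) δ, ContDiffAt ℝ ∞ (N S) z)
    (hB : ∀ m, ∀ z ∈ Metric.ball (0 : ι → ℂ) δ, ContDiffAt ℝ ∞ (B m) z)
    {K : Set (ModelParam ι σ V)} (hK : IsCompact K)
    (hKnn : ∀ κ ∈ K, ∀ S, 0 ≤ κ.2.2 S * N S 0)
    (hKpos : ∀ κ ∈ K, ∃ S₀, 0 < κ.2.2 S₀ * N S₀ 0 ∧ ∀ v, (∀ m ∈ sub S₀, κ.1 m v = 0) → v = 0) :
    ∃ ρ : ℝ, 0 < ρ ∧ ∀ κ ∈ K, ∀ r : ι → ℝ, (∀ m, 0 ≤ r m ∧ r m ≤ ρ) →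
      IsRegularAt (fun θ => kahlerMetric (modelPotential sub H N B θ)) ((κ, r), (0 : V)) ∧
      ∀ᶠ y in 𝓝 (0 : V), ContDiffAt ℝ ∞ (modelPotential sub H N B (κ, r)) y ∧
        0 < modelSum sub N B (κ, r) y := by
  set good : (ModelParam ι σ V × (ι → ℝ)) × V → Prop := fun q =>
    IsRegularAt (fun θ => kahlerMetric (modelPotential sub H N B θ)) q ∧
      ∀ᶠ q' in 𝓝 q, ContDiffAt ℝ ∞ (Function.uncurry (modelPotential sub H N B)) q' ∧
        0 < modelSum sub N B q'.1 q'.2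
  have hopen : IsOpen {θ : ModelParam ι σ V × (ι → ℝ) | good (θ, 0)} := by
    have h1 : IsOpen {q | good q} := isOpen_setOfPred_eventually_nhds.inter isOpen_setOfPred_eventually_nhds
    exact h1.preimage (f := fun θ : ModelParam ι σ V × (ι → ℝ) => (θ, (0 : V))) (by fun_prop)
  have hsub : K ×ˢ {(0 : ι → ℝ)} ⊆ {θ : ModelParam ι σ V × (ι → ℝ) | good (θ, 0)} := by
    rintro ⟨κ, r⟩ ⟨hκ, hr⟩
    obtain rfl : r = 0 := hr
    obtain ⟨S₀, hS₀, hinj⟩ := hKpos κ hκ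
    have hpos : 0 < ∑ S, κ.2.2 S * N S 0 :=
      Finset.sum_pos' (fun S _ => hKnn κ hκ S) ⟨S₀, Finset.mem_univ _, hS₀⟩
    have h1 := eventually_contDiffAt_modelPotential (sub := sub) hδ hH hN hB hpos
    exact ⟨isRegularAt_kahlerMetric (h1.mono fun _ h => h.1)
      (modelPotential_posDef hδ hH hN hB (hKnn κ hκ) hS₀ hinj), h1⟩
  obtain ⟨u, v, -, hv, hKu, h0v, huv⟩ := generalized_tube_lemma hK isCompact_singleton hopen hsub
  obtain ⟨ε, hε, hball⟩ := Metric.isOpen_iff.1 hv 0 (h0v rfl)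
  refine ⟨ε / 2, by positivity, fun κ hκ r hr => ?_⟩
  have hrv : r ∈ v := by
    refine hball ?_
    rw [mem_ball_zero_iff]
    refine lt_of_le_of_lt ((pi_norm_le_iff_of_nonneg (by positivity)).2 fun m => ?_) (half_lt_self hε)
    rw [Real.norm_of_nonneg (hr m).1]
    exact (hr m).2
  have hg : good ((κ, r), 0) := huv ⟨hKu hκ, hrv⟩
  refine ⟨hg.1, ?_⟩
  have h2 : ContinuousAt (fun y : V => ((κ, r), y)) 0 := by fun_prop
  filter_upwards [h2.eventually hg.2] with y hy
  exact ⟨ContDiffAt.comp y (g := Function.uncurry (modelPotential sub H N B))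
    (f := fun y => ((κ, r), y)) hy.1 (contDiffAt_const.prodMk contDiffAt_id), hy.2⟩

end Model

/-! ### Linear algebra of the pairing between lattice points and vectors. -/

section Pairing

variable {l : ℕ}

lemma pairing_add {R : Type*} [CommRing R] (m : Fin l → ℤ) (u v : Fin l → R) :
    pairing m (u + v) = pairing m u + pairing m v := by
  simp [pairing, mul_add, Finset.sum_add_distrib]

lemma pairing_smul {R : Type*} [CommRing R] (m : Fin l → ℤ) (c : R) (v : Fin l → R) :
    pairing m (c • v) = c * pairing m v := by
  simp only [pairing, Pi.smul_apply, smul_eq_mul, Finset.mul_sum]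
  exact Finset.sum_congr rfl fun i _ => by ring

lemma pairing_sub_right {R : Type*} [CommRing R] (m : Fin l → ℤ) (u v : Fin l → R) :
    pairing m (u - v) = pairing m u - pairing m v := by
  simp [pairing, mul_sub, Finset.sum_sub_distrib]

lemma pairing_zero {R : Type*} [CommRing R] (m : Fin l → ℤ) : pairing m (0 : Fin l → R) = 0 := by
  simp [pairing]

lemma pairing_sum {R α : Type*} [CommRing R] (m : Fin l → ℤ) (s : Finset α) (v : α → Fin l → R) :
    pairing m (∑ a ∈ s, v a) = ∑ a ∈ s, pairing m (v a) := by
  classical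
  induction s using Finset.induction_on with
  | empty => simp [pairing_zero]
  | insert a s ha ih => rw [Finset.sum_insert ha, Finset.sum_insert ha, pairing_add, ih]

lemma pairing_sub_left {R : Type*} [CommRing R] (m m' : Fin l → ℤ) (v : Fin l → R) :
    pairing (m - m') v = pairing m v - pairing m' v := by
  simp [pairing, sub_mul, Finset.sum_sub_distrib]

lemma pairing_self_sub {R : Type*} [CommRing R] (m : Fin l → ℤ) (v : Fin l → R) :
    pairing (m - m) v = 0 := by
  rw [pairing_sub_left, sub_self]

/-- The real linear functional `v ↦ ∑ vᵢ dᵢ`. -/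
def dotFunctional (d : Fin l → ℝ) : (Fin l → ℝ) →ₗ[ℝ] ℝ where
  toFun v := ∑ i, v i * d i
  map_add' u v := by simp [add_mul, Finset.sum_add_distrib]
  map_smul' c v := by
    simp only [Pi.smul_apply, smul_eq_mul, RingHom.id_apply, Finset.mul_sum, mul_assoc]

lemma dotFunctional_toReal (d : Fin l → ℝ) (m m' : Fin l → ℤ) :
    dotFunctional d (toReal m - toReal m') = pairing (m - m') d := by
  simp [dotFunctional, pairing, toReal]

lemma eq_zero_of_dotFunctional {d : Fin l → ℝ} (h : ∀ v, dotFunctional d v = 0) : d = 0 := by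
  have h1 := h d
  simp only [dotFunctional, LinearMap.coe_mk, AddHom.coe_mk] at h1
  rw [Finset.sum_eq_zero_iff_of_nonneg (fun i _ => mul_self_nonneg _)] at h1
  funext i
  simpa using h1 i (Finset.mem_univ i)

end Pairing

/-! ### Cells of the decomposition and dual bases of top simplices. -/

section Cells

variable {l : ℕ} {Δ : Finset (Fin l → ℤ)} {w : (Fin l → ℤ) → ℝ} {m₀ m₁ : Fin l → ℤ}

/-- The same affine function is added to the supporting function of the cell. The normalization of
`w` therefore leaves the decomposition unchanged. -/
lemma isCell_congr {w w' : (Fin l → ℤ) → ℝ} {S : Finset (Fin l → ℤ)}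
    (h : ∃ (c : ℝ) (b : Fin l → ℝ), ∀ m ∈ Δ, w' m = w m + (c + pairing m b))
    (hS : IsCell Δ w S) : IsCell Δ w' S := by
  obtain ⟨c, b, hcb⟩ := h
  obtain ⟨hne, hsub, c', b', h1, h2⟩ := hS
  refine ⟨hne, hsub, c' + c, b' + b, fun m hm => ?_, fun m hm hmS => ?_⟩
  · rw [hcb m (hsub hm), h1 m hm, pairing_add]; ring
  · rw [hcb m hm, pairing_add]
    have := h2 m hm hmS
    linarith

lemma isCell_iff {w w' : (Fin l → ℤ) → ℝ} {S : Finset (Fin l → ℤ)}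
    (h : ∃ (c : ℝ) (b : Fin l → ℝ), ∀ m ∈ Δ, w' m = w m + (c + pairing m b)) :
    IsCell Δ w S ↔ IsCell Δ w' S := by
  refine ⟨isCell_congr h, isCell_congr ?_⟩
  obtain ⟨c, b, hcb⟩ := h
  refine ⟨-c, (-1 : ℝ) • b, fun m hm => ?_⟩
  rw [hcb m hm, pairing_smul]; ring

lemma mem_topCells {S : Finset (Fin l → ℤ)} :
    S ∈ topCells Δ w ↔ IsCell Δ w S ∧ S.card = l + 1 := by
  simp only [topCells, Finset.mem_filter, Finset.mem_powerset, and_iff_right_iff_imp]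
  exact fun h => h.1.2.1

lemma eq_zero_of_pairing_polytope (hΔ : IsIntegralPolytope Δ) (hm₀ : m₀ ∈ Δ) {d : Fin l → ℝ}
    (h : ∀ m ∈ Δ, pairing (m - m₀) d = 0) : d = 0 := by
  refine eq_zero_of_dotFunctional fun v => ?_
  have h1 : vectorSpan ℝ (toReal '' (Δ : Set (Fin l → ℤ))) = ⊤ := by
    rw [← direction_affineSpan, hΔ.1, AffineSubspace.direction_top]
  have hm : toReal m₀ ∈ toReal '' (Δ : Set (Fin l → ℤ)) := ⟨m₀, hm₀, rfl⟩
  rw [vectorSpan_eq_span_vsub_set_right ℝ hm] at h1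
  have h2 : (⊤ : Submodule ℝ (Fin l → ℝ)) ≤ LinearMap.ker (dotFunctional d) := by
    rw [← h1, Submodule.span_le]
    rintro _ ⟨_, ⟨m, hmΔ, rfl⟩, rfl⟩
    simp only [vsub_eq_sub, SetLike.mem_coe, LinearMap.mem_ker, dotFunctional_toReal]
    exact h m hmΔ
  exact h2 trivial

/-- Being affinely independent, the `l + 1` vertices affinely span the whole space, so the
differences `m - m₀` span it linearly. -/
lemma eq_zero_of_pairing_topCell (hsimp : IsSimplicial Δ w) {S : Finset (Fin l → ℤ)}
    (hS : S ∈ topCells Δ w) (hm₀ : m₀ ∈ S) {d : Fin l → ℝ}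
    (h : ∀ m ∈ S, pairing (m - m₀) d = 0) : d = 0 := by
  obtain ⟨hcell, hcard⟩ := mem_topCells.1 hS
  have hai := hsimp S hcell
  have htop : affineSpan ℝ (Set.range fun m : S => toReal (m : Fin l → ℤ)) = ⊤ := by
    rw [hai.affineSpan_eq_top_iff_card_eq_finrank_add_one]
    simp [hcard]
  refine eq_zero_of_dotFunctional fun v => ?_
  have h1 : vectorSpan ℝ (Set.range fun m : S => toReal (m : Fin l → ℤ)) = ⊤ := by
    rw [← direction_affineSpan, htop, AffineSubspace.direction_top]
  have hm : toReal m₀ ∈ Set.range fun m : S => toReal (m : Fin l → ℤ) := ⟨⟨m₀, hm₀⟩, rfl⟩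
  rw [vectorSpan_eq_span_vsub_set_right ℝ hm] at h1
  have h2 : (⊤ : Submodule ℝ (Fin l → ℝ)) ≤ LinearMap.ker (dotFunctional d) := by
    rw [← h1, Submodule.span_le]
    rintro _ ⟨_, ⟨m, rfl⟩, rfl⟩
    simp only [vsub_eq_sub, SetLike.mem_coe, LinearMap.mem_ker, dotFunctional_toReal]
    exact h m m.2
  exact h2 trivial

lemma eq_zero_of_pairing_topCell_complex (hsimp : IsSimplicial Δ w) {S : Finset (Fin l → ℤ)}
    (hS : S ∈ topCells Δ w) (hm₀ : m₀ ∈ S) {d : Fin l → ℂ}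
    (h : ∀ m ∈ S, pairing (m - m₀) d = 0) : d = 0 := by
  have hre : ∀ m ∈ S, pairing (m - m₀) (fun i => (d i).re) = 0 := fun m hm => by
    have := congrArg Complex.re (h m hm)
    simpa [pairing, Complex.re_sum] using this
  have him : ∀ m ∈ S, pairing (m - m₀) (fun i => (d i).im) = 0 := fun m hm => by
    have := congrArg Complex.im (h m hm)
    simpa [pairing, Complex.im_sum] using this
  have h1 := eq_zero_of_pairing_topCell hsimp hS hm₀ hre
  have h2 := eq_zero_of_pairing_topCell hsimp hS hm₀ him
  funext i
  exact Complex.ext (congrFun h1 i) (congrFun h2 i)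

/-- The dual basis of the differences `m - m₀` of the vertices of a top dimensional simplex. -/
lemma exists_dualBasis (hsimp : IsSimplicial Δ w) {S : Finset (Fin l → ℤ)}
    (hS : S ∈ topCells Δ w) (hm₀ : m₀ ∈ S) :
    ∃ e : (Fin l → ℤ) → Fin l → ℝ, ∀ m ∈ S, m ≠ m₀ →
      pairing (m - m₀) (e m) = 1 ∧ ∀ a ∈ S, a ≠ m → pairing (a - m₀) (e m) = 0 := by
  classical
  let Φ : (Fin l → ℝ) →ₗ[ℝ] (S.erase m₀ → ℝ) :=
    { toFun := fun d a => pairing ((a : Fin l → ℤ) - m₀) d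
      map_add' := fun u v => by funext a; exact pairing_add _ _ _
      map_smul' := fun c v => by funext a; exact pairing_smul _ _ _ }
  have hinj : Function.Injective Φ := by
    rw [← LinearMap.ker_eq_bot, LinearMap.ker_eq_bot']
    intro d hd
    refine eq_zero_of_pairing_topCell hsimp hS hm₀ fun m hm => ?_
    by_cases h : m = m₀
    · rw [h, pairing_self_sub]
    · exact congrFun hd ⟨m, Finset.mem_erase.2 ⟨h, hm⟩⟩
  have hfin : Module.finrank ℝ (Fin l → ℝ) = Module.finrank ℝ (S.erase m₀ → ℝ) := by
    simp [Finset.card_erase_of_mem hm₀, (mem_topCells.1 hS).2]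
  have hsurj : Function.Surjective Φ :=
    (LinearMap.injective_iff_surjective_of_finrank_eq_finrank hfin).1 hinj
  choose g hg using hsurj
  refine ⟨fun m => g fun a => if (a : Fin l → ℤ) = m then 1 else 0, fun m hm hne => ⟨?_, ?_⟩⟩
  · have := congrFun (hg fun a => if (a : Fin l → ℤ) = m then 1 else 0)
      ⟨m, Finset.mem_erase.2 ⟨hne, hm⟩⟩
    simpa [Φ] using this
  · intro a ha ham
    by_cases h : a = m₀
    · rw [h, pairing_self_sub]
    · have := congrFun (hg fun a => if (a : Fin l → ℤ) = m then 1 else 0)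
        ⟨a, Finset.mem_erase.2 ⟨h, ha⟩⟩
      simpa [Φ, ham] using this

end Cells

/-! ### Choice of a top simplex adapted to a point of the polyhedron. -/

section Growth

variable {l : ℕ} {Δ : Finset (Fin l → ℤ)} {w : (Fin l → ℤ) → ℝ} {m₀ m₁ : Fin l → ℤ}

/-- A ray that starts in a polyhedron given by `a + t b ≥ 0` leaves it through a facet. -/
lemma exists_hitting_time {α : Type*} (s : Finset α) (a b : α → ℝ) (ha : ∀ m ∈ s, 0 ≤ a m)
    (hb : ∃ m ∈ s, b m < 0) :
    ∃ t : ℝ, 0 ≤ t ∧ (∀ m ∈ s, 0 ≤ a m + t * b m) ∧ ∃ m ∈ s, b m < 0 ∧ a m + t * b m = 0 := by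
  classical
  obtain ⟨m₁, hm₁, hm₁b⟩ := hb
  obtain ⟨m, hm, hmin⟩ := (s.filter fun m => b m < 0).exists_min_image (fun m => a m / -b m)
    ⟨m₁, Finset.mem_filter.2 ⟨hm₁, hm₁b⟩⟩
  obtain ⟨hms, hmb⟩ := Finset.mem_filter.1 hm
  have ht : 0 ≤ a m / -b m := div_nonneg (ha m hms) (by linarith)
  refine ⟨a m / -b m, ht, fun m' hm' => ?_, m, hms, hmb, ?_⟩
  · by_cases h : b m' < 0
    · have h1 := hmin m' (Finset.mem_filter.2 ⟨hm', h⟩)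
      have h2 : a m / -b m * -b m' ≤ a m' := by
        rwa [le_div_iff₀ (by linarith)] at h1
      linarith
    · have := mul_nonneg ht (not_lt.1 h)
      linarith [ha m' hm']
  · have : b m ≠ 0 := hmb.ne
    field_simp
    ring

/-- The function `m ↦ τ w m + ⟨m - m₀, x⟩`. -/
def tilt (w : (Fin l → ℤ) → ℝ) (m₀ : Fin l → ℤ) (τ : ℝ) (x : Fin l → ℝ) (m : Fin l → ℤ) : ℝ :=
  τ * w m + pairing (m - m₀) x

/-- The zero set of the function `tilt`. -/
def tiltZeros (Δ : Finset (Fin l → ℤ)) (w : (Fin l → ℤ) → ℝ) (m₀ : Fin l → ℤ) (τ : ℝ)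
    (x : Fin l → ℝ) : Finset (Fin l → ℤ) :=
  by classical exact Δ.filter fun m => tilt w m₀ τ x m = 0

lemma mem_tiltZeros {τ : ℝ} {x : Fin l → ℝ} {m : Fin l → ℤ} :
    m ∈ tiltZeros Δ w m₀ τ x ↔ m ∈ Δ ∧ tilt w m₀ τ x m = 0 := by
  simp [tiltZeros]

/-- After division by `τ`, nonnegativity of `tilt` says that an affine function supports `w`, and
the zeros of `tilt` are exactly the points of contact. -/
lemma isCell_tiltZeros {τ : ℝ} (hτ : 0 < τ) {x : Fin l → ℝ} (hm₀ : m₀ ∈ Δ) (hw₀ : w m₀ = 0)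
    (hx : ∀ m ∈ Δ, 0 ≤ tilt w m₀ τ x m) : IsCell Δ w (tiltZeros Δ w m₀ τ x) := by
  refine ⟨⟨m₀, ?_⟩, fun m hm => (mem_tiltZeros.1 hm).1, τ⁻¹ * pairing m₀ x, (-τ⁻¹) • x,
    fun m hm => ?_, fun m hm hmn => ?_⟩
  · rw [mem_tiltZeros]
    exact ⟨hm₀, by rw [tilt, hw₀, pairing_self_sub]; ring⟩
  · have h := (mem_tiltZeros.1 hm).2
    rw [tilt, pairing_sub_left] at h
    rw [pairing_smul]
    field_simp
    linarith
  · have h1 : 0 < tilt w m₀ τ x m :=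
      lt_of_le_of_ne (hx m hm) fun h => hmn (mem_tiltZeros.2 ⟨hm, h.symm⟩)
    rw [tilt, pairing_sub_left] at h1
    rw [pairing_smul, ← sub_pos]
    have h2 : w m - (τ⁻¹ * pairing m₀ x + -τ⁻¹ * pairing m x)
        = τ⁻¹ * (τ * w m + (pairing m x - pairing m₀ x)) := by field_simp; ring
    rw [h2]
    positivity

/-- The inequalities of the vertices of the link imply those of all lattice points. -/
lemma tilt_nonneg_of_mem_polyhedron {τ : ℝ} (hτ : 0 < τ) (hm₀ : m₀ ∈ Δ) (hm₁ : m₁ ∈ Δ)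
    (hw₀ : w m₀ = 0) (hw₁ : w m₁ = 0) (hw : ∀ m ∈ Δ, 0 ≤ w m) {x : Fin l → ℝ}
    (hx : x ∈ polyhedron Δ w m₀ m₁ τ) {m : Fin l → ℤ} (hm : m ∈ Δ) : 0 ≤ tilt w m₀ τ x m := by
  by_contra! hneg
  obtain ⟨hx1, hx2⟩ := hx
  have hb : pairing (m - m₀) x < 0 := by
    have := mul_nonneg hτ.le (hw m hm)
    rw [tilt] at hneg
    linarith
  -- On the segment from the origin to `x`, consider the first point at which some decreasing
  -- inequality becomes an equality. The zero set there is a cell through `m₀`, `m₁` and a further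
  -- vertex `m'`, so `m'` lies in the link; but its inequality fails beyond that point, in
  -- particular at `x`.
  obtain ⟨t, ht0, ht, m', hm', hb', hz⟩ := exists_hitting_time Δ (fun m => τ * w m)
    (fun m => pairing (m - m₀) x) (fun m hm => mul_nonneg hτ.le (hw m hm)) ⟨m, hm, hb⟩
  have ht1 : t < 1 := by
    by_contra! h
    have h1 := ht m hm
    rw [tilt] at hneg
    nlinarith
  have htilt : ∀ m, tilt w m₀ τ (t • x) m = τ * w m + t * pairing (m - m₀) x := fun m => by
    rw [tilt, pairing_smul]
  have hcell := isCell_tiltZeros hτ hm₀ hw₀ (x := t • x) fun m hm => by rw [htilt]; exact ht m hm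
  have h0 : m₀ ∈ tiltZeros Δ w m₀ τ (t • x) :=
    mem_tiltZeros.2 ⟨hm₀, by rw [htilt, hw₀, pairing_self_sub]; ring⟩
  have h1 : m₁ ∈ tiltZeros Δ w m₀ τ (t • x) :=
    mem_tiltZeros.2 ⟨hm₁, by rw [htilt, hw₁, hx1]; ring⟩
  have h2 : m' ∈ tiltZeros Δ w m₀ τ (t • x) := mem_tiltZeros.2 ⟨hm', by rw [htilt]; exact hz⟩
  have h3 := hx2 m' ⟨_, hcell, h0, h1, h2, by
    rintro rfl; rw [pairing_self_sub] at hb'; exact lt_irrefl _ hb', by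
    rintro rfl; rw [hx1] at hb'; exact lt_irrefl _ hb'⟩
  nlinarith

/-- `m - m₀` is not in the span of the differences `a - m₀`, `a ∈ A`. -/
def OffSpan (m₀ : Fin l → ℤ) (A : Finset (Fin l → ℤ)) (m : Fin l → ℤ) : Prop :=
  ∃ d : Fin l → ℝ, (∀ a ∈ A, pairing (a - m₀) d = 0) ∧ pairing (m - m₀) d ≠ 0

lemma OffSpan.mono {A A' : Finset (Fin l → ℤ)} (h : A ⊆ A') {m : Fin l → ℤ}
    (hm : OffSpan m₀ A' m) : OffSpan m₀ A m := by
  obtain ⟨d, h1, h2⟩ := hm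
  exact ⟨d, fun a ha => h1 a (h ha), h2⟩

/-- There are only finitely many pairs `(A, m)`, so one normalized direction can be fixed for each.
The bound involves neither `τ` nor a point of the polyhedron. -/
lemma exists_direction_bound (Δ : Finset (Fin l → ℤ)) (m₀ : Fin l → ℤ) :
    ∃ D : ℝ, 0 ≤ D ∧ ∀ A ⊆ Δ, ∀ m ∈ Δ, OffSpan m₀ A m → ∃ d : Fin l → ℝ,
      (∀ a ∈ A, pairing (a - m₀) d = 0) ∧ pairing (m - m₀) d = -1 ∧
      ∀ m' ∈ Δ, |pairing (m' - m₀) d| ≤ D := by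
  have h : ∀ A m, ∃ d : Fin l → ℝ, OffSpan m₀ A m →
      (∀ a ∈ A, pairing (a - m₀) d = 0) ∧ pairing (m - m₀) d = -1 := by
    intro A m
    by_cases hm : OffSpan m₀ A m
    · obtain ⟨d, h1, h2⟩ := hm
      refine ⟨(-(pairing (m - m₀) d)⁻¹) • d, fun _ => ⟨fun a ha => ?_, ?_⟩⟩
      · rw [pairing_smul, h1 a ha, mul_zero]
      · rw [pairing_smul]; field_simp
    · exact ⟨0, fun h => absurd h hm⟩
  choose d hd using h
  refine ⟨∑ A ∈ Δ.powerset, ∑ m ∈ Δ, ∑ m' ∈ Δ, |pairing (m' - m₀) (d A m)|,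
    Finset.sum_nonneg fun _ _ => Finset.sum_nonneg fun _ _ => Finset.sum_nonneg fun _ _ =>
      abs_nonneg _, fun A hA m hm hoff => ⟨d A m, (hd A m hoff).1, (hd A m hoff).2, ?_⟩⟩
  intro m' hm'
  calc |pairing (m' - m₀) (d A m)| ≤ ∑ m' ∈ Δ, |pairing (m' - m₀) (d A m)| :=
        Finset.single_le_sum (f := fun m' => |pairing (m' - m₀) (d A m)|)
          (fun _ _ => abs_nonneg _) hm'
    _ ≤ ∑ m ∈ Δ, ∑ m' ∈ Δ, |pairing (m' - m₀) (d A m)| :=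
        Finset.single_le_sum (f := fun m => ∑ m' ∈ Δ, |pairing (m' - m₀) (d A m)|)
          (fun _ _ => Finset.sum_nonneg fun _ _ => abs_nonneg _) hm
    _ ≤ _ := Finset.single_le_sum
        (f := fun A => ∑ m ∈ Δ, ∑ m' ∈ Δ, |pairing (m' - m₀) (d A m)|)
        (fun _ _ => Finset.sum_nonneg fun _ _ => Finset.sum_nonneg fun _ _ => abs_nonneg _)
        (Finset.mem_powerset.2 hA)

/-- The zero set at `y` is a cell adapted to the size of the function `tilt` at `x`. -/
structure IsAdapted (Δ : Finset (Fin l → ℤ)) (w : (Fin l → ℤ) → ℝ) (m₀ m₁ : Fin l → ℤ) (τ : ℝ)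
    (x : Fin l → ℝ) (C : ℝ) (y : Fin l → ℝ) : Prop where
  nonneg : ∀ m ∈ Δ, 0 ≤ tilt w m₀ τ y m
  mem : m₁ ∈ tiltZeros Δ w m₀ τ y
  close : ∀ m ∈ Δ, ∀ m' ∈ Δ, OffSpan m₀ (tiltZeros Δ w m₀ τ y) m' →
    |tilt w m₀ τ y m - tilt w m₀ τ x m| ≤ C * tilt w m₀ τ x m'
  small : ∀ m' ∈ tiltZeros Δ w m₀ τ y, m' ≠ m₀ → m' ≠ m₁ → ∀ m ∈ Δ,
    OffSpan m₀ ((tiltZeros Δ w m₀ τ y).erase m') m → tilt w m₀ τ x m' ≤ C * tilt w m₀ τ x m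

/-- Move `y` in a direction that fixes the current zeros and decreases the smallest value off their
span, until a new zero appears. The distance moved is controlled by that smallest value, hence by
every off-span value at `x`. A newly created zero `m'` therefore has a value at `x` bounded by
these, which is the exchange inequality. -/
lemma IsAdapted.grow {τ : ℝ} {D : ℝ} (hD : 0 ≤ D) (hDb : ∀ A ⊆ Δ, ∀ m ∈ Δ, OffSpan m₀ A m → ∃ d : Fin l → ℝ,
      (∀ a ∈ A, pairing (a - m₀) d = 0) ∧ pairing (m - m₀) d = -1 ∧
      ∀ m' ∈ Δ, |pairing (m' - m₀) d| ≤ D)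
    {x y : Fin l → ℝ} {C : ℝ} (hC : 0 ≤ C) (hx : ∀ m ∈ Δ, 0 ≤ tilt w m₀ τ x m)
    (h : IsAdapted Δ w m₀ m₁ τ x C y)
    (hoff : ∃ m ∈ Δ, OffSpan m₀ (tiltZeros Δ w m₀ τ y) m) :
    ∃ y', IsAdapted Δ w m₀ m₁ τ x (C + D * (1 + C)) y' ∧
      tiltZeros Δ w m₀ τ y ⊂ tiltZeros Δ w m₀ τ y' := by
  classical
  set A := tiltZeros Δ w m₀ τ y with hA
  have hAΔ : A ⊆ Δ := fun m hm => (mem_tiltZeros.1 hm).1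
  obtain ⟨m₂, hm₂, hmin⟩ := (Δ.filter fun m => OffSpan m₀ A m).exists_min_image
    (fun m => tilt w m₀ τ y m) (by
      obtain ⟨m, hm, hmo⟩ := hoff
      exact ⟨m, Finset.mem_filter.2 ⟨hm, hmo⟩⟩)
  obtain ⟨hm₂Δ, hm₂o⟩ := Finset.mem_filter.1 hm₂
  obtain ⟨d, hdA, hd2, hdD⟩ := hDb A hAΔ m₂ hm₂Δ hm₂o
  obtain ⟨s, hs0, hs, m₃, hm₃, hb₃, hz₃⟩ := exists_hitting_time Δ (fun m => tilt w m₀ τ y m)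
    (fun m => pairing (m - m₀) d) h.nonneg ⟨m₂, hm₂Δ, by rw [hd2]; norm_num⟩
  have htilt : ∀ m, tilt w m₀ τ (y + s • d) m = tilt w m₀ τ y m + s * pairing (m - m₀) d := by
    intro m
    simp only [tilt, pairing_add, pairing_smul]
    ring
  have hsle : s ≤ tilt w m₀ τ y m₂ := by
    have := hs m₂ hm₂Δ
    rw [hd2] at this
    linarith
  set A' := tiltZeros Δ w m₀ τ (y + s • d) with hA'
  have hAA' : A ⊆ A' := fun m hm => mem_tiltZeros.2 ⟨hAΔ hm, by
    rw [htilt, hdA m hm, (mem_tiltZeros.1 hm).2]; ring⟩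
  have hm₃A' : m₃ ∈ A' := mem_tiltZeros.2 ⟨hm₃, by rw [htilt]; exact hz₃⟩
  have hm₃A : m₃ ∉ A := fun hm => by rw [hdA m₃ hm] at hb₃; exact lt_irrefl _ hb₃
  have hnew : ∀ m ∈ A', m ∉ A → OffSpan m₀ A m := by
    intro m hm hmA
    refine ⟨d, hdA, fun h0 => hmA ?_⟩
    have := (mem_tiltZeros.1 hm).2
    rw [htilt, h0, mul_zero, add_zero] at this
    exact mem_tiltZeros.2 ⟨(mem_tiltZeros.1 hm).1, this⟩
  have hclose : ∀ m ∈ Δ, ∀ m' ∈ Δ, OffSpan m₀ A m' →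
      |tilt w m₀ τ (y + s • d) m - tilt w m₀ τ x m| ≤ (C + D * (1 + C)) * tilt w m₀ τ x m' := by
    intro m hm m' hm' ho
    have h1 := h.close m hm m' hm' ho
    have h2 := h.close m' hm' m' hm' ho
    have h3 := hmin m' (Finset.mem_filter.2 ⟨hm', ho⟩)
    have h4 : s ≤ (1 + C) * tilt w m₀ τ x m' := by
      have := (abs_le.1 h2).2
      linarith
    have h5 : |s * pairing (m - m₀) d| ≤ s * D := by
      rw [abs_mul, abs_of_nonneg hs0]
      exact mul_le_mul_of_nonneg_left (hdD m hm) hs0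
    have h6 : s * D ≤ (1 + C) * tilt w m₀ τ x m' * D := mul_le_mul_of_nonneg_right h4 hD
    have h7 : tilt w m₀ τ (y + s • d) m - tilt w m₀ τ x m
        = (tilt w m₀ τ y m - tilt w m₀ τ x m) + s * pairing (m - m₀) d := by rw [htilt]; ring
    rw [h7]
    have h8 := abs_add_le (tilt w m₀ τ y m - tilt w m₀ τ x m) (s * pairing (m - m₀) d)
    nlinarith
  refine ⟨y + s • d, ⟨fun m hm => ?_, hAA' h.mem, fun m hm m' hm' ho => ?_, ?_⟩,
    Finset.ssubset_iff_subset_ne.2 ⟨hAA', fun heq => hm₃A (heq ▸ hm₃A')⟩⟩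
  · rw [htilt]; exact hs m hm
  · exact hclose m hm m' hm' (ho.mono hAA')
  · intro m' hm' hne₀ hne₁ m hm ho
    by_cases hmem : m' ∈ A
    · have h1 := h.small m' hmem hne₀ hne₁ m hm (ho.mono (Finset.erase_subset_erase _ hAA'))
      have h2 := hx m hm
      have h3 : 0 ≤ D * (1 + C) * tilt w m₀ τ x m := by positivity
      linarith
    -- For a new zero `m'` all old zeros survive the erasure, so `m` is off the span of `A` and
    -- `hclose` applies with value `0` at `m'`.
    · have hsub : A ⊆ A'.erase m' := fun a ha =>
        Finset.mem_erase.2 ⟨ne_of_mem_of_not_mem ha hmem, hAA' ha⟩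
      have h1 := hclose m' (mem_tiltZeros.1 hm').1 m hm (ho.mono hsub)
      rw [(mem_tiltZeros.1 hm').2, zero_sub, abs_neg] at h1
      exact (le_abs_self _).trans h1

/-- Start at `y = x`, where no zeros other than `m₀`, `m₁` exist, and apply `IsAdapted.grow` up to
`n` times. The constant is chosen before `w`, `τ` and `x`, which is the source of the uniformity in
`t`. -/
lemma exists_isAdapted (Δ : Finset (Fin l → ℤ)) (m₀ m₁ : Fin l → ℤ) (hm₁ : m₁ ∈ Δ)
    (n : ℕ) :
    ∃ C : ℝ, 0 ≤ C ∧ ∀ (w : (Fin l → ℤ) → ℝ) (τ : ℝ) (x : Fin l → ℝ), w m₀ = 0 → w m₁ = 0 →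
      pairing (m₁ - m₀) x = 0 →
      (∀ m ∈ Δ, m ≠ m₀ → m ≠ m₁ → 0 < tilt w m₀ τ x m) →
      ∃ y, IsAdapted Δ w m₀ m₁ τ x C y ∧ (n ≤ (tiltZeros Δ w m₀ τ y).card ∨
        ∀ m ∈ Δ, ¬ OffSpan m₀ (tiltZeros Δ w m₀ τ y) m) := by
  obtain ⟨D, hD, hDb⟩ := exists_direction_bound Δ m₀
  have hnn : ∀ (w : (Fin l → ℤ) → ℝ) (τ : ℝ) (x : Fin l → ℝ), w m₀ = 0 → w m₁ = 0 →
      pairing (m₁ - m₀) x = 0 → (∀ m ∈ Δ, m ≠ m₀ → m ≠ m₁ → 0 < tilt w m₀ τ x m) →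
      ∀ m ∈ Δ, 0 ≤ tilt w m₀ τ x m := by
    intro w τ x hw₀ hw₁ hx hpos m hm
    by_cases h0 : m = m₀
    · rw [h0, tilt, hw₀, pairing_self_sub]; simp
    by_cases h1 : m = m₁
    · rw [h1, tilt, hw₁, hx]; simp
    exact (hpos m hm h0 h1).le
  induction n with
  | zero =>
    refine ⟨0, le_rfl, fun w τ x hw₀ hw₁ hx hpos => ⟨x, ⟨hnn w τ x hw₀ hw₁ hx hpos, ?_, ?_, ?_⟩,
      Or.inl (Nat.zero_le _)⟩⟩
    · exact mem_tiltZeros.2 ⟨hm₁, by rw [tilt, hw₁, hx]; simp⟩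
    · intro m _ m' _ _
      simp
    · intro m' hm' h0 h1
      obtain ⟨h2, h3⟩ := mem_tiltZeros.1 hm'
      exact absurd h3 (hpos m' h2 h0 h1).ne'
  | succ n ih =>
    obtain ⟨C, hC, hCb⟩ := ih
    refine ⟨C + D * (1 + C), by positivity, fun w τ x hw₀ hw₁ hx hpos => ?_⟩
    have hx0 := hnn w τ x hw₀ hw₁ hx hpos
    obtain ⟨y, hy, hcard⟩ := hCb w τ x hw₀ hw₁ hx hpos
    by_cases hoff : ∃ m ∈ Δ, OffSpan m₀ (tiltZeros Δ w m₀ τ y) m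
    · obtain ⟨y', hy', hlt⟩ := hy.grow hD hDb hC hx0 hoff
      refine ⟨y', hy', Or.inl ?_⟩
      rcases hcard with h | h
      · exact lt_of_le_of_lt h (Finset.card_lt_card hlt)
      · obtain ⟨m, hm, hmo⟩ := hoff
        exact absurd hmo (h m hm)
    · push Not at hoff
      have hle : ∀ m ∈ Δ, C * tilt w m₀ τ x m ≤ (C + D * (1 + C)) * tilt w m₀ τ x m :=
        fun m hm => mul_le_mul_of_nonneg_right (le_add_of_nonneg_right (by positivity)) (hx0 m hm)
      exact ⟨y, ⟨hy.nonneg, hy.mem, fun m hm m' hm' ho => (hy.close m hm m' hm' ho).trans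
        (hle m' hm'), fun m' hm' h0 h1 m hm ho => (hy.small m' hm' h0 h1 m hm ho).trans
        (hle m hm)⟩, Or.inr hoff⟩

/-- There is a top dimensional simplex with the vertex `m'` of which a lattice point `m` can only
be exchanged if the value at `m` dominates the value at `m'`. -/
lemma exists_minimal_topCell (hΔ : IsIntegralPolytope Δ) (hsimp : IsSimplicial Δ w)
    (hm₀ : m₀ ∈ Δ) (hm₁ : m₁ ∈ Δ) (hw₀ : w m₀ = 0) (hw₁ : w m₁ = 0) :
    ∃ C : ℝ, 0 ≤ C ∧ ∀ (τ : ℝ) (x : Fin l → ℝ), 0 < τ → pairing (m₁ - m₀) x = 0 →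
      (∀ m ∈ Δ, m ≠ m₀ → m ≠ m₁ → 0 < tilt w m₀ τ x m) →
      ∃ S ∈ topCells Δ w, m₀ ∈ S ∧ m₁ ∈ S ∧ ∀ m' ∈ S, m' ≠ m₀ → m' ≠ m₁ → ∀ m ∈ Δ,
        OffSpan m₀ (S.erase m') m → tilt w m₀ τ x m' ≤ C * tilt w m₀ τ x m := by
  classical
  -- An affinely independent set has at most `l + 1` points, so cardinality `l + 2` is impossible
  -- and the process must stop because no lattice point is off the span.
  obtain ⟨C, hC, hCb⟩ := exists_isAdapted Δ m₀ m₁ hm₁ (l + 2)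
  refine ⟨C, hC, fun τ x hτ hx hpos => ?_⟩
  obtain ⟨y, hy, hcard⟩ := hCb w τ x hw₀ hw₁ hx hpos
  have hcell := isCell_tiltZeros hτ hm₀ hw₀ hy.nonneg
  have h0 : m₀ ∈ tiltZeros Δ w m₀ τ y :=
    mem_tiltZeros.2 ⟨hm₀, by rw [tilt, hw₀, pairing_self_sub]; ring⟩
  have hle : (tiltZeros Δ w m₀ τ y).card ≤ l + 1 := by
    have h1 := (hsimp _ hcell).card_le_finrank_succ
    have h2 := Submodule.finrank_le (vectorSpan ℝ (Set.range fun m : tiltZeros Δ w m₀ τ y =>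
      toReal (m : Fin l → ℤ)))
    simp only [Fintype.card_coe, Module.finrank_fin_fun] at h1 h2
    omega
  have hfull : ∀ m ∈ Δ, ¬ OffSpan m₀ (tiltZeros Δ w m₀ τ y) m := by
    rcases hcard with h | h
    · omega
    · exact h
  -- The zeros span all differences of lattice points, and these span the whole space because the
  -- polytope is full dimensional.
  have hge : l + 1 ≤ (tiltZeros Δ w m₀ τ y).card := by
    let Φ : (Fin l → ℝ) →ₗ[ℝ] ((tiltZeros Δ w m₀ τ y).erase m₀ → ℝ) :=
      { toFun := fun d a => pairing ((a : Fin l → ℤ) - m₀) d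
        map_add' := fun u v => by funext a; exact pairing_add _ _ _
        map_smul' := fun c v => by funext a; exact pairing_smul _ _ _ }
    have hinj : Function.Injective Φ := by
      rw [← LinearMap.ker_eq_bot, LinearMap.ker_eq_bot']
      intro d hd
      refine eq_zero_of_pairing_polytope hΔ hm₀ fun m hm => ?_
      by_contra hne
      refine hfull m hm ⟨d, fun a ha => ?_, hne⟩
      by_cases h : a = m₀
      · rw [h, pairing_self_sub]
      · exact congrFun hd ⟨a, Finset.mem_erase.2 ⟨h, ha⟩⟩
    have h1 := LinearMap.finrank_le_finrank_of_injective hinj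
    simp only [Module.finrank_fintype_fun_eq_card, Fintype.card_coe, Fintype.card_fin,
      Finset.card_erase_of_mem h0] at h1
    have : 0 < (tiltZeros Δ w m₀ τ y).card := Finset.card_pos.2 ⟨m₀, h0⟩
    omega
  exact ⟨_, mem_topCells.2 ⟨hcell, le_antisymm hle hge⟩, h0, hy.mem, hy.small⟩

open Classical in
/-- The product of the values over a simplex as in `exists_minimal_topCell` is minimal up to a
constant. -/
lemma prod_le_prod_of_exchange (hsimp : IsSimplicial Δ w) {S S' : Finset (Fin l → ℤ)}
    (hS : S ∈ topCells Δ w) (hS' : S' ∈ topCells Δ w) (hm₀ : m₀ ∈ S) (hm₁ : m₁ ∈ S)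
    {C : ℝ} (hC : 1 ≤ C) {f : (Fin l → ℤ) → ℝ} (hf : ∀ m ∈ Δ, m ≠ m₀ → m ≠ m₁ → 1 ≤ f m)
    (hex : ∀ m' ∈ S, m' ≠ m₀ → m' ≠ m₁ → ∀ m ∈ Δ, OffSpan m₀ (S.erase m') m → f m' ≤ C * f m) :
    ∏ m ∈ S \ {m₀, m₁}, f m ≤ C ^ (l + 1) * ∏ m ∈ S' \ {m₀, m₁}, f m := by
  obtain ⟨e, he⟩ := exists_dualBasis hsimp hS hm₀
  obtain ⟨hcell, hcard⟩ := mem_topCells.1 hS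
  obtain ⟨hcell', hcard'⟩ := mem_topCells.1 hS'
  let E : S ≃ S' := Finset.equivOfCardEq (hcard.trans hcard'.symm)
  -- The rows are the vertices of `S'` in affine coordinates attached to `S`, with the column of
  -- `m₀` replaced by ones. The matrix is nonsingular because `S'` is a top simplex.
  let M : Matrix S S ℝ := fun a m =>
    if (m : Fin l → ℤ) = m₀ then 1 else pairing ((E a : Fin l → ℤ) - m₀) (e m)
  have hdet : M.det ≠ 0 := by
    intro h0
    obtain ⟨x, hx0, hx⟩ := Matrix.exists_mulVec_eq_zero_iff.2 h0
    set d : Fin l → ℝ := ∑ m : S, (if (m : Fin l → ℤ) = m₀ then 0 else x m) • e m with hd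
    have h1 : ∀ b ∈ S', x ⟨m₀, hm₀⟩ + pairing (b - m₀) d = 0 := by
      intro b hb
      have h2 := congrFun hx (E.symm ⟨b, hb⟩)
      simp only [Matrix.mulVec, dotProduct, Pi.zero_apply, M, Equiv.apply_symm_apply] at h2
      rw [← h2, hd, pairing_sum]
      have h3 : x ⟨m₀, hm₀⟩ = ∑ m : S, if (m : Fin l → ℤ) = m₀ then x m else 0 := by
        rw [Finset.sum_eq_single ⟨m₀, hm₀⟩]
        · simp
        · intro m _ hm
          have : (m : Fin l → ℤ) ≠ m₀ := fun h => hm (Subtype.ext h)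
          simp [this]
        · simp
      rw [h3, ← Finset.sum_add_distrib]
      refine Finset.sum_congr rfl fun m _ => ?_
      by_cases h : (m : Fin l → ℤ) = m₀
      · simp [h, pairing_zero]
      · simp only [h, if_false, pairing_smul]
        ring
    obtain ⟨b₀, hb₀⟩ := hcell'.1
    have hd0 : d = 0 := eq_zero_of_pairing_topCell hsimp hS' hb₀ fun b hb => by
      have e1 := h1 b hb
      have e2 := h1 b₀ hb₀
      simp only [pairing_sub_left] at e1 e2 ⊢
      linarith
    have hx0' : x ⟨m₀, hm₀⟩ = 0 := by
      have := h1 b₀ hb₀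
      rwa [hd0, pairing_zero, add_zero] at this
    refine hx0 (funext fun m => ?_)
    by_cases h : (m : Fin l → ℤ) = m₀
    · have : m = ⟨m₀, hm₀⟩ := Subtype.ext h
      rw [this, hx0']; rfl
    · have h4 : pairing ((m : Fin l → ℤ) - m₀) d = x m := by
        rw [hd, pairing_sum, Finset.sum_eq_single m]
        · simp [h, pairing_smul, (he m m.2 h).1]
        · intro m' _ hne
          have hne' : (m : Fin l → ℤ) ≠ m' := fun h => hne (Subtype.ext h.symm)
          by_cases h' : (m' : Fin l → ℤ) = m₀
          · simp [h', pairing_zero]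
          · rw [pairing_smul, (he m' m'.2 h').2 m m.2 hne', mul_zero]
        · simp
      rw [← h4, hd0, pairing_zero]; rfl
  -- A nonzero determinant has a nonzero term in its expansion. It matches each `m ∈ S` other than
  -- `m₀`, `m₁` with a vertex of `S'` off the span of `S \ {m}`, for which the exchange inequality
  -- is available.
  obtain ⟨π, hπ⟩ : ∃ π : Equiv.Perm S, ∀ m, M (π m) m ≠ 0 := by
    by_contra! hcon
    refine hdet ?_
    rw [Matrix.det_apply]
    refine Finset.sum_eq_zero fun π _ => ?_
    obtain ⟨m, hm⟩ := hcon π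
    have h0 : ∏ i, M (π i) i = 0 := Finset.prod_eq_zero (Finset.mem_univ m) hm
    exact (congrArg (fun c => Equiv.Perm.sign π • c) h0).trans (smul_zero _)
  have hmem : ∀ m ∈ S \ {m₀, m₁}, m ∈ S ∧ m ≠ m₀ ∧ m ≠ m₁ := by
    intro m hm
    simpa using hm
  let s : (Fin l → ℤ) → Fin l → ℤ := fun m => if h : m ∈ S then (E (π ⟨m, h⟩) : Fin l → ℤ) else m
  have hs : ∀ m (h : m ∈ S), s m = E (π ⟨m, h⟩) := fun m h => by simp [s, h]
  have hpair : ∀ m ∈ S \ {m₀, m₁}, pairing (s m - m₀) (e m) ≠ 0 := by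
    intro m hm
    obtain ⟨h1, h2, h3⟩ := hmem m hm
    have := hπ ⟨m, h1⟩
    simpa [M, h2, hs m h1] using this
  have hs' : ∀ m ∈ S \ {m₀, m₁}, s m ∈ S' \ {m₀, m₁} := by
    intro m hm
    obtain ⟨h1, h2, h3⟩ := hmem m hm
    have h4 := hpair m hm
    have h5 : s m ∈ S' := by rw [hs m h1]; exact (E _).2
    have h6 : s m ≠ m₀ := fun h => h4 (by rw [h, pairing_self_sub])
    have h7 : s m ≠ m₁ := fun h => h4 (by rw [h]; exact (he m h1 h2).2 m₁ hm₁ h3.symm)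
    simp [h5, h6, h7]
  have hinj : Set.InjOn s (S \ {m₀, m₁} : Finset (Fin l → ℤ)) := by
    intro a ha b hb hab
    have h1 := (hmem a ha).1
    have h2 := (hmem b hb).1
    rw [hs a h1, hs b h2] at hab
    have h3 := π.injective (E.injective (Subtype.ext hab))
    exact congrArg Subtype.val h3
  have hf1 : ∀ m ∈ S' \ {m₀, m₁}, 1 ≤ f m := by
    intro m hm
    simp only [Finset.mem_sdiff, Finset.mem_insert, Finset.mem_singleton, not_or] at hm
    exact hf m (hcell'.2.1 hm.1) hm.2.1 hm.2.2
  have hfS : ∀ m ∈ S \ {m₀, m₁}, 1 ≤ f m := by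
    intro m hm
    obtain ⟨h1, h2, h3⟩ := hmem m hm
    exact hf m (hcell.2.1 h1) h2 h3
  calc ∏ m ∈ S \ {m₀, m₁}, f m
      ≤ ∏ m ∈ S \ {m₀, m₁}, C * f (s m) := by
        refine Finset.prod_le_prod (fun m hm => zero_le_one.trans (hfS m hm)) fun m hm => ?_
        obtain ⟨h1, h2, h3⟩ := hmem m hm
        have h4 := Finset.mem_sdiff.1 (hs' m hm)
        refine hex m h1 h2 h3 (s m) (hcell'.2.1 h4.1) ⟨e m, fun a ha => ?_, hpair m hm⟩
        exact (he m h1 h2).2 a (Finset.mem_of_mem_erase ha) (Finset.ne_of_mem_erase ha)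
    _ = C ^ (S \ {m₀, m₁}).card * ∏ m ∈ (S \ {m₀, m₁}).image s, f m := by
        rw [Finset.prod_mul_distrib, Finset.prod_const, Finset.prod_image hinj]
    _ ≤ C ^ (l + 1) * ∏ m ∈ S' \ {m₀, m₁}, f m := by
        have h1 : (S \ {m₀, m₁}).card ≤ l + 1 := by
          rw [← hcard]; exact Finset.card_le_card Finset.sdiff_subset
        have h2 : (S \ {m₀, m₁}).image s ⊆ S' \ {m₀, m₁} := by
          intro b hb
          obtain ⟨m, hm, rfl⟩ := Finset.mem_image.1 hb
          exact hs' m hm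
        -- If `S'` misses `m₀` or `m₁`, its product has factors outside the image of `s`; these are
        -- at least `1`.
        refine mul_le_mul (pow_le_pow_right₀ hC h1) ?_ ?_ (by positivity)
        · exact Finset.prod_le_prod_of_subset_of_one_le h2
            (fun m hm => zero_le_one.trans (hf1 m (h2 hm))) (fun m hm _ => hf1 m hm)
        · exact Finset.prod_nonneg fun m hm => zero_le_one.trans (hf1 m (h2 hm))

end Growth

/-! ### Solution of the equation of `X_t` near the degeneracy point. -/

section ImplicitSolution

variable {ι : Type*} [Fintype ι]

/-- The equation of `X_t` in the coordinate `λ` with `s_{m₁} / s_{m₀} = -exp λ`. -/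
def localEquation (ε : ι → ℝ) (z : ι → ℂ) (s : ℂ) : ℂ :=
  1 - Complex.exp s + ∑ m, z m * Complex.exp (ε m * s)

/-- On the unit disc `|exp s - 1|` is at least `|s| / 4`, since the quadratic remainder is at most
`(3/4) |s|²`. Every solution in the disc is thus small with `z`, which upgrades the local uniqueness
of the inverse function theorem to uniqueness in the whole disc. -/
lemma norm_le_of_localEquation {ε : ι → ℝ} {z : ι → ℂ} {s : ℂ} (hs : ‖s‖ < 1)
    (h : localEquation ε z s = 0) : ‖s‖ ≤ 4 * (‖z‖ * ∑ m, Real.exp |ε m|) := by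
  have h1 : ‖Complex.exp s - 1 - s‖ ≤ ‖s‖ ^ 2 * (3 / 4) := by
    have := Complex.exp_bound hs.le (n := 2) (by norm_num)
    norm_num [Finset.sum_range_succ, Nat.factorial] at this
    rwa [← sub_sub] at this
  have h2 : Complex.exp s - 1 = ∑ m, z m * Complex.exp (ε m * s) := by
    rw [localEquation] at h
    linear_combination -h
  have h3 : ‖Complex.exp s - 1‖ ≤ ‖z‖ * ∑ m, Real.exp |ε m| := by
    rw [h2, Finset.mul_sum]
    refine norm_sum_le_of_le _ fun m _ => ?_
    rw [norm_mul, Complex.norm_exp]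
    refine mul_le_mul (norm_le_pi_norm z m) (Real.exp_le_exp.2 ?_) (Real.exp_nonneg _)
      (norm_nonneg _)
    rw [Complex.re_ofReal_mul]
    refine (le_abs_self _).trans ?_
    rw [abs_mul]
    exact mul_le_of_le_one_right (abs_nonneg _) ((Complex.abs_re_le_norm s).trans hs.le)
  have h4 : ‖s‖ ≤ ‖Complex.exp s - 1‖ + ‖Complex.exp s - 1 - s‖ := by
    have := norm_sub_le (Complex.exp s - 1) (Complex.exp s - 1 - s)
    simpa using this
  nlinarith [norm_nonneg s]

lemma exists_localSolution (ε : ι → ℝ) :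
    ∃ (δ : ℝ) (Λ : (ι → ℂ) → ℂ), 0 < δ ∧ Λ 0 = 0 ∧
      ∀ z ∈ Metric.ball (0 : ι → ℂ) δ, ContDiffAt ℂ ∞ Λ z ∧ ‖Λ z‖ < 1 ∧
        ∀ s : ℂ, ‖s‖ < 1 → (localEquation ε z s = 0 ↔ s = Λ z) := by
  let f : (ι → ℂ) × ℂ → (ι → ℂ) × ℂ := fun p => (p.1, localEquation ε p.1 p.2)
  -- Analyticity is used because, unlike smoothness of order `∞` at one point, it persists in a
  -- neighbourhood of the point.
  have hfs : ContDiff ℂ ω f := by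
    refine ContDiff.prodMk contDiff_fst ?_
    unfold localEquation
    refine ContDiff.add (ContDiff.sub contDiff_const (Complex.contDiff_exp.comp contDiff_snd))
      (ContDiff.sum fun m _ => ContDiff.mul (by fun_prop)
        (Complex.contDiff_exp.comp (contDiff_const.mul contDiff_snd)))
  let L : (ι → ℂ) × ℂ →L[ℂ] (ι → ℂ) × ℂ :=
    (ContinuousLinearMap.fst ℂ _ _).prod
      ((∑ m, (ContinuousLinearMap.proj m).comp (ContinuousLinearMap.fst ℂ (ι → ℂ) ℂ)) -
        ContinuousLinearMap.snd ℂ _ _)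
  have hL : ∀ p, L p = (p.1, ∑ m, p.1 m - p.2) := fun p => by
    simp [L]
  -- The derivative `(z, s) ↦ (z, ∑ z m - s)` is its own inverse.
  let e : ((ι → ℂ) × ℂ) ≃L[ℂ] (ι → ℂ) × ℂ :=
    ContinuousLinearEquiv.equivOfInverse L L (fun p => by simp [hL]) (fun p => by simp [hL])
  have hf0 : f 0 = 0 := by simp [f, localEquation]
  have hder : HasFDerivAt f (e : ((ι → ℂ) × ℂ) →L[ℂ] (ι → ℂ) × ℂ) 0 := by
    refine HasFDerivAt.prodMk hasFDerivAt_fst ?_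
    have e1 : HasFDerivAt (fun p : (ι → ℂ) × ℂ => Complex.exp p.2) _ 0 :=
      (hasFDerivAt_snd (𝕜 := ℂ) (p := (0 : (ι → ℂ) × ℂ))).cexp
    have e2 : ∀ m, HasFDerivAt (fun p : (ι → ℂ) × ℂ => p.1 m * Complex.exp (ε m * p.2)) _ 0 :=
      fun m => (((ContinuousLinearMap.proj (R := ℂ) (φ := fun _ : ι => ℂ) m).comp
        (ContinuousLinearMap.fst ℂ (ι → ℂ) ℂ)).hasFDerivAt (x := 0)).mul
        (((hasFDerivAt_snd (𝕜 := ℂ) (p := (0 : (ι → ℂ) × ℂ))).const_mul (ε m : ℂ)).cexp)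
    refine ((e1.const_sub 1).add (HasFDerivAt.fun_sum fun m _ => e2 m)).congr_fderiv ?_
    ext p
    · simp
    · simp
  have hfa : ContDiffAt ℂ ω f 0 := hfs.contDiffAt
  set g := hfa.localInverse hder (by simp) with hg
  have hga : ContDiffAt ℂ ω g 0 := by
    have := hfa.to_localInverse hder (by simp)
    rwa [hf0] at this
  have hleft : ∀ᶠ p in 𝓝 (0 : (ι → ℂ) × ℂ), g (f p) = p :=
    (hfa.hasStrictFDerivAt' hder (by simp)).eventually_left_inverse
  have hright : ∀ᶠ q in 𝓝 (0 : (ι → ℂ) × ℂ), f (g q) = q := by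
    have := (hfa.hasStrictFDerivAt' hder (by simp)).eventually_right_inverse
    rwa [hf0] at this
  have hg0 : g 0 = 0 := by
    have := hleft.self_of_nhds
    rwa [hf0] at this
  set Λ : (ι → ℂ) → ℂ := fun z => (g (z, 0)).2 with hΛ
  have hin : ContDiff ℂ ω (fun z : ι → ℂ => (z, (0 : ℂ))) := contDiff_id.prodMk contDiff_const
  have hΛa : ContDiffAt ℂ ω Λ 0 :=
    contDiffAt_snd.comp (0 : ι → ℂ) (ContDiffAt.comp (0 : ι → ℂ) (g := g) hga hin.contDiffAt)
  have hΛ0 : Λ 0 = 0 := by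
    have : g ((0 : ι → ℂ), (0 : ℂ)) = 0 := hg0
    simp [hΛ, this]
  have E1 : ∀ᶠ z in 𝓝 (0 : ι → ℂ), AnalyticAt ℂ Λ z := hΛa.analyticAt.eventually_analyticAt
  have E2 : ∀ᶠ z in 𝓝 (0 : ι → ℂ), ‖Λ z‖ < 1 := by
    refine hΛa.continuousAt.norm.eventually_lt_const ?_
    simp only [hΛ0, norm_zero]; exact one_pos
  have E3 : ∀ᶠ z in 𝓝 (0 : ι → ℂ), f (g (z, 0)) = (z, 0) :=
    (hin.continuous.tendsto (0 : ι → ℂ)).eventually hright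
  obtain ⟨η, hη, hηb⟩ := Metric.eventually_nhds_iff_ball.1 hleft
  set M := 4 * ∑ m, Real.exp |ε m| with hM
  have hM0 : 0 ≤ M := by positivity
  have E4 : ∀ᶠ z in 𝓝 (0 : ι → ℂ), ‖z‖ * M < η := by
    have : ContinuousAt (fun z : ι → ℂ => ‖z‖ * M) 0 := by fun_prop
    exact this.eventually_lt_const (by simpa using hη)
  have E5 : ∀ᶠ z in 𝓝 (0 : ι → ℂ), ‖z‖ < η :=
    continuousAt_id.norm.eventually_lt_const (by simpa using hη)
  obtain ⟨δ, hδ, hδb⟩ := Metric.eventually_nhds_iff_ball.1 (E1.and (E2.and (E3.and (E4.and E5))))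
  refine ⟨δ, Λ, hδ, hΛ0, fun z hz => ?_⟩
  obtain ⟨h1, h2, h3, h4, h5⟩ := hδb z hz
  have hfst : (g (z, 0)).1 = z := congrArg Prod.fst h3
  have hsnd : localEquation ε (g (z, 0)).1 (g (z, 0)).2 = 0 := congrArg Prod.snd h3
  refine ⟨h1.contDiffAt, h2, fun s hs => ⟨fun h => ?_, fun h => ?_⟩⟩
  · have hsn := norm_le_of_localEquation hs h
    have hmem : (z, s) ∈ Metric.ball (0 : (ι → ℂ) × ℂ) η := by
      rw [mem_ball_zero_iff, Prod.norm_def]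
      refine max_lt h5 (lt_of_le_of_lt hsn ?_)
      rw [hM] at h4
      linarith
    have h6 := hηb _ hmem
    have h7 : f (z, s) = (z, 0) := Prod.ext rfl h
    rw [h7] at h6
    simp [hΛ, h6]
  · rw [hfst] at hsnd
    rw [h]
    exact hsnd

end ImplicitSolution

/-! ### Normalized monomials under the torus action. -/

section Characters

variable {l : ℕ}

lemma torusExp_add (u v p : Fin l → ℂ) : torusExp (u + v) p = torusExp v (torusExp u p) := by
  funext i
  simp only [torusExp, Pi.add_apply, Complex.exp_add]
  ring

lemma monomial_torusExp (m : Fin l → ℤ) (v p : Fin l → ℂ) :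
    monomial m (torusExp v p) = Complex.exp (pairing m v) * monomial m p := by
  simp only [monomial, torusExp, pairing, Complex.exp_sum, ← Finset.prod_mul_distrib]
  exact Finset.prod_congr rfl fun i _ => by rw [mul_zpow, Complex.exp_int_mul]

lemma monomial_ne_zero (m : Fin l → ℤ) {p : Fin l → ℂ} (hp : ∀ i, p i ≠ 0) : monomial m p ≠ 0 :=
  Finset.prod_ne_zero_iff.2 fun i _ => zpow_ne_zero _ (hp i)

lemma torusExp_ne_zero (v : Fin l → ℂ) {p : Fin l → ℂ} (hp : ∀ i, p i ≠ 0) (i : Fin l) :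
    torusExp v p i ≠ 0 :=
  mul_ne_zero (Complex.exp_ne_zero _) (hp i)

/-- The value `t ^ (w m) s_m / s_{m₀}` of a normalized monomial. -/
def charVal (w : (Fin l → ℤ) → ℝ) (L : ℂ) (m₀ : Fin l → ℤ) (p : Fin l → ℂ) (m : Fin l → ℤ) : ℂ :=
  tpow L (w m) * (monomial m p / monomial m₀ p)

lemma charVal_torusExp (w : (Fin l → ℤ) → ℝ) (L : ℂ) (m₀ m : Fin l → ℤ) (v p : Fin l → ℂ) :
    charVal w L m₀ (torusExp v p) m = charVal w L m₀ p m * Complex.exp (pairing (m - m₀) v) := by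
  rw [charVal, charVal, monomial_torusExp, monomial_torusExp, pairing_sub_left, Complex.exp_sub]
  have := Complex.exp_ne_zero (pairing m₀ v)
  field_simp

lemma norm_monomial (m : Fin l → ℤ) {p : Fin l → ℂ} (hp : ∀ i, p i ≠ 0) :
    ‖monomial m p‖ = Real.exp (-pairing m (momentMap p)) := by
  simp only [monomial, norm_prod, norm_zpow, pairing, momentMap, ← Finset.sum_neg_distrib,
    Real.exp_sum]
  refine Finset.prod_congr rfl fun i _ => ?_
  rw [mul_neg, neg_neg, ← Real.rpow_intCast, Real.rpow_def_of_pos (norm_pos_iff.2 (hp i)), mul_comm]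

lemma norm_charVal (w : (Fin l → ℤ) → ℝ) (L : ℂ) (m₀ m : Fin l → ℤ) {p : Fin l → ℂ}
    (hp : ∀ i, p i ≠ 0) :
    ‖charVal w L m₀ p m‖ = Real.exp (-tilt w m₀ (-L.re) (momentMap p) m) := by
  rw [charVal, norm_mul, norm_div, norm_monomial m hp, norm_monomial m₀ hp, tpow, Complex.norm_exp,
    Complex.re_ofReal_mul, ← Real.exp_sub, ← Real.exp_add, tilt, pairing_sub_left]
  congr 1
  ring

lemma charVal_ne_zero (w : (Fin l → ℤ) → ℝ) (L : ℂ) (m₀ m : Fin l → ℤ) {p : Fin l → ℂ}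
    (hp : ∀ i, p i ≠ 0) : charVal w L m₀ p m ≠ 0 := by
  rw [← norm_pos_iff, norm_charVal w L m₀ m hp]
  exact Real.exp_pos _

lemma hatA_eq (w : (Fin l → ℤ) → ℝ) (L : ℂ) (m₀ m : Fin l → ℤ) {p : Fin l → ℂ}
    (hp : ∀ i, p i ≠ 0) : hatA w L m₀ m p = 2 * tilt w m₀ (-L.re) (momentMap p) m := by
  have : hatA w L m₀ m p = -Real.log (‖charVal w L m₀ p m‖ ^ 2) := rfl
  rw [this, norm_charVal w L m₀ m hp, Real.log_pow, Real.log_exp]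
  push_cast
  ring

lemma hatA_torusExp (w : (Fin l → ℤ) → ℝ) (L : ℂ) (m₀ m : Fin l → ℤ) (v : Fin l → ℂ)
    {p : Fin l → ℂ} (hp : ∀ i, p i ≠ 0) :
    hatA w L m₀ m (torusExp v p) = hatA w L m₀ m p - 2 * (pairing (m - m₀) v).re := by
  have h : ∀ p, hatA w L m₀ m p = -Real.log (‖charVal w L m₀ p m‖ ^ 2) := fun _ => rfl
  have h1 : ‖charVal w L m₀ p m‖ ≠ 0 := norm_ne_zero_iff.2 (charVal_ne_zero w L m₀ m hp)
  rw [h, h, charVal_torusExp, norm_mul, Complex.norm_exp, mul_pow,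
    Real.log_mul (pow_ne_zero 2 h1) (pow_ne_zero 2 (Real.exp_ne_zero _)), Real.log_pow (Real.exp _) 2,
    Real.log_exp]
  push_cast
  ring

lemma torusExp_mem_toricTorus {m₀ m₁ : Fin l → ℤ} {p v : Fin l → ℂ} (hp : p ∈ toricTorus m₀ m₁)
    (hv : pairing (m₁ - m₀) v = 0) : torusExp v p ∈ toricTorus m₀ m₁ := by
  refine ⟨torusExp_ne_zero v hp.1, ?_⟩
  rw [pairing_sub_left, sub_eq_zero] at hv
  rw [monomial_torusExp, monomial_torusExp, hp.2, hv]
  ring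

lemma charVal_base {w : (Fin l → ℤ) → ℝ} {m₀ : Fin l → ℤ} (hw₀ : w m₀ = 0) (L : ℂ)
    {p : Fin l → ℂ} (hp : ∀ i, p i ≠ 0) : charVal w L m₀ p m₀ = 1 := by
  simp [charVal, hw₀, tpow, div_self (monomial_ne_zero m₀ hp)]

lemma charVal_opposite {w : (Fin l → ℤ) → ℝ} {m₀ m₁ : Fin l → ℤ} (hw₁ : w m₁ = 0) (L : ℂ)
    {p : Fin l → ℂ} (hp : p ∈ toricTorus m₀ m₁) : charVal w L m₀ p m₁ = -1 := by
  simp [charVal, hw₁, tpow, hp.2, neg_div, div_self (monomial_ne_zero m₀ hp.1)]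

end Characters

/-! ### Identification of points of the toric model with points of `X_t`. -/

section Identification

variable {l : ℕ} {Δ : Finset (Fin l → ℤ)} {w : (Fin l → ℤ) → ℝ} {m₀ m₁ : Fin l → ℤ}

/-- The lattice points other than `m₀`, `m₁`. -/
abbrev Rest (Δ : Finset (Fin l → ℤ)) (m₀ m₁ : Fin l → ℤ) : Type := ↥(Δ \ {m₀, m₁})

lemma sum_eq_add_rest {M : Type*} [AddCommMonoid M] (hm₀ : m₀ ∈ Δ) (hm₁ : m₁ ∈ Δ) (hne : m₀ ≠ m₁)
    (F : (Fin l → ℤ) → M) :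
    ∑ m ∈ Δ, F m = F m₀ + F m₁ + ∑ m : Rest Δ m₀ m₁, F m := by
  have hsub : ({m₀, m₁} : Finset (Fin l → ℤ)) ⊆ Δ := by
    intro m hm
    rcases Finset.mem_insert.1 hm with rfl | h
    · exact hm₀
    · rwa [Finset.mem_singleton.1 h]
  rw [← Finset.sum_sdiff hsub, Finset.sum_pair hne, add_comm,
    Finset.sum_coe_sort (Δ \ {m₀, m₁}) F]

lemma Rest.prop_mem (m : Rest Δ m₀ m₁) : (m : Fin l → ℤ) ∈ Δ ∧ (m : Fin l → ℤ) ≠ m₀ ∧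
    (m : Fin l → ℤ) ≠ m₁ := by
  have := Finset.mem_sdiff.1 m.2
  simpa using this

/-- A vector as the one on which the points of `X_t` are moved along in the identification. -/
structure IsTransverse (m₀ m₁ : Fin l → ℤ) (S : Finset (Fin l → ℤ)) (e : Fin l → ℝ) : Prop where
  one : pairing (m₁ - m₀) e = 1
  zero : ∀ m ∈ S, m ≠ m₁ → pairing (m - m₀) e = 0

/-- The complexification of a real vector. -/
def toComplex (e : Fin l → ℝ) : Fin l → ℂ := fun i => (e i : ℂ)

lemma pairing_toComplex (m : Fin l → ℤ) (e : Fin l → ℝ) :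
    pairing m (toComplex e) = ((pairing m e : ℝ) : ℂ) := by
  simp [pairing, toComplex]

lemma charVal_along (w : (Fin l → ℤ) → ℝ) (L : ℂ) (m₀ m : Fin l → ℤ) (e : Fin l → ℝ) (s : ℂ)
    (p : Fin l → ℂ) : charVal w L m₀ (torusExp (s • toComplex e) p) m =
      charVal w L m₀ p m * Complex.exp (pairing (m - m₀) e * s) := by
  rw [charVal_torusExp, pairing_smul, pairing_toComplex, mul_comm s]

/-- Divide the equation of `X_t` by `s_{m₀}`. The terms of `m₀` and `m₁` become `1` and `-exp s`,
and the others are the normalized monomials at `p` times exponentials of `s`. -/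
lemma mem_hypersurface_along_iff (hm₀ : m₀ ∈ Δ) (hm₁ : m₁ ∈ Δ) (hne : m₀ ≠ m₁) (hw₀ : w m₀ = 0)
    (hw₁ : w m₁ = 0) {S : Finset (Fin l → ℤ)} {e : Fin l → ℝ} (he : IsTransverse m₀ m₁ S e)
    (L : ℂ) {p : Fin l → ℂ} (hp : p ∈ toricTorus m₀ m₁) (s : ℂ) :
    torusExp (s • toComplex e) p ∈ hypersurface Δ w L ↔
      localEquation (fun m : Rest Δ m₀ m₁ => pairing ((m : Fin l → ℤ) - m₀) e)
        (fun m => charVal w L m₀ p m) s = 0 := by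
  set x := torusExp (s • toComplex e) p with hx
  have hx0 : ∀ i, x i ≠ 0 := torusExp_ne_zero _ hp.1
  have hmon := monomial_ne_zero m₀ hx0
  have h1 : ∑ m ∈ Δ, tpow L (w m) * monomial m x
      = monomial m₀ x * ∑ m ∈ Δ, charVal w L m₀ x m := by
    rw [Finset.mul_sum]
    refine Finset.sum_congr rfl fun m _ => ?_
    rw [charVal]
    field_simp
  have h2 : ∑ m ∈ Δ, charVal w L m₀ x m =
      localEquation (fun m : Rest Δ m₀ m₁ => pairing ((m : Fin l → ℤ) - m₀) e)
        (fun m => charVal w L m₀ p m) s := by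
    rw [sum_eq_add_rest hm₀ hm₁ hne, localEquation]
    simp only [hx, charVal_along]
    rw [charVal_base hw₀ L hp.1, charVal_opposite hw₁ L hp, pairing_self_sub, he.one]
    simp
    ring
  simp only [hypersurface, Set.mem_ofPred_eq]
  rw [h1, h2]
  simp [hx0, hmon]

/-- A displacement `u` that fixes the coordinates of `S` other than that of `m₁` is a multiple of
`e`, because the vertices of `S` separate vectors. Only the scalar `s = ⟨m₁ - m₀, u⟩` remains to be
found. -/
lemma isIdentified_iff (hsimp : IsSimplicial Δ w) (hm₀ : m₀ ∈ Δ) (hm₁ : m₁ ∈ Δ) (hne : m₀ ≠ m₁)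
    (hw₀ : w m₀ = 0) (hw₁ : w m₁ = 0) {S : Finset (Fin l → ℤ)} (hS : S ∈ topCells Δ w)
    (hm₀S : m₀ ∈ S) {e : Fin l → ℝ} (he : IsTransverse m₀ m₁ S e) {L : ℂ}
    {p : Fin l → ℂ} (hp : p ∈ toricTorus m₀ m₁) {s₀ : ℂ} (hs₀ : ‖s₀‖ < 1)
    (hsol : ∀ s : ℂ, ‖s‖ < 1 →
      (localEquation (fun m : Rest Δ m₀ m₁ => pairing ((m : Fin l → ℤ) - m₀) e)
        (fun m => charVal w L m₀ p m) s = 0 ↔ s = s₀)) (x : Fin l → ℂ) :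
    IsIdentified Δ w L m₀ m₁ S p x ↔ x = torusExp (s₀ • toComplex e) p := by
  constructor
  · rintro ⟨hx, u, hxu, hu0, hu1⟩
    set s := pairing (m₁ - m₀) u
    have hu : u = s • toComplex e := by
      rw [← sub_eq_zero]
      refine eq_zero_of_pairing_topCell_complex hsimp hS hm₀S fun m hm => ?_
      have hlin : pairing (m - m₀) (u - s • toComplex e)
          = pairing (m - m₀) u - s * (pairing (m - m₀) e : ℝ) := by
        rw [pairing_sub_right, pairing_smul, pairing_toComplex]
      rw [hlin]
      by_cases h : m = m₁
      · rw [h, he.one]; simp [s]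
      · rw [he.zero m hm h, hu0 m hm h]; simp
    rw [hxu, hu] at hx ⊢
    rw [mem_hypersurface_along_iff hm₀ hm₁ hne hw₀ hw₁ he L hp, hsol s hu1] at hx
    rw [hx]
  · rintro rfl
    refine ⟨?_, s₀ • toComplex e, rfl, fun m hm h => ?_, ?_⟩
    · rw [mem_hypersurface_along_iff hm₀ hm₁ hne hw₀ hw₁ he L hp, hsol s₀ hs₀]
    · rw [pairing_smul, pairing_toComplex, he.zero m hm h]; simp
    · rw [pairing_smul, pairing_toComplex, he.one]; simpa using hs₀

end Identification

/-! ### The two potentials in terms of the normalized monomials. -/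

section Potentials

variable {l : ℕ} {Δ : Finset (Fin l → ℤ)} {w : (Fin l → ℤ) → ℝ} {m₀ m₁ : Fin l → ℤ}

/-- The vertices of `S` other than `m₀`, `m₁`. -/
def subCell (Δ : Finset (Fin l → ℤ)) (m₀ m₁ : Fin l → ℤ) (S : Finset (Fin l → ℤ)) :
    Finset (Rest Δ m₀ m₁) :=
  Finset.univ.filter fun m => (m : Fin l → ℤ) ∈ S

open Classical in
lemma prod_subCell {S : Finset (Fin l → ℤ)} (hS : S ⊆ Δ) (F : (Fin l → ℤ) → ℝ) :
    ∏ m ∈ subCell Δ m₀ m₁ S, F m = ∏ m ∈ S \ {m₀, m₁}, F m := by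
  refine Finset.prod_bij (fun m _ => (m : Fin l → ℤ)) (fun m hm => ?_)
    (fun a _ b _ h => Subtype.ext h) (fun m hm => ?_) fun _ _ => rfl
  · have h1 := m.prop_mem
    have h2 : (m : Fin l → ℤ) ∈ S := by simpa [subCell] using hm
    simp [h1, h2]
  · simp only [Finset.mem_sdiff, Finset.mem_insert, Finset.mem_singleton] at hm
    exact ⟨⟨m, by simpa using ⟨hS hm.1, not_or.1 hm.2⟩⟩, by simpa [subCell] using hm.1, rfl⟩

/-- The sum `∑ |t ^ (w m) s_m / s_{m₀}|²` at an identified point of `X_t`. -/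
def normSum (ε : (Fin l → ℤ) → ℝ) (Λ : (Rest Δ m₀ m₁ → ℂ) → ℂ) (z : Rest Δ m₀ m₁ → ℂ) : ℝ :=
  1 + ‖Complex.exp (Λ z)‖ ^ 2 + ∑ m, ‖z m * Complex.exp (ε m * Λ z)‖ ^ 2

/-- The difference of `a_m` and `â_m` at an identified point of `X_t`. -/
def shift (κ : ℝ) (ε : (Fin l → ℤ) → ℝ) (Λ : (Rest Δ m₀ m₁ → ℂ) → ℂ) (m : Fin l → ℤ)
    (z : Rest Δ m₀ m₁ → ℂ) : ℝ :=
  κ + Real.log (normSum ε Λ z) - 2 * ε m * (Λ z).re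

/-- The contribution of `m₀`, `m₁` to the summand of the simplex `S` in `h_t`. -/
def edgeWeight (κ : ℝ) (ε : (Fin l → ℤ) → ℝ) (Λ : (Rest Δ m₀ m₁ → ℂ) → ℂ)
    (S : Finset (Fin l → ℤ)) (z : Rest Δ m₀ m₁ → ℂ) : ℝ :=
  ∏ m ∈ S ∩ {m₀, m₁}, ((shift κ ε Λ m z)⁻¹) ^ 2

lemma normSum_pos (ε : (Fin l → ℤ) → ℝ) (Λ : (Rest Δ m₀ m₁ → ℂ) → ℂ) (z : Rest Δ m₀ m₁ → ℂ) :
    0 < normSum ε Λ z := by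
  unfold normSum
  positivity

lemma sumSq_along (hm₀ : m₀ ∈ Δ) (hm₁ : m₁ ∈ Δ) (hne : m₀ ≠ m₁) (hw₀ : w m₀ = 0)
    (hw₁ : w m₁ = 0) {e : Fin l → ℝ} (he : pairing (m₁ - m₀) e = 1) (L : ℂ) {p : Fin l → ℂ}
    (hp : p ∈ toricTorus m₀ m₁) (s : ℂ) :
    sumSq Δ w L (torusExp (s • toComplex e) p) =
      ‖monomial m₀ (torusExp (s • toComplex e) p)‖ ^ 2 *
        (1 + ‖Complex.exp s‖ ^ 2 + ∑ m : Rest Δ m₀ m₁,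
          ‖charVal w L m₀ p m * Complex.exp (pairing ((m : Fin l → ℤ) - m₀) e * s)‖ ^ 2) := by
  set x := torusExp (s • toComplex e) p with hx
  have hx0 : ∀ i, x i ≠ 0 := torusExp_ne_zero _ hp.1
  have hmon := monomial_ne_zero m₀ hx0
  have h1 : sumSq Δ w L x = ‖monomial m₀ x‖ ^ 2 * ∑ m ∈ Δ, ‖charVal w L m₀ x m‖ ^ 2 := by
    rw [sumSq, Finset.mul_sum]
    refine Finset.sum_congr rfl fun m _ => ?_
    rw [← mul_pow, ← norm_mul, charVal]
    congr 2
    field_simp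
  rw [h1, sum_eq_add_rest hm₀ hm₁ hne]
  simp only [hx, charVal_along]
  rw [charVal_base hw₀ L hp.1, charVal_opposite hw₁ L hp, pairing_self_sub, he]
  simp

/-- The factor `|s_{m₀}|²` cancels in `eta`. What remains is the normalized monomial at `p`, its
change under the shift by `Λ z`, and `normSum`, so the difference from `hatA` depends on `z` alone.
-/
lemma aFun_along (hm₀ : m₀ ∈ Δ) (hm₁ : m₁ ∈ Δ) (hne : m₀ ≠ m₁) (hw₀ : w m₀ = 0)
    (hw₁ : w m₁ = 0) {e : Fin l → ℝ} (he : pairing (m₁ - m₀) e = 1) (κ : ℝ) (L : ℂ)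
    {p : Fin l → ℂ} (hp : p ∈ toricTorus m₀ m₁) (Λ : (Rest Δ m₀ m₁ → ℂ) → ℂ) (m : Fin l → ℤ) :
    aFun Δ w κ L m (torusExp (Λ (fun m => charVal w L m₀ p m) • toComplex e) p) =
      hatA w L m₀ m p + shift κ (fun m => pairing (m - m₀) e) Λ m
        (fun m => charVal w L m₀ p m) := by
  set z : Rest Δ m₀ m₁ → ℂ := fun m => charVal w L m₀ p m with hz
  set x := torusExp (Λ z • toComplex e) p with hx
  have hx0 : ∀ i, x i ≠ 0 := torusExp_ne_zero _ hp.1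
  have hmon : ‖monomial m₀ x‖ ≠ 0 := norm_ne_zero_iff.2 (monomial_ne_zero m₀ hx0)
  have hQ := normSum_pos (fun m => pairing (m - m₀) e) Λ z
  have h1 : eta Δ w L m x = ‖charVal w L m₀ x m‖ ^ 2 /
      normSum (fun m => pairing (m - m₀) e) Λ z := by
    rw [eta, hx, sumSq_along hm₀ hm₁ hne hw₀ hw₁ he L hp, ← hx]
    have h2 : tpow L (w m) * monomial m x = monomial m₀ x * charVal w L m₀ x m := by
      rw [charVal]
      have := monomial_ne_zero m₀ hx0
      field_simp
    rw [h2, norm_mul, mul_pow, mul_div_mul_left _ _ (pow_ne_zero 2 hmon)]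
    rfl
  have hc : ‖charVal w L m₀ x m‖ ^ 2 ≠ 0 :=
    pow_ne_zero 2 (norm_ne_zero_iff.2 (charVal_ne_zero w L m₀ m hx0))
  have hA : Real.log (‖charVal w L m₀ x m‖ ^ 2) = -hatA w L m₀ m x := by
    simp [hatA, charVal]
  rw [aFun, h1, Real.log_div hc hQ.ne', hA, hx, hatA_torusExp w L m₀ m _ hp.1, pairing_smul,
    pairing_toComplex, shift, Complex.mul_re, Complex.ofReal_re, Complex.ofReal_im]
  ring

/-- Since `hatA` vanishes at `m₀` and `m₁`, their factors are functions of `z` only and are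
collected in `edgeWeight`. -/
lemma hFun_along (hm₀ : m₀ ∈ Δ) (hm₁ : m₁ ∈ Δ) (hne : m₀ ≠ m₁) (hw₀ : w m₀ = 0)
    (hw₁ : w m₁ = 0) {e : Fin l → ℝ} (he : pairing (m₁ - m₀) e = 1) (κ : ℝ) (L : ℂ)
    {p : Fin l → ℂ} (hp : p ∈ toricTorus m₀ m₁) (Λ : (Rest Δ m₀ m₁ → ℂ) → ℂ) :
    hFun Δ w κ L (torusExp (Λ (fun m => charVal w L m₀ p m) • toComplex e) p) =
      κ ^ 2 * ∑ S : topCells Δ w,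
        edgeWeight κ (fun m => pairing (m - m₀) e) Λ S (fun m => charVal w L m₀ p m) *
        ∏ m ∈ subCell Δ m₀ m₁ S, ((hatA w L m₀ m p +
          shift κ (fun m => pairing (m - m₀) e) Λ m (fun m => charVal w L m₀ p m))⁻¹) ^ 2 := by
  classical
  rw [hFun]
  congr 1
  rw [← Finset.sum_coe_sort (topCells Δ w)]
  refine Finset.sum_congr rfl fun S _ => ?_
  have hSΔ : (S : Finset (Fin l → ℤ)) ⊆ Δ := (mem_topCells.1 S.2).1.2.1
  have h0 : hatA w L m₀ m₀ p = 0 := by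
    have : hatA w L m₀ m₀ p = -Real.log (‖charVal w L m₀ p m₀‖ ^ 2) := rfl
    rw [this, charVal_base hw₀ L hp.1]; simp
  have h1 : hatA w L m₀ m₁ p = 0 := by
    have : hatA w L m₀ m₁ p = -Real.log (‖charVal w L m₀ p m₁‖ ^ 2) := rfl
    rw [this, charVal_opposite hw₁ L hp]; simp
  simp only [aFun_along hm₀ hm₁ hne hw₀ hw₁ he κ L hp]
  rw [← Finset.prod_inv_distrib, ← Finset.prod_pow,
    ← Finset.prod_inter_mul_prod_sdiff (S : Finset (Fin l → ℤ)) {m₀, m₁}, edgeWeight]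
  have h2 := prod_subCell (m₀ := m₀) (m₁ := m₁) hSΔ fun m => ((hatA w L m₀ m p +
    shift κ (fun m => pairing (m - m₀) e) Λ m (fun m : Rest Δ m₀ m₁ => charVal w L m₀ p m))⁻¹) ^ 2
  rw [h2]
  congr 1
  · refine Finset.prod_congr (by congr) fun m hm => ?_
    have hm' := (Finset.mem_inter.1 hm).2
    rcases Finset.mem_insert.1 hm' with rfl | h
    · rw [h0, zero_add]
    · rw [Finset.mem_singleton.1 h, h1, zero_add]

lemma hatH_eq (L : ℂ) (p : Fin l → ℂ) :
    hatH Δ w L m₀ m₁ p = ∑ S : topCells Δ w,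
      (if m₀ ∈ (S : Finset (Fin l → ℤ)) ∧ m₁ ∈ (S : Finset (Fin l → ℤ)) then 1 else 0) *
      ∏ m ∈ subCell Δ m₀ m₁ S, ((hatA w L m₀ m p)⁻¹) ^ 2 := by
  classical
  rw [hatH, Finset.sum_filter, ← Finset.sum_coe_sort (topCells Δ w)]
  refine Finset.sum_congr rfl fun S _ => ?_
  have hSΔ : (S : Finset (Fin l → ℤ)) ⊆ Δ := (mem_topCells.1 S.2).1.2.1
  have h2 := prod_subCell (m₀ := m₀) (m₁ := m₁) hSΔ fun m => ((hatA w L m₀ m p)⁻¹) ^ 2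
  rw [h2, Finset.prod_pow, Finset.prod_inv_distrib]
  split_ifs <;> simp

end Potentials

/-! ### Rescaling of the Lie algebra by the values of `hatA`. -/

section Scaling

variable {l : ℕ} {Δ : Finset (Fin l → ℤ)} {w : (Fin l → ℤ) → ℝ} {m₀ m₁ : Fin l → ℤ}

/-- The character `m` on the Lie algebra `N̂_ℂ`. -/
def pairingFunctional (m₀ m₁ m : Fin l → ℤ) : toricLie m₀ m₁ →L[ℂ] ℂ :=
  LinearMap.toContinuousLinearMap
    { toFun := fun v => pairing m (v : Fin l → ℂ)
      map_add' := fun _ _ => pairing_add _ _ _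
      map_smul' := fun _ _ => pairing_smul _ _ _ }

/-- The character `m - m₀` on the Lie algebra `N̂_ℂ`. -/
def charFunctional (m₀ m₁ m : Fin l → ℤ) : toricLie m₀ m₁ →L[ℂ] ℂ :=
  pairingFunctional m₀ m₁ (m - m₀)

lemma charFunctional_apply (m₀ m₁ m : Fin l → ℤ) (v : toricLie m₀ m₁) :
    charFunctional m₀ m₁ m v = pairing (m - m₀) (v : Fin l → ℂ) := rfl

/-- The vectors of a basis of `N̂_ℂ` that is dual to the characters of a simplex. -/
structure IsDualFamily (m₀ m₁ : Fin l → ℤ) (S : Finset (Fin l → ℤ))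
    (e : (Fin l → ℤ) → Fin l → ℝ) : Prop where
  one : ∀ m ∈ S, m ≠ m₀ → pairing (m - m₀) (e m) = 1
  zero : ∀ m ∈ S, m ≠ m₀ → ∀ a ∈ S, a ≠ m → pairing (a - m₀) (e m) = 0

/-- Vectors of `toricLie` are already annihilated by `m₁ - m₀`, so the remaining vertices of the
simplex suffice to determine them. -/
lemma eq_of_charFunctional_eq (hsimp : IsSimplicial Δ w) {S : Finset (Fin l → ℤ)}
    (hS : S ∈ topCells Δ w) (hm₀S : m₀ ∈ S) {u v : toricLie m₀ m₁}
    (h : ∀ m ∈ subCell Δ m₀ m₁ S, charFunctional m₀ m₁ m u = charFunctional m₀ m₁ m v) :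
    u = v := by
  refine Subtype.ext (sub_eq_zero.1 (eq_zero_of_pairing_topCell_complex hsimp hS hm₀S
    fun m hm => ?_))
  rw [pairing_sub_right, sub_eq_zero]
  by_cases h0 : m = m₀
  · rw [h0, pairing_self_sub, pairing_self_sub]
  by_cases h1 : m = m₁
  · rw [h1]; exact u.2.trans v.2.symm
  have hm' : m ∈ Δ \ {m₀, m₁} := by
    simp [(mem_topCells.1 hS).1.2.1 hm, h0, h1]
  exact h ⟨m, hm'⟩ (by simpa [subCell] using hm)

lemma dual_mem_toricLie {S : Finset (Fin l → ℤ)} (hm₁S : m₁ ∈ S)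
    {e : (Fin l → ℤ) → Fin l → ℝ} (he : IsDualFamily m₀ m₁ S e)
    (m : Rest Δ m₀ m₁) (hm : (m : Fin l → ℤ) ∈ S) : toComplex (e m) ∈ toricLie m₀ m₁ := by
  have h := m.prop_mem
  change pairing (m₁ - m₀) (toComplex (e m)) = 0
  rw [pairing_toComplex, he.zero m hm h.2.1 m₁ hm₁S h.2.2.symm, Complex.ofReal_zero]

open Classical in
/-- The linear map of `N̂_ℂ` that is diagonal, with entries `R`, in the basis `e`. -/
def scaleMap (S : Finset (Fin l → ℤ)) (e : (Fin l → ℤ) → Fin l → ℝ)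
    (R : Rest Δ m₀ m₁ → ℝ) : toricLie m₀ m₁ →L[ℂ] toricLie m₀ m₁ :=
  ∑ m ∈ subCell Δ m₀ m₁ S, (charFunctional m₀ m₁ m).smulRight
    ((R m : ℂ) • if h : toComplex (e m) ∈ toricLie m₀ m₁ then ⟨toComplex (e m), h⟩ else 0)

lemma charFunctional_scaleMap {S : Finset (Fin l → ℤ)} (hm₁S : m₁ ∈ S)
    {e : (Fin l → ℤ) → Fin l → ℝ} (he : IsDualFamily m₀ m₁ S e) (R : Rest Δ m₀ m₁ → ℝ)
    (a : Fin l → ℤ) (v : toricLie m₀ m₁) :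
    charFunctional m₀ m₁ a (scaleMap S e R v) = ∑ m ∈ subCell Δ m₀ m₁ S,
      ((R m * pairing (a - m₀) (e m) : ℝ) : ℂ) * charFunctional m₀ m₁ m v := by
  simp only [scaleMap, sum_apply, map_sum]
  refine Finset.sum_congr rfl fun m hm => ?_
  have hmS : (m : Fin l → ℤ) ∈ S := by simpa [subCell] using hm
  have h := dual_mem_toricLie hm₁S he m hmS
  rw [ContinuousLinearMap.smulRight_apply, dif_pos h, map_smul, map_smul]
  have h2 : charFunctional m₀ m₁ a ⟨toComplex (e m), h⟩ = (pairing (a - m₀) (e m) : ℝ) :=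
    pairing_toComplex _ _
  rw [h2, smul_eq_mul, smul_eq_mul]
  push_cast
  ring

lemma charFunctional_scaleMap_of_mem {S : Finset (Fin l → ℤ)} (hm₁S : m₁ ∈ S)
    {e : (Fin l → ℤ) → Fin l → ℝ} (he : IsDualFamily m₀ m₁ S e) (R : Rest Δ m₀ m₁ → ℝ)
    {a : Rest Δ m₀ m₁} (ha : a ∈ subCell Δ m₀ m₁ S) (v : toricLie m₀ m₁) :
    charFunctional m₀ m₁ a (scaleMap S e R v) = R a * charFunctional m₀ m₁ a v := by
  have haS : (a : Fin l → ℤ) ∈ S := by simpa [subCell] using ha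
  rw [charFunctional_scaleMap hm₁S he, Finset.sum_eq_single a]
  · rw [he.one a haS a.prop_mem.2.1, mul_one]
  · intro m hm hne
    have hmS : (m : Fin l → ℤ) ∈ S := by simpa [subCell] using hm
    rw [he.zero m hmS m.prop_mem.2.1 a haS fun h => hne (Subtype.ext h.symm)]
    simp
  · exact fun h => absurd ha h

/-- The isomorphism of `N̂_ℂ` that is diagonal, with entries `R`, in the basis `e`. -/
lemma exists_scaleEquiv (hsimp : IsSimplicial Δ w) {S : Finset (Fin l → ℤ)}
    (hS : S ∈ topCells Δ w) (hm₀S : m₀ ∈ S) (hm₁S : m₁ ∈ S)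
    {e : (Fin l → ℤ) → Fin l → ℝ} (he : IsDualFamily m₀ m₁ S e) {R : Rest Δ m₀ m₁ → ℝ}
    (hR : ∀ m, R m ≠ 0) :
    ∃ T : toricLie m₀ m₁ ≃L[ℂ] toricLie m₀ m₁, ∀ v, T v = scaleMap S e R v := by
  have h : ∀ R' : Rest Δ m₀ m₁ → ℝ, (∀ m, R' m ≠ 0) → ∀ v,
      scaleMap S e (fun m => (R' m)⁻¹) (scaleMap S e R' v) = v := by
    intro R' hR' v
    refine eq_of_charFunctional_eq hsimp hS hm₀S fun m hm => ?_
    rw [charFunctional_scaleMap_of_mem hm₁S he _ hm, charFunctional_scaleMap_of_mem hm₁S he _ hm,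
      Complex.ofReal_inv, inv_mul_cancel_left₀ (Complex.ofReal_ne_zero.2 (hR' m))]
  refine ⟨ContinuousLinearEquiv.equivOfInverse (scaleMap S e R) (scaleMap S e fun m => (R m)⁻¹)
    (fun v => h R hR v) (fun v => ?_), fun v => rfl⟩
  have := h (fun m => (R m)⁻¹) (fun m => inv_ne_zero (hR m)) v
  simpa only [inv_inv] using this

/-- The parameters of the model potentials at a point where the `â_m` have the values `R`. -/
def scaledParam (w : (Fin l → ℤ) → ℝ) (L : ℂ) (R : Rest Δ m₀ m₁ → ℝ) (S : Finset (Fin l → ℤ))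
    (T : toricLie m₀ m₁ →L[ℂ] toricLie m₀ m₁) (p : Fin l → ℂ) :
    ModelParam (Rest Δ m₀ m₁) (topCells Δ w) (toricLie m₀ m₁) :=
  (fun m => ((R m)⁻¹ : ℂ) • (charFunctional m₀ m₁ m).comp T,
    fun m => charVal w L m₀ p m * Real.exp (R m / 2),
    fun S' => (∏ m ∈ subCell Δ m₀ m₁ S', ((R m)⁻¹) ^ 2) *
      (∏ m ∈ subCell Δ m₀ m₁ S, ((R m)⁻¹) ^ 2)⁻¹)

/-- The factor `exp (R / 2)` in the phase cancels the constant `1/2` in the exponent of `modelChar`,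
and the scaling of the functional by `1 / R` cancels the division by `r = 1 / R`. When `R` is the
value of `hatA` at `p`, the phase has absolute value one. -/
lemma modelChar_scaledParam {L : ℂ} {R : Rest Δ m₀ m₁ → ℝ} (hR : ∀ m, 0 < R m)
    (S : Finset (Fin l → ℤ)) (T : toricLie m₀ m₁ →L[ℂ] toricLie m₀ m₁) (p : Fin l → ℂ)
    (ζ : toricLie m₀ m₁) :
    modelChar (scaledParam w L R S T p, fun m => (R m)⁻¹) ζ =
      fun m : Rest Δ m₀ m₁ => charVal w L m₀ (torusExp (T ζ : Fin l → ℂ) p) m := by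
  funext m
  have h1 : 0 < (R m)⁻¹ := inv_pos.2 (hR m)
  have hne : (R m : ℂ) ≠ 0 := Complex.ofReal_ne_zero.2 (hR m).ne'
  rw [charVal_torusExp, ← charFunctional_apply m₀ m₁ m (T ζ)]
  simp only [modelChar, scaledParam, decay, h1, if_true, pow_zero, one_mul, smul_apply,
    ContinuousLinearMap.comp_apply, smul_eq_mul]
  rw [mul_assoc, Complex.ofReal_exp, ← Complex.exp_add]
  congr 2
  push_cast
  field_simp
  ring

/-- Since `hatA` is real affine along the action, `R m` factors out of each denominator, and the
product over `S` factors out of the whole sum. The case of arbitrary `N` and `B` serves both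
metrics. -/
lemma prod_scaledParam {L : ℂ} {R : Rest Δ m₀ m₁ → ℝ} (hR : ∀ m, 0 < R m)
    (S : Finset (Fin l → ℤ)) (T : toricLie m₀ m₁ →L[ℂ] toricLie m₀ m₁) {p : Fin l → ℂ}
    (hp : ∀ i, p i ≠ 0) (hRp : ∀ m : Rest Δ m₀ m₁, hatA w L m₀ m p = R m)
    (N : topCells Δ w → (Rest Δ m₀ m₁ → ℂ) → ℝ) (B : Rest Δ m₀ m₁ → (Rest Δ m₀ m₁ → ℂ) → ℝ)
    (ζ : toricLie m₀ m₁) :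
    ∑ S' : topCells Δ w,
      N S' (fun m => charVal w L m₀ (torusExp (T ζ : Fin l → ℂ) p) m) *
      ∏ m ∈ subCell Δ m₀ m₁ S', ((hatA w L m₀ m (torusExp (T ζ : Fin l → ℂ) p) +
        B m (fun m => charVal w L m₀ (torusExp (T ζ : Fin l → ℂ) p) m))⁻¹) ^ 2 =
    (∏ m ∈ subCell Δ m₀ m₁ S, ((R m)⁻¹) ^ 2) *
      modelSum (fun S' : topCells Δ w => subCell Δ m₀ m₁ S') N B
        (scaledParam w L R S T p, fun m => (R m)⁻¹) ζ := by
  have hP : 0 < ∏ m ∈ subCell Δ m₀ m₁ S, ((R m)⁻¹) ^ 2 :=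
    Finset.prod_pos fun m _ => pow_pos (inv_pos.2 (hR m)) 2
  rw [modelSum, modelChar_scaledParam hR, Finset.mul_sum]
  refine Finset.sum_congr rfl fun S' _ => ?_
  set z : Rest Δ m₀ m₁ → ℂ := fun m => charVal w L m₀ (torusExp (T ζ : Fin l → ℂ) p) m
  have h1 : ∀ m : Rest Δ m₀ m₁, ((hatA w L m₀ m (torusExp (T ζ : Fin l → ℂ) p) + B m z)⁻¹) ^ 2 =
      ((R m)⁻¹) ^ 2 * ((1 - 2 * ((scaledParam w L R S T p).1 m ζ).re +
        (R m)⁻¹ * B m z)⁻¹) ^ 2 := by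
    intro m
    have h2 : ((scaledParam w L R S T p).1 m ζ).re
        = (R m)⁻¹ * (pairing ((m : Fin l → ℤ) - m₀) (T ζ : Fin l → ℂ)).re := by
      simp only [scaledParam, smul_apply, ContinuousLinearMap.comp_apply, smul_eq_mul,
        charFunctional_apply]
      rw [← Complex.ofReal_inv, Complex.re_ofReal_mul]
    have h3 := (hR m).ne'
    rw [hatA_torusExp w L m₀ m _ hp, hRp, h2, ← mul_pow, ← mul_inv]
    congr 2
    field_simp
  have h4 : (scaledParam w L R S T p).2.2 S' = (∏ m ∈ subCell Δ m₀ m₁ S', ((R m)⁻¹) ^ 2) *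
      (∏ m ∈ subCell Δ m₀ m₁ S, ((R m)⁻¹) ^ 2)⁻¹ := rfl
  simp only [h1, Finset.prod_mul_distrib, h4]
  have h5 := mul_inv_cancel₀ hP.ne'
  generalize (∏ m ∈ subCell Δ m₀ m₁ S, ((R m)⁻¹) ^ 2) = P at h5 ⊢
  generalize (∏ m ∈ subCell Δ m₀ m₁ S', ((R m)⁻¹) ^ 2) = A
  generalize (∏ m ∈ subCell Δ m₀ m₁ S', ((1 - 2 * ((scaledParam w L R S T p).1 m ζ).re +
    (R m)⁻¹ * B m z)⁻¹) ^ 2) = D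
  linear_combination (-(N S' z * A * D)) * h5

end Scaling

/-! ### Both potentials as model potentials with parameters in a compact set. -/

section Matching

variable {l : ℕ} {Δ : Finset (Fin l → ℤ)} {w : (Fin l → ℤ) → ℝ} {m₀ m₁ : Fin l → ℤ}

/-- The weights of the simplices in the toric model. -/
def toricWeight (Δ : Finset (Fin l → ℤ)) (w : (Fin l → ℤ) → ℝ) (m₀ m₁ : Fin l → ℤ)
    (S : topCells Δ w) (_z : Rest Δ m₀ m₁ → ℂ) : ℝ :=
  if m₀ ∈ (S : Finset (Fin l → ℤ)) ∧ m₁ ∈ (S : Finset (Fin l → ℤ)) then 1 else 0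

/-- The toric potential as a model potential. -/
def toricModel (Δ : Finset (Fin l → ℤ)) (w : (Fin l → ℤ) → ℝ) (m₀ m₁ : Fin l → ℤ) :
    ModelParam (Rest Δ m₀ m₁) (topCells Δ w) (toricLie m₀ m₁) × (Rest Δ m₀ m₁ → ℝ) →
      toricLie m₀ m₁ → ℝ :=
  modelPotential (fun S' : topCells Δ w => subCell Δ m₀ m₁ S') (fun _ => 0)
    (toricWeight Δ w m₀ m₁) (fun _ _ => 0)

/-- The smooth part of the potential of the approximate metric. -/
def smoothPart (m₀ : Fin l → ℤ) (e : Fin l → ℝ) (Λ : (Rest Δ m₀ m₁ → ℂ) → ℂ)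
    (z : Rest Δ m₀ m₁ → ℂ) : ℝ :=
  Real.log (normSum (fun m => pairing (m - m₀) e) Λ z) + 2 * pairing m₀ e * (Λ z).re

/-- The potential of the approximate metric as a model potential. -/
def approxModel (Δ : Finset (Fin l → ℤ)) (w : (Fin l → ℤ) → ℝ) (m₀ m₁ : Fin l → ℤ) (κ : ℝ)
    (e : Fin l → ℝ) (Λ : (Rest Δ m₀ m₁ → ℂ) → ℂ) :
    ModelParam (Rest Δ m₀ m₁) (topCells Δ w) (toricLie m₀ m₁) × (Rest Δ m₀ m₁ → ℝ) →
      toricLie m₀ m₁ → ℝ :=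
  modelPotential (fun S' : topCells Δ w => subCell Δ m₀ m₁ S') (smoothPart m₀ e Λ)
    (fun S' => edgeWeight κ (fun m => pairing (m - m₀) e) Λ (S' : Finset (Fin l → ℤ)))
    (fun m => shift κ (fun m => pairing (m - m₀) e) Λ m)

lemma toricPotential_eq_model {L : ℂ} {R : Rest Δ m₀ m₁ → ℝ} (hR : ∀ m, 0 < R m)
    (S : Finset (Fin l → ℤ)) (T : toricLie m₀ m₁ →L[ℂ] toricLie m₀ m₁) {p : Fin l → ℂ}
    (hp : ∀ i, p i ≠ 0) (hRp : ∀ m : Rest Δ m₀ m₁, hatA w L m₀ m p = R m) {ζ : toricLie m₀ m₁}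
    (hpos : 0 < modelSum (fun S' : topCells Δ w => subCell Δ m₀ m₁ S') (toricWeight Δ w m₀ m₁)
      (fun _ _ => 0) (scaledParam w L R S T p, fun m => (R m)⁻¹) ζ) :
    toricPotential Δ w L m₀ m₁ (torusExp (T ζ : Fin l → ℂ) p) =
      toricModel Δ w m₀ m₁ (scaledParam w L R S T p, fun m => (R m)⁻¹) ζ +
        Real.log (∏ m ∈ subCell Δ m₀ m₁ S, ((R m)⁻¹) ^ 2) := by
  have hP : 0 < ∏ m ∈ subCell Δ m₀ m₁ S, ((R m)⁻¹) ^ 2 :=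
    Finset.prod_pos fun m _ => pow_pos (inv_pos.2 (hR m)) 2
  have h := prod_scaledParam hR S T hp hRp (toricWeight Δ w m₀ m₁) (fun _ _ => 0) ζ
  have h2 : hatH Δ w L m₀ m₁ (torusExp (T ζ : Fin l → ℂ) p) =
      (∏ m ∈ subCell Δ m₀ m₁ S, ((R m)⁻¹) ^ 2) *
      modelSum (fun S' : topCells Δ w => subCell Δ m₀ m₁ S') (toricWeight Δ w m₀ m₁)
        (fun _ _ => 0) (scaledParam w L R S T p, fun m => (R m)⁻¹) ζ := by
    rw [hatH_eq, ← h]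
    simp [toricWeight]
  rw [toricPotential, h2, Real.log_mul hP.ne' hpos.ne', toricModel, modelPotential]
  ring

/-- The logarithm of `|s_{m₀}|²` at the identified point splits into a constant, the real part of a
linear function of `ζ`, and a multiple of `Re Λ z`. The first two are affine, and the third is part
of `smoothPart`. -/
lemma approxPotential_eq_model (hm₀ : m₀ ∈ Δ) (hm₁ : m₁ ∈ Δ) (hne : m₀ ≠ m₁) (hw₀ : w m₀ = 0)
    (hw₁ : w m₁ = 0) {e : Fin l → ℝ} (he : pairing (m₁ - m₀) e = 1) {κ : ℝ} (hκ : 0 < κ) {L : ℂ}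
    {R : Rest Δ m₀ m₁ → ℝ} (hR : ∀ m, 0 < R m)
    (S : Finset (Fin l → ℤ)) (T : toricLie m₀ m₁ →L[ℂ] toricLie m₀ m₁) {p : Fin l → ℂ}
    (hp : p ∈ toricTorus m₀ m₁) (hRp : ∀ m : Rest Δ m₀ m₁, hatA w L m₀ m p = R m)
    (Λ : (Rest Δ m₀ m₁ → ℂ) → ℂ) {ζ : toricLie m₀ m₁}
    (hpos : 0 < modelSum (fun S' : topCells Δ w => subCell Δ m₀ m₁ S')
      (fun S' => edgeWeight κ (fun m => pairing (m - m₀) e) Λ (S' : Finset (Fin l → ℤ)))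
      (fun m => shift κ (fun m => pairing (m - m₀) e) Λ m)
      (scaledParam w L R S T p, fun m => (R m)⁻¹) ζ) :
    approxPotential Δ w κ L (torusExp (Λ (fun m => charVal w L m₀
        (torusExp (T ζ : Fin l → ℂ) p) m) • toComplex e) (torusExp (T ζ : Fin l → ℂ) p)) =
      approxModel Δ w m₀ m₁ κ e Λ (scaledParam w L R S T p, fun m => (R m)⁻¹) ζ +
        ((Real.log (κ ^ 2) + Real.log (∏ m ∈ subCell Δ m₀ m₁ S, ((R m)⁻¹) ^ 2) +
          2 * Real.log ‖monomial m₀ p‖) + 2 * (pairing m₀ (T ζ : Fin l → ℂ)).re) := by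
  have hP : 0 < ∏ m ∈ subCell Δ m₀ m₁ S, ((R m)⁻¹) ^ 2 :=
    Finset.prod_pos fun m _ => pow_pos (inv_pos.2 (hR m)) 2
  have hp' : torusExp (T ζ : Fin l → ℂ) p ∈ toricTorus m₀ m₁ := torusExp_mem_toricTorus hp (T ζ).2
  have h := prod_scaledParam hR S T hp.1 hRp
    (fun S' : topCells Δ w => edgeWeight κ (fun m => pairing (m - m₀) e) Λ S')
    (fun m => shift κ (fun m => pairing (m - m₀) e) Λ m) ζ
  rw [approxPotential, hFun_along hm₀ hm₁ hne hw₀ hw₁ he κ L hp' Λ, h,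
    sumSq_along hm₀ hm₁ hne hw₀ hw₁ he L hp', approxModel, modelPotential,
    modelChar_scaledParam hR]
  set z : Rest Δ m₀ m₁ → ℂ := fun m => charVal w L m₀ (torusExp (T ζ : Fin l → ℂ) p) m
  have hQ := normSum_pos (fun m => pairing (m - m₀) e) Λ z
  have hm : ‖monomial m₀ p‖ ≠ 0 := norm_ne_zero_iff.2 (monomial_ne_zero m₀ hp.1)
  have hmon : Real.log (‖monomial m₀ (torusExp (Λ z • toComplex e)
      (torusExp (T ζ : Fin l → ℂ) p))‖ ^ 2) = 2 * (pairing m₀ e * (Λ z).re) +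
      (2 * (pairing m₀ (T ζ : Fin l → ℂ)).re + 2 * Real.log ‖monomial m₀ p‖) := by
    rw [monomial_torusExp, monomial_torusExp, norm_mul, norm_mul, Complex.norm_exp,
      Complex.norm_exp, Real.log_pow, Real.log_mul (Real.exp_ne_zero _)
      (mul_ne_zero (Real.exp_ne_zero _) hm), Real.log_mul (Real.exp_ne_zero _) hm, Real.log_exp,
      Real.log_exp, pairing_smul, pairing_toComplex, Complex.mul_re, Complex.ofReal_re,
      Complex.ofReal_im]
    push_cast
    ring
  have hmon0 : ‖monomial m₀ (torusExp (Λ z • toComplex e)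
      (torusExp (T ζ : Fin l → ℂ) p))‖ ^ 2 ≠ 0 :=
    pow_ne_zero 2 (norm_ne_zero_iff.2 (monomial_ne_zero m₀ (torusExp_ne_zero _ hp'.1)))
  have hN : 1 + ‖Complex.exp (Λ z)‖ ^ 2 + ∑ m : Rest Δ m₀ m₁,
      ‖charVal w L m₀ (torusExp (T ζ : Fin l → ℂ) p) m *
        Complex.exp (pairing ((m : Fin l → ℤ) - m₀) e * Λ z)‖ ^ 2 =
      normSum (fun m => pairing (m - m₀) e) Λ z := rfl
  rw [hN, Real.log_mul hmon0 hQ.ne', hmon,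
    Real.log_mul (pow_ne_zero 2 hκ.ne') (mul_pos hP hpos).ne', Real.log_mul hP.ne' hpos.ne',
    smoothPart]
  ring

/-- The smooth data of the approximate metric near the maximal degeneracy point. -/
lemma exists_smooth_radius {κ : ℝ} (hκ : 0 < κ) (m₀ m₁ : Fin l → ℤ) (e : Fin l → ℝ)
    {δ₀ : ℝ} (hδ₀ : 0 < δ₀) {Λ : (Rest Δ m₀ m₁ → ℂ) → ℂ} (hΛ0 : Λ 0 = 0)
    (hΛ : ∀ z ∈ Metric.ball (0 : Rest Δ m₀ m₁ → ℂ) δ₀, ContDiffAt ℂ ∞ Λ z) :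
    (∀ S, 0 < edgeWeight κ (fun m => pairing (m - m₀) e) Λ S 0) ∧
    ∃ δ : ℝ, 0 < δ ∧ ∀ z ∈ Metric.ball (0 : Rest Δ m₀ m₁ → ℂ) δ,
      ContDiffAt ℝ ∞ (smoothPart m₀ e Λ) z ∧
      (∀ m, ContDiffAt ℝ ∞ (shift κ (fun m => pairing (m - m₀) e) Λ m) z) ∧
      ∀ S, ContDiffAt ℝ ∞ (edgeWeight κ (fun m => pairing (m - m₀) e) Λ S) z := by
  set ε : (Fin l → ℤ) → ℝ := fun m => pairing (m - m₀) e with hε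
  have hΛr : ∀ z ∈ Metric.ball (0 : Rest Δ m₀ m₁ → ℂ) δ₀, ContDiffAt ℝ ∞ Λ z :=
    fun z hz => (hΛ z hz).restrict_scalars ℝ
  have hre : ∀ z ∈ Metric.ball (0 : Rest Δ m₀ m₁ → ℂ) δ₀,
      ContDiffAt ℝ ∞ (fun z => (Λ z).re) z :=
    fun z hz => Complex.reCLM.contDiff.contDiffAt.comp z (hΛr z hz)
  have hlog : ∀ z ∈ Metric.ball (0 : Rest Δ m₀ m₁ → ℂ) δ₀,
      ContDiffAt ℝ ∞ (fun z => Real.log (normSum ε Λ z)) z := by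
    intro z hz
    have h1 := hΛr z hz
    refine ContDiffAt.log ?_ (normSum_pos ε Λ z).ne'
    unfold normSum
    refine (contDiffAt_const.add (h1.cexp.norm_sq ℝ)).add (ContDiffAt.sum fun m _ => ?_)
    refine ContDiffAt.norm_sq ℝ (ContDiffAt.mul (by fun_prop) (ContDiffAt.cexp ?_))
    exact contDiffAt_const.mul h1
  have hshift : ∀ m, ∀ z ∈ Metric.ball (0 : Rest Δ m₀ m₁ → ℂ) δ₀,
      ContDiffAt ℝ ∞ (shift κ ε Λ m) z := fun m z hz =>
    (contDiffAt_const.add (hlog z hz)).sub (contDiffAt_const.mul (hre z hz))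
  -- At `z = 0` only the terms of `m₀` and `m₁` remain in `normSum`, so the value is `κ + log 2`.
  have hval : ∀ m, 0 < shift κ ε Λ m 0 := by
    intro m
    have : (0 : ℝ) < Real.log 2 := Real.log_pos (by norm_num)
    simp only [shift, normSum, hΛ0]
    norm_num
    positivity
  have hpos : ∀ m, ∀ᶠ z in 𝓝 (0 : Rest Δ m₀ m₁ → ℂ), 0 < shift κ ε Λ m z := fun m =>
    (hshift m 0 (Metric.mem_ball_self hδ₀)).continuousAt.eventually_const_lt (hval m)
  refine ⟨fun S => Finset.prod_pos fun m _ => pow_pos (inv_pos.2 (hval m)) 2, ?_⟩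
  have hball : ∀ᶠ z in 𝓝 (0 : Rest Δ m₀ m₁ → ℂ),
      z ∈ Metric.ball (0 : Rest Δ m₀ m₁ → ℂ) δ₀ := Metric.ball_mem_nhds _ hδ₀
  obtain ⟨δ, hδ, hδb⟩ := Metric.eventually_nhds_iff_ball.1
    (hball.and ((hpos m₀).and (hpos m₁)))
  refine ⟨δ, hδ, fun z hz => ?_⟩
  obtain ⟨h1, h2, h3⟩ := hδb z hz
  refine ⟨(hlog z h1).add (contDiffAt_const.mul (hre z h1)), fun m => hshift m z h1, fun S => ?_⟩
  refine contDiffAt_prod fun m hm => ((hshift m z h1).inv ?_).pow 2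
  rcases Finset.mem_insert.1 (Finset.mem_inter.1 hm).2 with rfl | h
  · exact h2.ne'
  · rw [Finset.mem_singleton.1 h]; exact h3.ne'

/-- A set of parameters that contains those of all points of the polyhedron. -/
def paramSet (Δ : Finset (Fin l → ℤ)) (w : (Fin l → ℤ) → ℝ) (m₀ m₁ : Fin l → ℤ) (C₁ C₂ : ℝ) :
    Set (ModelParam (Rest Δ m₀ m₁) (topCells Δ w) (toricLie m₀ m₁)) :=
  {κ | (‖κ.1‖ ≤ C₁ ∧ ‖κ.2.1‖ ≤ 1 ∧ ‖κ.2.2‖ ≤ C₂) ∧ (∀ S, 0 ≤ κ.2.2 S) ∧ ∃ S : topCells Δ w,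
    (m₀ ∈ (S : Finset (Fin l → ℤ)) ∧ m₁ ∈ (S : Finset (Fin l → ℤ))) ∧ κ.2.2 S = 1 ∧
    ∀ m ∈ subCell Δ m₀ m₁ S, κ.1 m = charFunctional m₀ m₁ m}

/-- The existential over top cells is a finite union of closed conditions, and the parameter space
is finite dimensional. -/
lemma isCompact_paramSet (C₁ C₂ : ℝ) : IsCompact (paramSet Δ w m₀ m₁ C₁ C₂) := by
  have : ProperSpace (toricLie m₀ m₁ →L[ℂ] ℂ) :=
    FiniteDimensional.proper ℂ (toricLie m₀ m₁ →L[ℂ] ℂ)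
  refine Metric.isCompact_of_isClosed_isBounded ?_ ?_
  · have e1 : IsClosed {κ : ModelParam (Rest Δ m₀ m₁) (topCells Δ w) (toricLie m₀ m₁) |
        ‖κ.1‖ ≤ C₁ ∧ ‖κ.2.1‖ ≤ 1 ∧ ‖κ.2.2‖ ≤ C₂} :=
      (isClosed_le continuous_fst.norm continuous_const).and
        ((isClosed_le continuous_snd.fst.norm continuous_const).and
          (isClosed_le continuous_snd.snd.norm continuous_const))
    have e2 : IsClosed {κ : ModelParam (Rest Δ m₀ m₁) (topCells Δ w) (toricLie m₀ m₁) |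
        ∀ S, 0 ≤ κ.2.2 S} := by
      simp only [Set.ofPred_forall]
      exact isClosed_iInter fun S => isClosed_le (by fun_prop) (by fun_prop)
    have e3 : IsClosed {κ : ModelParam (Rest Δ m₀ m₁) (topCells Δ w) (toricLie m₀ m₁) |
        ∃ S : topCells Δ w, (m₀ ∈ (S : Finset (Fin l → ℤ)) ∧ m₁ ∈ (S : Finset (Fin l → ℤ))) ∧
          κ.2.2 S = 1 ∧ ∀ m ∈ subCell Δ m₀ m₁ S, κ.1 m = charFunctional m₀ m₁ m} := by
      simp only [Set.ofPred_exists]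
      refine isClosed_iUnion_of_finite fun S => ?_
      refine IsClosed.and isClosed_const (IsClosed.and ?_ ?_)
      · exact isClosed_eq (by fun_prop) (by fun_prop)
      · simp only [Set.ofPred_forall]
        exact isClosed_iInter fun m => isClosed_iInter fun _ =>
          isClosed_eq (by fun_prop) (by fun_prop)
    exact e1.inter (e2.inter e3)
  · refine (Metric.isBounded_closedBall (x := 0) (r := max C₁ (max 1 C₂))).subset fun κ hκ => ?_
    rw [mem_closedBall_zero_iff, Prod.norm_def, Prod.norm_def]
    exact max_le_max hκ.1.1 (max_le_max hκ.1.2.1 hκ.1.2.2)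

/-- The exchange hypothesis bounds the rescaled characters, and through `prod_le_prod_of_exchange`
also the weights. The constants are sums over all top cells and lattice points, so they depend
neither on the point nor on `t`. -/
lemma exists_scaledParam_mem (hsimp : IsSimplicial Δ w) (C : ℝ) (hC : 1 ≤ C) :
    ∃ C₁ C₂ : ℝ, ∀ (L : ℂ) (p : Fin l → ℂ), (∀ i, p i ≠ 0) →
      (∀ m : Rest Δ m₀ m₁, 1 ≤ hatA w L m₀ m p) →
      ∀ S ∈ topCells Δ w, m₀ ∈ S → m₁ ∈ S →
      (∀ m' ∈ S, m' ≠ m₀ → m' ≠ m₁ → ∀ m ∈ Δ, OffSpan m₀ (S.erase m') m →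
        hatA w L m₀ m' p ≤ C * hatA w L m₀ m p) →
      ∃ T : toricLie m₀ m₁ ≃L[ℂ] toricLie m₀ m₁,
        scaledParam w L (fun m : Rest Δ m₀ m₁ => hatA w L m₀ m p) S T p ∈
          paramSet Δ w m₀ m₁ C₁ C₂ := by
  classical
  have hdual : ∀ S : topCells Δ w, ∃ e : (Fin l → ℤ) → Fin l → ℝ,
      m₀ ∈ (S : Finset (Fin l → ℤ)) → IsDualFamily m₀ m₁ S e := by
    intro S
    by_cases h : m₀ ∈ (S : Finset (Fin l → ℤ))
    · obtain ⟨e, he⟩ := exists_dualBasis hsimp S.2 h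
      exact ⟨e, fun _ => ⟨fun m hm hne => (he m hm hne).1, fun m hm hne => (he m hm hne).2⟩⟩
    · exact ⟨0, fun h' => absurd h' h⟩
  choose e he using hdual
  set D : topCells Δ w → Rest Δ m₀ m₁ → Rest Δ m₀ m₁ → ℝ := fun S m m' =>
    C * |pairing ((m : Fin l → ℤ) - m₀) (e S m')| * ‖charFunctional m₀ m₁ m'‖ with hD
  have hD0 : ∀ S m m', 0 ≤ D S m m' := fun S m m' => by
    have : 0 ≤ C := zero_le_one.trans hC
    simp only [hD]
    positivity
  refine ⟨∑ S, ∑ m, ∑ m', D S m m', (C ^ (l + 1)) ^ 2, ?_⟩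
  intro L p hp h1 S hS hm₀S hm₁S hex
  set R : Rest Δ m₀ m₁ → ℝ := fun m => hatA w L m₀ m p with hR
  have hRpos : ∀ m, 0 < R m := fun m => zero_lt_one.trans_le (h1 m)
  have heS := he ⟨S, hS⟩ hm₀S
  obtain ⟨T, hT⟩ := exists_scaleEquiv hsimp hS hm₀S hm₁S heS (R := R) fun m => (hRpos m).ne'
  have hSΔ := (mem_topCells.1 hS).1.2.1
  have hprodpos : ∀ S' : Finset (Fin l → ℤ), 0 < ∏ m ∈ subCell Δ m₀ m₁ S', R m := fun S' =>
    Finset.prod_pos fun m _ => hRpos m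
  have hq : ∀ S' : topCells Δ w, (scaledParam w L R S T p).2.2 S' =
      ((∏ m ∈ subCell Δ m₀ m₁ S, R m) / ∏ m ∈ subCell Δ m₀ m₁ S', R m) ^ 2 := by
    intro S'
    simp only [scaledParam, Finset.prod_pow, Finset.prod_inv_distrib]
    rw [div_pow, inv_pow, inv_pow, inv_inv, div_eq_inv_mul]
  refine ⟨T, ⟨?_, ?_, ?_⟩, fun S' => ?_, ⟨S, hS⟩, ⟨hm₀S, hm₁S⟩, ?_, ?_⟩
  · refine (pi_norm_le_iff_of_nonneg (Finset.sum_nonneg fun S _ => Finset.sum_nonneg fun m _ =>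
      Finset.sum_nonneg fun m' _ => hD0 S m m')).2 fun m => ?_
    have hle : ∑ m', D ⟨S, hS⟩ m m' ≤ ∑ S, ∑ m, ∑ m', D S m m' :=
      (Finset.single_le_sum (f := fun m => ∑ m', D ⟨S, hS⟩ m m')
        (fun m _ => Finset.sum_nonneg fun m' _ => hD0 _ m m') (Finset.mem_univ m)).trans
      (Finset.single_le_sum (f := fun S => ∑ m, ∑ m', D S m m')
        (fun S _ => Finset.sum_nonneg fun m _ => Finset.sum_nonneg fun m' _ => hD0 S m m')
        (Finset.mem_univ (⟨S, hS⟩ : topCells Δ w)))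
    refine le_trans (ContinuousLinearMap.opNorm_le_bound _
      (Finset.sum_nonneg fun m' _ => hD0 ⟨S, hS⟩ m m') fun v => ?_) hle
    have h2 : (scaledParam w L R S (T : toricLie m₀ m₁ →L[ℂ] toricLie m₀ m₁) p).1 m v =
        ((R m : ℂ)⁻¹) * charFunctional m₀ m₁ m (scaleMap S (e ⟨S, hS⟩) R v) := by
      simp only [scaledParam, smul_apply, ContinuousLinearMap.comp_apply, smul_eq_mul,
        ContinuousLinearEquiv.coe_coe, hT]
    rw [h2, charFunctional_scaleMap hm₁S heS, Finset.mul_sum, Finset.sum_mul]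
    refine (norm_sum_le _ _).trans ?_
    refine (Finset.sum_le_sum (g := fun m' => D ⟨S, hS⟩ m m' * ‖v‖) fun m' hm' => ?_).trans
      (Finset.sum_le_sum_of_subset_of_nonneg (Finset.subset_univ _)
        fun m' _ _ => mul_nonneg (hD0 _ _ _) (norm_nonneg _))
    have hm'S : (m' : Fin l → ℤ) ∈ S := by simpa [subCell] using hm'
    have h3 : (R m)⁻¹ * (R m' * |pairing ((m : Fin l → ℤ) - m₀) (e ⟨S, hS⟩ m')|) ≤
        C * |pairing ((m : Fin l → ℤ) - m₀) (e ⟨S, hS⟩ m')| := by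
      -- A nonzero coefficient of `m - m₀` along the dual vector of `m'` witnesses that `m` is off
      -- the span of `S \ {m'}`. The exchange hypothesis then controls the ratio `R m' / R m`.
      by_cases h0 : pairing ((m : Fin l → ℤ) - m₀) (e ⟨S, hS⟩ m') = 0
      · rw [h0]; simp
      · have h4 : R m' ≤ C * R m := hex m' hm'S m'.prop_mem.2.1 m'.prop_mem.2.2 m m.prop_mem.1
          ⟨e ⟨S, hS⟩ m', fun a ha => heS.zero m' hm'S m'.prop_mem.2.1 a
            (Finset.mem_of_mem_erase ha) (Finset.ne_of_mem_erase ha), h0⟩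
        rw [← mul_assoc]
        refine mul_le_mul_of_nonneg_right ?_ (abs_nonneg _)
        rw [inv_mul_le_iff₀ (hRpos m)]
        linarith
    have h5 : ‖charFunctional m₀ m₁ m' v‖ ≤ ‖charFunctional m₀ m₁ (m' : Fin l → ℤ)‖ * ‖v‖ :=
      (charFunctional m₀ m₁ (m' : Fin l → ℤ)).le_opNorm v
    rw [norm_mul, norm_mul, norm_inv, Complex.norm_real, Complex.norm_real,
      Real.norm_of_nonneg (hRpos m).le, Real.norm_eq_abs, abs_mul, abs_of_pos (hRpos m'),
      ← mul_assoc]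
    calc _ ≤ C * |pairing ((m : Fin l → ℤ) - m₀) (e ⟨S, hS⟩ m')| *
          (‖charFunctional m₀ m₁ (m' : Fin l → ℤ)‖ * ‖v‖) :=
          mul_le_mul h3 h5 (norm_nonneg _) (by have : 0 ≤ C := zero_le_one.trans hC
                                               positivity)
      _ = D ⟨S, hS⟩ m m' * ‖v‖ := by simp only [hD]; ring
  · refine (pi_norm_le_iff_of_nonneg zero_le_one).2 fun m => ?_
    have h2 : R m = 2 * tilt w m₀ (-L.re) (momentMap p) m := hatA_eq w L m₀ m hp
    simp only [scaledParam]
    rw [norm_mul, norm_charVal w L m₀ m hp, Complex.norm_real, Real.norm_of_nonneg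
      (Real.exp_nonneg _), ← Real.exp_add, h2]
    simp
  · refine (pi_norm_le_iff_of_nonneg (by positivity)).2 fun S' => ?_
    have hS'Δ := (mem_topCells.1 S'.2).1.2.1
    rw [hq, Real.norm_of_nonneg (sq_nonneg _)]
    have h3 := prod_le_prod_of_exchange hsimp hS S'.2 hm₀S hm₁S hC
      (f := fun m => hatA w L m₀ m p) (fun m hm h0 h1' => h1 ⟨m, by simp [hm, h0, h1']⟩) hex
    have h4 := prod_subCell (m₀ := m₀) (m₁ := m₁) hSΔ fun m => hatA w L m₀ m p
    have h5 := prod_subCell (m₀ := m₀) (m₁ := m₁) hS'Δ fun m => hatA w L m₀ m p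
    have h6 : ∏ m ∈ subCell Δ m₀ m₁ S, R m ≤
        C ^ (l + 1) * ∏ m ∈ subCell Δ m₀ m₁ (S' : Finset (Fin l → ℤ)), R m := by
      simp only [hR]
      rw [h4, h5]
      convert h3
    refine pow_le_pow_left₀ (div_nonneg (hprodpos _).le (hprodpos _).le) ?_ 2
    rwa [div_le_iff₀ (hprodpos _)]
  · rw [hq]; positivity
  · rw [hq, div_self (hprodpos _).ne', one_pow]
  · intro m hm
    ext v
    simp only [scaledParam, smul_apply, ContinuousLinearMap.comp_apply, smul_eq_mul,
      ContinuousLinearEquiv.coe_coe, hT]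
    rw [charFunctional_scaleMap_of_mem hm₁S heS R hm,
      inv_mul_cancel_left₀ (Complex.ofReal_ne_zero.2 (hRpos m).ne')]

end Matching

/-! ### Uniform comparison of the two metrics. -/

section Comparison

variable {l : ℕ} {Δ : Finset (Fin l → ℤ)} {w : (Fin l → ℤ) → ℝ} {m₀ m₁ : Fin l → ℤ}

/-- The point of `X_t` near the maximal degeneracy point that corresponds to a point of `T̂`. -/
def solutionPoint (w : (Fin l → ℤ) → ℝ) (L : ℂ) (m₀ : Fin l → ℤ) (e : Fin l → ℝ)
    (Λ : (Rest Δ m₀ m₁ → ℂ) → ℂ) (p : Fin l → ℂ) : Fin l → ℂ :=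
  torusExp (Λ (fun m => charVal w L m₀ p m) • toComplex e) p

lemma contDiff_charVal_torusExp (L : ℂ) (p : Fin l → ℂ) :
    ContDiff ℂ ∞ fun v : toricLie m₀ m₁ => fun m : Rest Δ m₀ m₁ =>
      charVal w L m₀ (torusExp (v : Fin l → ℂ) p) m := by
  refine contDiff_pi.2 fun m => ?_
  simp only [charVal_torusExp]
  exact contDiff_const.mul (charFunctional m₀ m₁ m).contDiff.cexp

lemma differentiable_torusExp (p : Fin l → ℂ) :
    Differentiable ℂ fun v : toricLie m₀ m₁ => torusExp (v : Fin l → ℂ) p := by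
  refine differentiable_pi.2 fun i => ?_
  have h : Differentiable ℂ fun v : toricLie m₀ m₁ => (v : Fin l → ℂ) i :=
    ((ContinuousLinearMap.proj i).comp (toricLie m₀ m₁).subtypeL).differentiable
  exact h.cexp.mul_const _

lemma eventually_isIdentified (hsimp : IsSimplicial Δ w) (hm₀ : m₀ ∈ Δ) (hm₁ : m₁ ∈ Δ)
    (hne : m₀ ≠ m₁) (hw₀ : w m₀ = 0) (hw₁ : w m₁ = 0) {S : Finset (Fin l → ℤ)}
    (hS : S ∈ topCells Δ w) (hm₀S : m₀ ∈ S) {e : Fin l → ℝ} (he : IsTransverse m₀ m₁ S e)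
    {δ : ℝ} {Λ : (Rest Δ m₀ m₁ → ℂ) → ℂ}
    (hΛ : ∀ z ∈ Metric.ball (0 : Rest Δ m₀ m₁ → ℂ) δ, ContDiffAt ℂ ∞ Λ z ∧ ‖Λ z‖ < 1 ∧
      ∀ s : ℂ, ‖s‖ < 1 → (localEquation (fun m : Rest Δ m₀ m₁ =>
        pairing ((m : Fin l → ℤ) - m₀) e) z s = 0 ↔ s = Λ z))
    {L : ℂ} {p : Fin l → ℂ} (hp : p ∈ toricTorus m₀ m₁)
    (hz : (fun m : Rest Δ m₀ m₁ => charVal w L m₀ p m) ∈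
      Metric.ball (0 : Rest Δ m₀ m₁ → ℂ) δ) :
    ∀ᶠ v : toricLie m₀ m₁ in 𝓝 0,
      (∃! x, IsIdentified Δ w L m₀ m₁ S (torusExp (v : Fin l → ℂ) p) x) ∧
      identification Δ w L m₀ m₁ S (torusExp (v : Fin l → ℂ) p) =
        solutionPoint w L m₀ e Λ (torusExp (v : Fin l → ℂ) p) ∧
      DifferentiableAt ℂ (fun v' : toricLie m₀ m₁ =>
        solutionPoint w L m₀ e Λ (torusExp (v' : Fin l → ℂ) p)) v := by
  have hchar := contDiff_charVal_torusExp (Δ := Δ) (w := w) (m₀ := m₀) (m₁ := m₁) L p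
  have h0 : torusExp ((0 : toricLie m₀ m₁) : Fin l → ℂ) p = p := by
    funext i; simp [torusExp]
  have hev : ∀ᶠ v : toricLie m₀ m₁ in 𝓝 0, (fun m : Rest Δ m₀ m₁ =>
      charVal w L m₀ (torusExp (v : Fin l → ℂ) p) m) ∈
        Metric.ball (0 : Rest Δ m₀ m₁ → ℂ) δ := by
    refine hchar.continuous.continuousAt.eventually_mem (Metric.isOpen_ball.mem_nhds ?_)
    rwa [h0]
  filter_upwards [hev] with v hv
  obtain ⟨hΛs, hΛ1, hΛu⟩ := hΛ _ hv
  have hiff := isIdentified_iff hsimp hm₀ hm₁ hne hw₀ hw₁ hS hm₀S he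
    (torusExp_mem_toricTorus hp v.2) hΛ1 hΛu
  have hex : IsIdentified Δ w L m₀ m₁ S (torusExp (v : Fin l → ℂ) p)
      (solutionPoint w L m₀ e Λ (torusExp (v : Fin l → ℂ) p)) := (hiff _).2 rfl
  refine ⟨⟨_, hex, fun x hx => (hiff x).1 hx⟩,
    (hiff _).1 (Classical.epsilon_spec (p := IsIdentified Δ w L m₀ m₁ S _) ⟨_, hex⟩), ?_⟩
  have hcomp : DifferentiableAt ℂ (fun v' : toricLie m₀ m₁ =>
      Λ (fun m : Rest Δ m₀ m₁ => charVal w L m₀ (torusExp (v' : Fin l → ℂ) p) m)) v :=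
    (hΛs.differentiableAt (by simp)).comp v (hchar.differentiable (by simp) v)
  refine differentiableAt_pi.2 fun i => ?_
  have h2 := differentiableAt_pi.1 (differentiable_torusExp (m₀ := m₀) (m₁ := m₁) p v) i
  exact (hcomp.mul_const (toComplex e i)).cexp.mul h2

/-- The inequality for `τ - μ` holds at every lattice point, not only in the link, and passing from
`τ - μ` to `τ` adds `μ * w m`. Shrinking the polyhedron is thus what makes all the scales large. -/
lemma mul_le_tilt_of_mem_toricRegion (hm₀ : m₀ ∈ Δ) (hm₁ : m₁ ∈ Δ) (hw₀ : w m₀ = 0)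
    (hw₁ : w m₁ = 0) (hw : ∀ m ∈ Δ, 0 ≤ w m) {τ μ : ℝ} (hτ : μ < τ) {p : Fin l → ℂ}
    (hp : p ∈ toricRegion Δ w m₀ m₁ (τ - μ)) {m : Fin l → ℤ} (hm : m ∈ Δ) :
    μ * w m ≤ tilt w m₀ τ (momentMap p) m := by
  have h := tilt_nonneg_of_mem_polyhedron (sub_pos.2 hτ) hm₀ hm₁ hw₀ hw₁ hw hp.2 hm
  unfold tilt at h ⊢
  linarith

/-- The scales for which the model metrics are regular. -/
lemma exists_regular_scale (hsimp : IsSimplicial Δ w) {κ : ℝ} (hκ : 0 < κ) (e : Fin l → ℝ)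
    {δ : ℝ} (hδ : 0 < δ) {Λ : (Rest Δ m₀ m₁ → ℂ) → ℂ} (hΛ0 : Λ 0 = 0)
    (hΛ : ∀ z ∈ Metric.ball (0 : Rest Δ m₀ m₁ → ℂ) δ, ContDiffAt ℂ ∞ Λ z) (C₁ C₂ : ℝ) :
    ∃ ρ : ℝ, 0 < ρ ∧ ∀ θ ∈ paramSet Δ w m₀ m₁ C₁ C₂, ∀ r : Rest Δ m₀ m₁ → ℝ,
      (∀ m, 0 ≤ r m ∧ r m ≤ ρ) →
      (IsRegularAt (fun θ => kahlerMetric (toricModel Δ w m₀ m₁ θ)) ((θ, r), 0) ∧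
        ∀ᶠ y in 𝓝 0, ContDiffAt ℝ ∞ (toricModel Δ w m₀ m₁ (θ, r)) y ∧
          0 < modelSum (fun S' : topCells Δ w => subCell Δ m₀ m₁ S') (toricWeight Δ w m₀ m₁)
            (fun _ _ => 0) (θ, r) y) ∧
      IsRegularAt (fun θ => kahlerMetric (approxModel Δ w m₀ m₁ κ e Λ θ)) ((θ, r), 0) ∧
        ∀ᶠ y in 𝓝 0, ContDiffAt ℝ ∞ (approxModel Δ w m₀ m₁ κ e Λ (θ, r)) y ∧
          0 < modelSum (fun S' : topCells Δ w => subCell Δ m₀ m₁ S')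
            (fun S' => edgeWeight κ (fun m => pairing (m - m₀) e) Λ (S' : Finset (Fin l → ℤ)))
            (fun m => shift κ (fun m => pairing (m - m₀) e) Λ m) (θ, r) y := by
  obtain ⟨hedge, δ', hδ', hsm⟩ := exists_smooth_radius hκ m₀ m₁ e hδ hΛ0 hΛ
  have hK := isCompact_paramSet (Δ := Δ) (w := w) (m₀ := m₀) (m₁ := m₁) C₁ C₂
  have hinj : ∀ θ ∈ paramSet Δ w m₀ m₁ C₁ C₂, ∃ S : topCells Δ w,
      (m₀ ∈ (S : Finset (Fin l → ℤ)) ∧ m₁ ∈ (S : Finset (Fin l → ℤ))) ∧ θ.2.2 S = 1 ∧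
      ∀ v, (∀ m ∈ subCell Δ m₀ m₁ S, θ.1 m v = 0) → v = 0 := by
    rintro θ ⟨-, -, S, hS, hS1, hSc⟩
    refine ⟨S, hS, hS1, fun v hv => eq_of_charFunctional_eq hsimp S.2 hS.1 fun m hm => ?_⟩
    rw [← hSc m hm, hv m hm, map_zero]
  obtain ⟨ρ, hρ, h1⟩ := exists_isRegularAt_modelPotential (δ := 1) one_pos
    (sub := fun S' : topCells Δ w => subCell Δ m₀ m₁ S') (H := fun _ => 0)
    (N := toricWeight Δ w m₀ m₁) (B := fun _ _ => 0)
    (fun _ _ => contDiffAt_const) (fun _ _ _ => contDiffAt_const) (fun _ _ _ => contDiffAt_const)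
    hK (fun θ hθ S => mul_nonneg (hθ.2.1 S) (by unfold toricWeight; split_ifs <;> norm_num))
    (fun θ hθ => by
      obtain ⟨S, hS, hS1, hv⟩ := hinj θ hθ
      exact ⟨S, by simp [hS1, toricWeight, hS], hv⟩)
  obtain ⟨ρ', hρ', h2⟩ := exists_isRegularAt_modelPotential hδ'
    (sub := fun S' : topCells Δ w => subCell Δ m₀ m₁ S') (H := smoothPart m₀ e Λ)
    (N := fun S' => edgeWeight κ (fun m => pairing (m - m₀) e) Λ (S' : Finset (Fin l → ℤ)))
    (B := fun m => shift κ (fun m => pairing (m - m₀) e) Λ m)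
    (fun z hz => (hsm z hz).1) (fun S z hz => (hsm z hz).2.2 S) (fun m z hz => (hsm z hz).2.1 m)
    hK (fun θ hθ S => mul_nonneg (hθ.2.1 S) (hedge S).le)
    (fun θ hθ => by
      obtain ⟨S, hS, hS1, hv⟩ := hinj θ hθ
      exact ⟨S, by rw [hS1, one_mul]; exact hedge S, hv⟩)
  exact ⟨min ρ ρ', lt_min hρ hρ', fun θ hθ r hr =>
    ⟨h1 θ hθ r fun m => ⟨(hr m).1, (hr m).2.trans (min_le_left _ _)⟩,
      h2 θ hθ r fun m => ⟨(hr m).1, (hr m).2.trans (min_le_right _ _)⟩⟩⟩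

lemma pullback_toricMetric {L : ℂ} {p : Fin l → ℂ} (hp : p ∈ toricTorus m₀ m₁)
    (v : toricLie m₀ m₁) (S : Finset (Fin l → ℤ)) (T : toricLie m₀ m₁ ≃L[ℂ] toricLie m₀ m₁)
    {R : Rest Δ m₀ m₁ → ℝ} (hR : ∀ m, 0 < R m)
    (hRp : ∀ m : Rest Δ m₀ m₁, hatA w L m₀ m (torusExp (v : Fin l → ℂ) p) = R m)
    (hreg : ∀ᶠ y in 𝓝 0, ContDiffAt ℝ ∞ (toricModel Δ w m₀ m₁
        (scaledParam w L R S T (torusExp (v : Fin l → ℂ) p), fun m => (R m)⁻¹)) y ∧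
      0 < modelSum (fun S' : topCells Δ w => subCell Δ m₀ m₁ S') (toricWeight Δ w m₀ m₁)
        (fun _ _ => 0) (scaledParam w L R S T (torusExp (v : Fin l → ℂ) p), fun m => (R m)⁻¹) y) :
    pullbackMetric (T.restrictScalars ℝ) v (toricMetric Δ w L m₀ m₁ p) =ᶠ[𝓝 0]
      kahlerMetric (toricModel Δ w m₀ m₁
        (scaledParam w L R S T (torusExp (v : Fin l → ℂ) p), fun m => (R m)⁻¹)) := by
  rw [toricMetric, pullbackMetric_kahlerMetric]
  refine kahlerMetric_add_affine (A := 0)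
    (c := Real.log (∏ m ∈ subCell Δ m₀ m₁ S, ((R m)⁻¹) ^ 2)) (hreg.mono fun y hy => hy.1) ?_
  filter_upwards [hreg] with y hy
  rw [Submodule.coe_add, torusExp_add]
  exact (toricPotential_eq_model hR S T (torusExp_ne_zero _ hp.1) hRp hy.2).trans (by simp)

lemma pullback_approxMetric (hm₀ : m₀ ∈ Δ) (hm₁ : m₁ ∈ Δ) (hne : m₀ ≠ m₁) (hw₀ : w m₀ = 0)
    (hw₁ : w m₁ = 0) {e : Fin l → ℝ} (he : pairing (m₁ - m₀) e = 1) {κ : ℝ} (hκ : 0 < κ)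
    {Λ : (Rest Δ m₀ m₁ → ℂ) → ℂ} {Sstar : Finset (Fin l → ℤ)}
    {L : ℂ} {p : Fin l → ℂ} (hp : p ∈ toricTorus m₀ m₁)
    (v : toricLie m₀ m₁) (S : Finset (Fin l → ℤ)) (T : toricLie m₀ m₁ ≃L[ℂ] toricLie m₀ m₁)
    {R : Rest Δ m₀ m₁ → ℝ} (hR : ∀ m, 0 < R m)
    (hRp : ∀ m : Rest Δ m₀ m₁, hatA w L m₀ m (torusExp (v : Fin l → ℂ) p) = R m)
    (hid : ∀ᶠ u : toricLie m₀ m₁ in 𝓝 0, identification Δ w L m₀ m₁ Sstar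
        (torusExp (u : Fin l → ℂ) (torusExp (v : Fin l → ℂ) p)) =
      solutionPoint w L m₀ e Λ (torusExp (u : Fin l → ℂ) (torusExp (v : Fin l → ℂ) p)))
    (hreg : ∀ᶠ y in 𝓝 0, ContDiffAt ℝ ∞ (approxModel Δ w m₀ m₁ κ e Λ
        (scaledParam w L R S T (torusExp (v : Fin l → ℂ) p), fun m => (R m)⁻¹)) y ∧
      0 < modelSum (fun S' : topCells Δ w => subCell Δ m₀ m₁ S')
        (fun S' => edgeWeight κ (fun m => pairing (m - m₀) e) Λ (S' : Finset (Fin l → ℤ)))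
        (fun m => shift κ (fun m => pairing (m - m₀) e) Λ m)
        (scaledParam w L R S T (torusExp (v : Fin l → ℂ) p), fun m => (R m)⁻¹) y) :
    pullbackMetric (T.restrictScalars ℝ) v (approxMetric Δ w κ L m₀ m₁ Sstar p) =ᶠ[𝓝 0]
      kahlerMetric (approxModel Δ w m₀ m₁ κ e Λ
        (scaledParam w L R S T (torusExp (v : Fin l → ℂ) p), fun m => (R m)⁻¹)) := by
  rw [approxMetric, pullbackMetric_kahlerMetric]
  have hT : Filter.Tendsto T (𝓝 0) (𝓝 0) := by
    simpa using T.continuous.tendsto 0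
  refine kahlerMetric_add_affine
    (A := (2 : ℝ) • Complex.reCLM.comp
      (((pairingFunctional m₀ m₁ m₀).comp (T : toricLie m₀ m₁ →L[ℂ] toricLie m₀ m₁)).restrictScalars
        ℝ))
    (c := Real.log (κ ^ 2) + Real.log (∏ m ∈ subCell Δ m₀ m₁ S, ((R m)⁻¹) ^ 2) +
      2 * Real.log ‖monomial m₀ (torusExp (v : Fin l → ℂ) p)‖) (hreg.mono fun y hy => hy.1) ?_
  filter_upwards [hreg, hT.eventually hid] with y hy hidy
  rw [Submodule.coe_add, torusExp_add, hidy]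
  exact approxPotential_eq_model hm₀ hm₁ hne hw₀ hw₁ he hκ hR S T
    (torusExp_mem_toricTorus hp v.2) hRp Λ hy.2

/-- The order of choices matters: the radius `δ` of the solution, the exchange constant and the
compact parameter set come before the scale bound `ρ`, and `μ` comes after all of these. The cell
`Sstar` defines the identification throughout, while the cell used for rescaling varies with the
point. -/
theorem exists_comparison (hΔ : IsIntegralPolytope Δ) (hsimp : IsSimplicial Δ w) {κ : ℝ}
    (hκ : 0 < κ) (hne : m₀ ≠ m₁) (hm₀ : m₀ ∈ Δ) (hm₁ : m₁ ∈ Δ) {Sstar : Finset (Fin l → ℤ)}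
    (hS : Sstar ∈ topCells Δ w) (hm₀S : m₀ ∈ Sstar) (hm₁S : m₁ ∈ Sstar) (hw₀ : w m₀ = 0)
    (hw₁ : w m₁ = 0) (hw : ∀ m ∈ Δ, m ≠ m₀ → m ≠ m₁ → 0 < w m) :
    ∃ μ : ℝ, 0 < μ ∧ ∃ τ₀ : ℝ,
      (∀ L : ℂ, τ₀ ≤ -L.re → ∀ p ∈ toricRegion Δ w m₀ m₁ (-L.re - μ),
        ∀ᶠ v : toricLie m₀ m₁ in 𝓝 0,
          (∃! x, IsIdentified Δ w L m₀ m₁ Sstar (torusExp (v : Fin l → ℂ) p) x) ∧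
          DifferentiableAt ℂ (fun v' : toricLie m₀ m₁ =>
            identification Δ w L m₀ m₁ Sstar (torusExp (v' : Fin l → ℂ) p)) v) ∧
      UniformlyCInftyQuasiIsometric
        {i : ℂ × (Fin l → ℂ) | τ₀ ≤ -i.1.re ∧ i.2 ∈ toricTorus m₀ m₁}
        (fun i => {v : toricLie m₀ m₁ |
          torusExp (v : Fin l → ℂ) i.2 ∈ toricRegion Δ w m₀ m₁ (-i.1.re - μ)})
        (fun i => toricMetric Δ w i.1 m₀ m₁ i.2)
        (fun i => approxMetric Δ w κ i.1 m₀ m₁ Sstar i.2) := by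
  have hwnn : ∀ m ∈ Δ, 0 ≤ w m := by
    intro m hm
    by_cases h0 : m = m₀
    · rw [h0, hw₀]
    by_cases h1 : m = m₁
    · rw [h1, hw₁]
    exact (hw m hm h0 h1).le
  obtain ⟨es, hes⟩ := exists_dualBasis hsimp hS hm₀S
  set e := es m₁ with he_def
  have he : IsTransverse m₀ m₁ Sstar e :=
    ⟨(hes m₁ hm₁S hne.symm).1, (hes m₁ hm₁S hne.symm).2⟩
  obtain ⟨δ, Λ, hδ, hΛ0, hΛ⟩ := exists_localSolution
    (fun m : Rest Δ m₀ m₁ => pairing ((m : Fin l → ℤ) - m₀) e)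
  obtain ⟨C, hC, hcell⟩ := exists_minimal_topCell hΔ hsimp hm₀ hm₁ hw₀ hw₁
  obtain ⟨C₁, C₂, hparam⟩ := exists_scaledParam_mem (m₀ := m₀) (m₁ := m₁) hsimp (max C 1)
    (le_max_right _ _)
  obtain ⟨ρ, hρ, hreg⟩ := exists_regular_scale (m₀ := m₀) (m₁ := m₁) hsimp hκ e hδ hΛ0
    (fun z hz => (hΛ z hz).1) C₁ C₂
  obtain ⟨β, hβ, hβw⟩ : ∃ β : ℝ, 0 < β ∧ ∀ m : Rest Δ m₀ m₁, β ≤ w m := by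
    rcases isEmpty_or_nonempty (Rest Δ m₀ m₁) with h | h
    · exact ⟨1, one_pos, fun m => isEmptyElim m⟩
    · obtain ⟨m', hm'⟩ := Finite.exists_min fun m : Rest Δ m₀ m₁ => w m
      exact ⟨w m', hw _ m'.prop_mem.1 m'.prop_mem.2.1 m'.prop_mem.2.2, hm'⟩
  -- The three terms ensure `1 ≤ hatA`, `1 / hatA ≤ ρ`, and `exp (-tilt) < δ` through `1 + tilt ≤
  -- exp tilt`. Division by the minimum `β` of `w` away from `m₀`, `m₁` turns `c` into `μ`.
  set c := 1 + 1 / ρ + 1 / δ with hc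
  have hρ' : 0 < 1 / ρ := one_div_pos.2 hρ
  have hδ' : 0 < 1 / δ := one_div_pos.2 hδ
  have hc0 : 0 < c := by positivity
  have hμ : 0 < c / β := div_pos hc0 hβ
  have htilt : ∀ L : ℂ, c / β + 1 ≤ -L.re → ∀ p ∈ toricRegion Δ w m₀ m₁ (-L.re - c / β),
      ∀ m : Rest Δ m₀ m₁, c ≤ tilt w m₀ (-L.re) (momentMap p) m := by
    intro L hL p hp m
    refine le_trans ?_ (mul_le_tilt_of_mem_toricRegion hm₀ hm₁ hw₀ hw₁ hwnn (by linarith) hp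
      m.prop_mem.1)
    calc c = c / β * β := (div_mul_cancel₀ c hβ.ne').symm
      _ ≤ _ := mul_le_mul_of_nonneg_left (hβw m) hμ.le
  have hball : ∀ L : ℂ, c / β + 1 ≤ -L.re → ∀ p ∈ toricRegion Δ w m₀ m₁ (-L.re - c / β),
      (fun m : Rest Δ m₀ m₁ => charVal w L m₀ p m) ∈
        Metric.ball (0 : Rest Δ m₀ m₁ → ℂ) δ := by
    intro L hL p hp
    rw [mem_ball_zero_iff, pi_norm_lt_iff hδ]
    intro m
    rw [norm_charVal w L m₀ m hp.1.1, Real.exp_neg, inv_lt_comm₀ (Real.exp_pos _) hδ, ← one_div]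
    have h1 := htilt L hL p hp m
    have h2 := Real.add_one_le_exp (tilt w m₀ (-L.re) (momentMap p) m)
    linarith
  have hident := fun (L : ℂ) (hL : c / β + 1 ≤ -L.re) (p : Fin l → ℂ)
    (hp : p ∈ toricRegion Δ w m₀ m₁ (-L.re - c / β)) =>
    eventually_isIdentified hsimp hm₀ hm₁ hne hw₀ hw₁ hS hm₀S he hΛ hp.1 (hball L hL p hp)
  -- The choice `τ₀ = μ + 1` keeps `τ - μ` positive, as required to pass from the link to all
  -- lattice points.
  refine ⟨c / β, hμ, c / β + 1, fun L hL p hp => ?_, ?_⟩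
  · filter_upwards [(hident L hL p hp).eventually_nhds] with v hv
    obtain ⟨h1, -, h3⟩ := hv.self_of_nhds
    exact ⟨h1, h3.congr_of_eventuallyEq (hv.mono fun y hy => hy.2.1)⟩
  · have hΘ : IsCompact (paramSet Δ w m₀ m₁ C₁ C₂ ×ˢ
        Set.Icc (0 : Rest Δ m₀ m₁ → ℝ) fun _ => ρ) :=
      (isCompact_paramSet C₁ C₂).prod isCompact_Icc
    have hreg' := fun (θ : _ × (Rest Δ m₀ m₁ → ℝ))
      (hθ : θ ∈ paramSet Δ w m₀ m₁ C₁ C₂ ×ˢ Set.Icc (0 : Rest Δ m₀ m₁ → ℝ) fun _ => ρ) =>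
      hreg θ.1 hθ.1 θ.2 fun m => ⟨hθ.2.1 m, hθ.2.2 m⟩
    refine uniformlyCInftyQuasiIsometric_of_compact hΘ (fun θ hθ => (hreg' θ hθ).1.1)
      (fun θ hθ => (hreg' θ hθ).2.1) ?_
    rintro ⟨L, p⟩ ⟨hL, hp⟩ v hv
    simp only [Set.mem_ofPred_eq] at hL hp hv
    have ht := htilt L hL _ hv
    have hp₀ := hv.1.1
    have hA : ∀ m : Rest Δ m₀ m₁, hatA w L m₀ m (torusExp (v : Fin l → ℂ) p) =
        2 * tilt w m₀ (-L.re) (momentMap (torusExp (v : Fin l → ℂ) p)) m :=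
      fun m => hatA_eq w L m₀ m hp₀
    have hA' : ∀ m : Rest Δ m₀ m₁, c ≤ hatA w L m₀ m (torusExp (v : Fin l → ℂ) p) := by
      intro m
      have := ht m
      rw [hA]; linarith
    have hApos : ∀ m : Rest Δ m₀ m₁, 0 < hatA w L m₀ m (torusExp (v : Fin l → ℂ) p) :=
      fun m => hc0.trans_le (hA' m)
    obtain ⟨S, hST, h0S, h1S, hmin⟩ := hcell (-L.re) (momentMap (torusExp (v : Fin l → ℂ) p))
      (by linarith) hv.2.1 fun m hm h0 h1 => hc0.trans_le (ht ⟨m, by simp [hm, h0, h1]⟩)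
    obtain ⟨T, hT⟩ := hparam L (torusExp (v : Fin l → ℂ) p) hp₀
      (fun m => le_trans (by linarith) (hA' m)) S hST h0S h1S fun m' hm' h0 h1 m hm hoff => by
        rw [hatA_eq w L m₀ m' hp₀, hatA_eq w L m₀ m hp₀]
        have h2 := hmin m' hm' h0 h1 m hm hoff
        have h3 := mul_le_mul_of_nonneg_right (le_max_left C 1)
          ((mul_nonneg hμ.le (hwnn m hm)).trans (mul_le_tilt_of_mem_toricRegion hm₀ hm₁ hw₀ hw₁
            hwnn (by linarith) hv hm))
        linarith
    have hr : (fun m : Rest Δ m₀ m₁ => (hatA w L m₀ m (torusExp (v : Fin l → ℂ) p))⁻¹) ∈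
        Set.Icc (0 : Rest Δ m₀ m₁ → ℝ) fun _ => ρ := by
      refine ⟨fun m => (inv_pos.2 (hApos m)).le, fun m => ?_⟩
      refine inv_le_of_inv_le₀ hρ ?_
      rw [← one_div]
      exact le_trans (by linarith) (hA' m)
    have hr' := hreg' (_, _) ⟨hT, hr⟩
    refine ⟨(_, _), ⟨hT, hr⟩, T.restrictScalars ℝ, ?_, ?_⟩
    · exact pullback_toricMetric hp v S T hApos (fun _ => rfl) hr'.1.2
    · exact pullback_approxMetric hm₀ hm₁ hne hw₀ hw₁ he.one hκ hp v S T hApos (fun _ => rfl)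
        ((hident L hL _ hv).mono fun u hu => hu.2.1) hr'.2.2

end Comparison

end ToricDegeneration

end

open ToricDegeneration in
theorem lemma8p1 {l : ℕ} (Δ : Finset (Fin l → ℤ)) (w₀ : (Fin l → ℤ) → ℝ)
    (hΔ : IsIntegralPolytope Δ) (hconv : IsConvexOn Δ w₀) (hsimp : IsSimplicial Δ w₀) :
    ∃ κ₀ : ℝ, 0 < κ₀ ∧ ∀ κ : ℝ, κ₀ ≤ κ →
    -- the maximal degeneracy point and the simplex that gives the coordinates
    ∀ m₀ m₁ : Fin l → ℤ, m₀ ≠ m₁ → IsCell Δ w₀ {m₀, m₁} →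
    ∀ Sstar ∈ topCells Δ w₀, m₀ ∈ Sstar → m₁ ∈ Sstar →
    -- the normalization of `w₀` by an affine function
    ∀ w : (Fin l → ℤ) → ℝ,
      (∃ (c : ℝ) (b : Fin l → ℝ), ∀ m ∈ Δ, w m = w₀ m + (c + pairing m b)) →
      w m₀ = 0 → w m₁ = 0 → (∀ m ∈ Δ, m ≠ m₀ → m ≠ m₁ → 0 < w m) →
    ∃ μ : ℝ, 0 < μ ∧ ∃ τ₀ : ℝ,
      -- the identification with `X_t` is well defined and holomorphic near `F⁻¹(Δ_{τ - μ})`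
      (∀ L : ℂ, τ₀ ≤ -L.re → ∀ p ∈ toricRegion Δ w m₀ m₁ (-L.re - μ),
        ∀ᶠ v : toricLie m₀ m₁ in 𝓝 0,
          (∃! x, IsIdentified Δ w L m₀ m₁ Sstar (torusExp (v : Fin l → ℂ) p) x) ∧
          DifferentiableAt ℂ (fun v' : toricLie m₀ m₁ =>
            identification Δ w L m₀ m₁ Sstar (torusExp (v' : Fin l → ℂ) p)) v) ∧
      UniformlyCInftyQuasiIsometric
        {i : ℂ × (Fin l → ℂ) | τ₀ ≤ -i.1.re ∧ i.2 ∈ toricTorus m₀ m₁}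
        (fun i => {v : toricLie m₀ m₁ |
          torusExp (v : Fin l → ℂ) i.2 ∈ toricRegion Δ w m₀ m₁ (-i.1.re - μ)})
        (fun i => toricMetric Δ w i.1 m₀ m₁ i.2)
        (fun i => approxMetric Δ w κ i.1 m₀ m₁ Sstar i.2) := by
  -- Only positivity of `κ` matters near the degeneracy point, since `μ` is chosen after `κ`; the
  -- bound `1` is arbitrary.
  refine ⟨1, one_pos, fun κ hκ m₀ m₁ hne hcell Sstar hS hm₀S hm₁S w hw hw₀ hw₁ hpos => ?_⟩
  have hsub := (mem_topCells.1 hS).1.2.1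
  exact exists_comparison hΔ (fun S hS' => hsimp S ((isCell_iff hw).2 hS'))
    (one_pos.trans_le hκ) hne (hsub hm₀S) (hsub hm₁S)
    (mem_topCells.2 ⟨(isCell_iff hw).1 (mem_topCells.1 hS).1, (mem_topCells.1 hS).2⟩)
    hm₀S hm₁S hw₀ hw₁ hpos
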